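/- Let $\mathbb D=\{z\in\mathbb C:|z|<1\}$ and let $F(a,b;c;x)=\sum_{n\ge 0}\frac{(a)_n(b)_n}{(c)_n}\frac{x^n}{n!}$ be the Gauss hypergeometric function. For real $\alpha,\beta$, a function $u\in C^2(\mathbb D)$ with complex values is called $(\alpha,\beta)$-harmonic if $$(1-|z|^2)\Big((1-|z|^2)u_{z\bar z}+\alpha z u_z+\beta\bar z u_{\bar z}-\alpha\beta u\Big)=0\quad\text{on }\mathbb D,$$ and sense-preserving if $|u_z|>|u_{\bar z}|$ on $\mathbb D$. Let $\mathcal H_{\alpha,\beta}$ be the set of pairs $(u,(c_k)_{k\in\mathbb Z})$ such that $u$ is a univalent (injective) sense-preserving $(\alpha,\beta)$-harmonic map of $\mathbb D$ onto $\mathbb D$ and $$u(z)=\sum_{k=0}^{\infty}c_kF(-\alpha,k-\beta;k+1;|z|^2)z^k+\sum_{k=1}^{\infty}c_{-k}F(-\beta,k-\alpha;k+1;|z|^2)\bar z^k\quad(z\in\mathbb D),$$ with complex $c_k$ satisfying $\limsup_{|k|\to\infty}|c_k|^{1/|k|}\le 1$. Put $$H_{\alpha,\beta}(c)=\left(\frac{\Gamma(1+\alpha+\beta)}{\Gamma(1+\alpha)\Gamma(1+\beta)}\right)^2\left(\frac{|c_1|^2}{(1+\alpha)^2}+\frac{3\sqrt3}{\pi}|c_0|^2+\frac{|c_{-1}|^2}{(1+\beta)^2}\right).$$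 (i) If $\alpha,\beta\in\mathbb R$ are not negative integers and $\alpha+\beta>-1$, then for every $(u,(c_k))\in\mathcal H_{\alpha,\beta}$ $$H_{\alpha,\beta}(c)\ge\frac{27}{4\pi^2}.$$ (ii) The lower bound is asymptotically sharp as $\alpha,\beta\to0$, in the following sense. For $\alpha=\beta=0$ it is sharp: for every $\varepsilon>0$ there is $(u,(c_k))\in\mathcal H_{0,0}$ with $H_{0,0}(c)<\frac{27}{4\pi^2}+\varepsilon$. Moreover, no larger constant will do for all $(\alpha,\beta)$ near the origin: for every $\varepsilon>0$ and every neighbourhood $N$ of $(0,0)$ in $\mathbb R^2$ there are $(\alpha,\beta)\in N\setminus\{(0,0)\}$ and $(u,(c_k))\in\mathcal H_{\alpha,\beta}$ with $H_{\alpha,\beta}(c)<\frac{27}{4\pi^2}+\varepsilon$. -/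

import Mathlib

open Set Filter Topology
open scoped ENNReal ComplexConjugate

noncomputable section

/-- The Wirtinger derivative `∂u/∂z = (∂u/∂x - i ∂u/∂y) / 2`. -/
def wirtingerDz (u : ℂ → ℂ) (z : ℂ) : ℂ :=
  (1 / 2 : ℂ) * (fderiv ℝ u z 1 - Complex.I * fderiv ℝ u z Complex.I)

/-- The Wirtinger derivative `∂u/∂z̄ = (∂u/∂x + i ∂u/∂y) / 2`. -/
def wirtingerDzbar (u : ℂ → ℂ) (z : ℂ) : ℂ :=
  (1 / 2 : ℂ) * (fderiv ℝ u z 1 + Complex.I * fderiv ℝ u z Complex.I)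

/-- The open unit disk. -/
abbrev unitDisk : Set ℂ := Metric.ball (0 : ℂ) 1

/-- The operator `L_{α,β}`. -/
def opL (α β : ℝ) (u : ℂ → ℂ) (z : ℂ) : ℂ :=
  (1 - (‖z‖ : ℂ) ^ 2) *
    ((1 - (‖z‖ : ℂ) ^ 2) * wirtingerDz (wirtingerDzbar u) z
      + (α : ℂ) * z * wirtingerDz u z
      + (β : ℂ) * conj z * wirtingerDzbar u z
      - (α : ℂ) * (β : ℂ) * u z)

/-- `u` is `(α,β)`-harmonic on the unit disk: it is of class `C²` there and `L_{α,β} u = 0`. -/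
def IsABHarmonic (α β : ℝ) (u : ℂ → ℂ) : Prop :=
  ContDiffOn ℝ 2 u unitDisk ∧ ∀ z ∈ unitDisk, opL α β u z = 0

/-- `u` is sense-preserving on the unit disk: `|u_z| > |u_z̄|` everywhere. -/
def IsSensePreserving (u : ℂ → ℂ) : Prop :=
  ∀ z ∈ unitDisk, ‖wirtingerDzbar u z‖ < ‖wirtingerDz u z‖

/-- The term `c_k F(-α, k-β; k+1; |z|²) z^k`, `k ≥ 0`, of the series. -/
def seriesTermPos (α β : ℝ) (c : ℤ → ℂ) (z : ℂ) (k : ℕ) : ℂ :=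
  c (k : ℤ) * ((ordinaryHypergeometric (-α) ((k : ℝ) - β) ((k : ℝ) + 1) (‖z‖ ^ 2) : ℝ) : ℂ)
    * z ^ k

/-- The term `c_{-k} F(-β, k-α; k+1; |z|²) z̄^k`, used for `k ≥ 1`, of the series. -/
def seriesTermNeg (α β : ℝ) (c : ℤ → ℂ) (z : ℂ) (k : ℕ) : ℂ :=
  c (-(k : ℤ)) * ((ordinaryHypergeometric (-β) ((k : ℝ) - α) ((k : ℝ) + 1) (‖z‖ ^ 2) : ℝ) : ℂ)
    * (conj z) ^ k

/-- `u` has the series form with coefficients `(c_k)_{k ∈ ℤ}`, where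
`limsup_{|k| → ∞} |c_k|^{1/|k|} ≤ 1`:
`u(z) = ∑_{k ≥ 0} c_k F(-α, k-β; k+1; |z|²) z^k + ∑_{k ≥ 1} c_{-k} F(-β, k-α; k+1; |z|²) z̄^k`. -/
def HasSeriesForm (α β : ℝ) (u : ℂ → ℂ) (c : ℤ → ℂ) : Prop :=
  limsup (fun k : ℤ => ‖c k‖ₑ ^ (1 / |(k : ℝ)|)) cofinite ≤ 1 ∧
  ∀ z ∈ unitDisk,
    Summable (fun k : ℕ => seriesTermPos α β c z k) ∧
    Summable (fun k : ℕ => seriesTermNeg α β c z (k + 1)) ∧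
    u z = (∑' k : ℕ, seriesTermPos α β c z k) + (∑' k : ℕ, seriesTermNeg α β c z (k + 1))

/-- `u` is a univalent sense-preserving `(α,β)`-harmonic map of the unit disk onto itself, written
in the series form with coefficients `c`. -/
structure IsABHarmonicDiskMap (α β : ℝ) (u : ℂ → ℂ) (c : ℤ → ℂ) : Prop where
  harmonic : IsABHarmonic α β u
  series : HasSeriesForm α β u c
  sensePreserving : IsSensePreserving u
  univalent : InjOn u unitDisk
  onto : u '' unitDisk = unitDisk

/-- The left-hand side of the Heinz inequality. -/
def heinzQuantity (α β : ℝ) (c : ℤ → ℂ) : ℝ :=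
  (Real.Gamma (1 + α + β) / (Real.Gamma (1 + α) * Real.Gamma (1 + β))) ^ 2 *
    (‖c 1‖ ^ 2 / (1 + α) ^ 2 + 3 * √3 / Real.pi * ‖c 0‖ ^ 2 + ‖c (-1)‖ ^ 2 / (1 + β) ^ 2)

end

/-! Lower bound. On the circle `|z| = r` the series of `u` is a Fourier series with coefficients
`b_k κ_k(r)`. Here `κ_k(r)` are the Fourier coefficients of the kernel `(1 - |z|²)^(1+α+β) (1 -
z)^(-1-α) (1 - z̄)^(-1-β)`, and `b_k` are rescaled `c_k`; the identification is Euler's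
transformation (`pochCoeff_mul_seriesFun`). By Gauss's summation theorem every `κ_k(r)` tends to the
Gamma quotient `M` of the statement. Bessel's inequality then puts `b` in `ℓ²`, and since the kernel
is `M` times an approximate identity, `u` has radial limits `g` almost everywhere with `ĝ(k) = M
b_k` (`HasSeriesForm.exists_radial_limit`). The Heinz quantity becomes `|ĝ(1)|² + (3√3/π)|ĝ(0)|² +
|ĝ(-1)|²`, and `α`, `β` disappear from the problem.

What remains uses only that `u` is a homeomorphism of the disk. Its radial limits are unimodular and
cannot interleave (`radial_limits_not_interleaved`), so the limits at cyclically ordered points form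
an inscribed polygon, whose squared sides sum to at most 9, the value for the equilateral triangle
(`sum_norm_sq_radial_limits_le`). Averaging over all rotations of the points `x, x + t, ..., x + mt`
gives `m G(t) + G(1 - mt) ≤ 9/2` for `G(y) = ½ ∫ |g(x+y) - g(x)|² dx = ∑ |ĝ(n)|² (1 - cos 2πny)`.
These inequalities yield `∫ (G(y) - 9y/2) sin(2πy + π/3) dy ≤ 0` over `[0, 1/3]`. The weight is
chosen so that only `n = -1, 0, 1` contribute positively to `∫ (1 - G) sin(2πy + π/3)`, which is the
inequality sought (`heinz_cosine_inequality`).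

Sharpness. The boundary map `z v̄ / v` with `v = (1 + b z³)^(1/3)` turns with speed equal to the
Poisson kernel of the disk evaluated at `-b z³`. As `b → 1` it degenerates to a step function onto
the vertices of an equilateral triangle. Its harmonic extension has coefficients `c_0 = c_{-1} = 0`
and `c_1 = F(1/3, -1/3; 1; b²) → 3√3/(2π)`, and its Jacobian is positive on the closed disk by a
Hopf lemma (`norm_deriv_antiCoeff_lt`). For small `α ≤ 0` and `β = 0` an explicit `(α,0)`-harmonic
map has the same boundary values and the same Heinz quantity. It is still sense-preserving, and it
is bijective because a proper local homeomorphism of the disk is a homeomorphism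
(`eventually_exists_isABHarmonicDiskMap`). -/

/-! ### Binomial and hypergeometric coefficients. -/

/-- The coefficient `(s)_n / n!` of `z ^ n` in the binomial series of `(1 - z) ^ (-s)`. -/
noncomputable def pochCoeff (s : ℝ) (n : ℕ) : ℝ := (ascPochhammer ℝ n).eval s / n.factorial

/-- The coefficient `(a)_n (b)_n / ((c)_n n!)` of the Gauss hypergeometric series. -/
noncomputable def hypCoeff (a b c : ℝ) (n : ℕ) : ℝ := ordinaryHypergeometricCoefficient a b c n

lemma pochCoeff_zero (s : ℝ) : pochCoeff s 0 = 1 := by simp [pochCoeff]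

lemma pochCoeff_succ (s : ℝ) (n : ℕ) :
    pochCoeff s (n + 1) = pochCoeff s n * (s + n) / (n + 1) := by
  have : (n.factorial : ℝ) ≠ 0 := by positivity
  have h2 : (n + 1 : ℝ) ≠ 0 := by positivity
  simp only [pochCoeff, ascPochhammer_succ_eval, Nat.factorial_succ]
  push_cast
  field_simp

lemma pochCoeff_ne_zero {s : ℝ} (hs : ∀ n : ℕ, s ≠ -(n : ℝ)) (n : ℕ) : pochCoeff s n ≠ 0 := by
  induction n with
  | zero => simp [pochCoeff_zero]
  | succ n ih =>
    rw [pochCoeff_succ]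
    have h1 : s + n ≠ 0 := fun h => hs n (by linarith)
    have h2 : (n + 1 : ℝ) ≠ 0 := by positivity
    exact div_ne_zero (mul_ne_zero ih h1) h2

lemma hypCoeff_zero (a b c : ℝ) : hypCoeff a b c 0 = 1 := by
  simp [hypCoeff, ordinaryHypergeometricCoefficient]

lemma hypCoeff_succ (a b c : ℝ) (n : ℕ) :
    hypCoeff a b c (n + 1) = hypCoeff a b c n * ((a + n) * (b + n) / ((c + n) * (n + 1))) := by
  simp only [hypCoeff, ordinaryHypergeometricCoefficient, ascPochhammer_succ_eval,
    Nat.factorial_succ]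
  push_cast
  rw [mul_inv, mul_inv, div_eq_mul_inv, mul_inv]
  ring

lemma hypCoeff_one_right {c : ℝ} (hc : 0 < c) (s : ℝ) (n : ℕ) :
    hypCoeff s c c n = pochCoeff s n := by
  induction n with
  | zero => simp [hypCoeff_zero, pochCoeff_zero]
  | succ n ih =>
    rw [hypCoeff_succ, pochCoeff_succ, ih]
    have h2 : (n + 1 : ℝ) ≠ 0 := by positivity
    have h3 : (c + n : ℝ) ≠ 0 := by positivity
    field_simp

lemma ordinaryHypergeometric_eq_tsum_hypCoeff (a b c x : ℝ) :
    ordinaryHypergeometric a b c x = ∑' n, hypCoeff a b c n * x ^ n := by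
  rw [ordinaryHypergeometric_eq_tsum]
  simp [hypCoeff, ordinaryHypergeometricCoefficient]

lemma tendsto_natCast_add_div_add (a c : ℝ) :
    Tendsto (fun n : ℕ => (a + n) / (c + n)) atTop (𝓝 1) := by
  have := tendsto_add_mul_div_add_mul_atTop_nhds (𝕜 := ℝ) a c 1 one_ne_zero
  simpa using this

lemma summable_hypCoeff_mul_pow {a b c x : ℝ} (hx : |x| < 1) :
    Summable fun n => ‖hypCoeff a b c n * x ^ n‖ := by
  obtain ⟨ρ, h1, h2⟩ := exists_between hx
  have hlim : Tendsto (fun n : ℕ => |x| * |(a + n) / (c + n) * ((b + n) / (1 + n))|) atTop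
      (𝓝 |x|) := by
    have := ((tendsto_natCast_add_div_add a c).mul (tendsto_natCast_add_div_add b 1)).abs.const_mul
      |x|
    simpa using this
  refine summable_of_ratio_norm_eventually_le h2 ?_
  filter_upwards [hlim.eventually_le_const h1] with n hn
  have : hypCoeff a b c (n + 1) * x ^ (n + 1)
      = hypCoeff a b c n * x ^ n * (x * ((a + n) / (c + n) * ((b + n) / (1 + n)))) := by
    rw [hypCoeff_succ, div_mul_div_comm, pow_succ, add_comm (1 : ℝ)]
    ring
  simp only [norm_norm]
  rw [this, norm_mul, mul_comm]
  refine mul_le_mul_of_nonneg_right ?_ (norm_nonneg _)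
  rwa [Real.norm_eq_abs, abs_mul]

lemma summable_pochCoeff_mul_pow (s : ℝ) {x : ℝ} (hx : |x| < 1) :
    Summable fun n => ‖pochCoeff s n * x ^ n‖ := by
  simpa only [hypCoeff_one_right one_pos] using summable_hypCoeff_mul_pow (a := s) (b := 1) (c := 1) hx

lemma summable_pochCoeff_mul_cpow (s : ℝ) {z : ℂ} (hz : ‖z‖ < 1) :
    Summable fun n => ‖(pochCoeff s n : ℂ) * z ^ n‖ := by
  have := summable_pochCoeff_mul_pow s (x := ‖z‖) (by simpa using hz)
  simpa using this

/-- Bridges the generalised binomial coefficients of the power series of `(1 - z)^(-s)` and the real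
rising factorials used here. -/
lemma ring_choose_eq_pochCoeff (s : ℝ) (n : ℕ) :
    Ring.choose ((s : ℂ) + n - 1) n = (pochCoeff s n : ℂ) := by
  have h : Ring.choose ((s : ℂ) + n - 1) n = Ring.multichoose (s : ℂ) n := by
    rw [Ring.choose]; congr 1; ring
  have h2 := Ring.factorial_nsmul_multichoose_eq_ascPochhammer (s : ℂ) n
  rw [nsmul_eq_mul, ← Polynomial.eval₂_smulOneHom_eq_smeval] at h2
  have hn : (n.factorial : ℂ) ≠ 0 := by exact_mod_cast n.factorial_ne_zero
  rw [h, pochCoeff]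
  push_cast
  rw [eq_div_iff hn, mul_comm, h2]
  rw [← Polynomial.eval_map]
  have e1 : Polynomial.map RingHom.smulOneHom (ascPochhammer ℕ n) = ascPochhammer ℂ n := by
    rw [ascPochhammer_map]
  rw [e1, ← ascPochhammer_map (Complex.ofRealHom), Polynomial.eval_map]
  exact (Polynomial.eval₂_at_apply Complex.ofRealHom s)

lemma hasSum_one_sub_cpow_neg (s : ℝ) {z : ℂ} (hz : ‖z‖ < 1) :
    HasSum (fun n => (pochCoeff s n : ℂ) * z ^ n) ((1 - z) ^ (-(s : ℂ))) := by
  have h := (Complex.one_div_one_sub_cpow_hasFPowerSeriesOnBall_zero (s : ℂ)).hasSum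
    (y := z) (by
      rw [Metric.mem_eball, edist_zero_right, ← ofReal_norm]
      exact ENNReal.ofReal_lt_one.2 hz)
  simp only [FormalMultilinearSeries.ofScalars_apply_eq, zero_add, ring_choose_eq_pochCoeff,
    smul_eq_mul] at h
  rwa [Complex.cpow_neg, ← one_div]

/-! ### Laurent expansion of a product of two binomial series. -/

/-- The diagonal sums `∑ₙ (s)_{n+k} (t)_n / ((n+k)! n!) xⁿ`. -/
noncomputable def pochDiag (s t : ℝ) (k : ℕ) (x : ℝ) : ℝ :=
  ∑' n, pochCoeff s (n + k) * pochCoeff t n * x ^ n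

/-- Pairs of natural numbers, split according to which entry is larger. -/
def natPairSplit : (ℕ × ℕ) ⊕ (ℕ × ℕ) ≃ ℕ × ℕ where
  toFun := Sum.elim (fun p => (p.2 + p.1, p.2)) (fun p => (p.2, p.2 + (p.1 + 1)))
  invFun p := if p.2 ≤ p.1 then .inl (p.1 - p.2, p.2) else .inr (p.2 - p.1 - 1, p.1)
  left_inv := by
    rintro (⟨k, n⟩ | ⟨k, n⟩)
    · simp
    · simp
  right_inv := by
    rintro ⟨p, q⟩
    dsimp only
    split_ifs with h
    · simp; omega
    · simp; omega

lemma hasSum_pochDiag_complex (s t : ℝ) (k : ℕ) {z w : ℂ} {x : ℝ}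
    (hzw : z * w = x) (hsum : Summable fun n =>
      (pochCoeff s (n + k) * z ^ (n + k)) * (pochCoeff t n * w ^ n)) :
    HasSum (fun n => (pochCoeff s (n + k) * z ^ (n + k)) * (pochCoeff t n * w ^ n))
      ((pochDiag s t k x : ℂ) * z ^ k) := by
  have : ∀ n, ((pochCoeff s (n + k) : ℂ) * z ^ (n + k)) * (pochCoeff t n * w ^ n)
      = ((pochCoeff s (n + k) * pochCoeff t n * x ^ n : ℝ) : ℂ) * z ^ k := by
    intro n
    push_cast
    rw [← hzw, mul_pow, pow_add]
    ring
  have h2 := hsum.hasSum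
  rw [show (pochDiag s t k x : ℂ) * z ^ k = ∑' n, ((pochCoeff s (n + k) : ℂ) * z ^ (n + k)) *
    (pochCoeff t n * w ^ n) from ?_]
  · exact h2
  · rw [tsum_congr this, tsum_mul_right, pochDiag, Complex.ofReal_tsum]

/-- Laurent-type expansion of `(1 - z) ^ (-s) (1 - w) ^ (-t)`. -/
theorem hasSum_one_sub_cpow_mul (s t : ℝ) {z w : ℂ} (hz : ‖z‖ < 1) (hw : ‖w‖ < 1) {x : ℝ}
    (hzw : z * w = x) :
    (Summable fun k : ℕ => (pochDiag s t k x : ℂ) * z ^ k) ∧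
    (Summable fun k : ℕ => (pochDiag t s (k + 1) x : ℂ) * w ^ (k + 1)) ∧
    (1 - z) ^ (-(s : ℂ)) * (1 - w) ^ (-(t : ℂ)) =
      (∑' k : ℕ, (pochDiag s t k x : ℂ) * z ^ k) +
        ∑' k : ℕ, (pochDiag t s (k + 1) x : ℂ) * w ^ (k + 1) := by
  have hx : |x| < 1 := by
    have : ‖(x : ℂ)‖ < 1 := by
      rw [← hzw, norm_mul]
      nlinarith [norm_nonneg z, norm_nonneg w]
    simpa using this
  have hA := summable_pochCoeff_mul_cpow s hz
  have hB := summable_pochCoeff_mul_cpow t hw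
  have hs := summable_mul_of_summable_norm hA hB
  have hval := ((hasSum_one_sub_cpow_neg s hz).mul (hasSum_one_sub_cpow_neg t hw) hs)
  have h1 : Summable fun p : ℕ × ℕ => ((pochCoeff s (p.2 + p.1) : ℂ) * z ^ (p.2 + p.1)) *
      (pochCoeff t p.2 * w ^ p.2) :=
    hs.comp_injective (i := fun p : ℕ × ℕ => (p.2 + p.1, p.2))
      (natPairSplit.injective.comp Sum.inl_injective)
  have h2 : Summable fun p : ℕ × ℕ => ((pochCoeff s p.2 : ℂ) * z ^ p.2) *
      (pochCoeff t (p.2 + (p.1 + 1)) * w ^ (p.2 + (p.1 + 1))) :=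
    hs.comp_injective (i := fun p : ℕ × ℕ => (p.2, p.2 + (p.1 + 1)))
      (natPairSplit.injective.comp Sum.inr_injective)
  -- The double series over `(p, q)` is summed along the lines where `p - q` is constant. Since `z w
  -- = x`, the line `p - q = k` contributes `z ^ k` times a power series in `x`; the lines with `p <
  -- q` give powers of `w`.
  have e1 := h1.hasSum.prod_fiberwise (fun k =>
    hasSum_pochDiag_complex s t k hzw (h1.prod_factor k))
  have e2 := h2.hasSum.prod_fiberwise (g := fun k => (pochDiag t s (k + 1) x : ℂ) * w ^ (k + 1))
    (fun k => by
      have h3 := h2.prod_factor k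
      simp_rw [mul_comm ((pochCoeff s _ : ℂ) * _)] at h3
      have := hasSum_pochDiag_complex t s (k + 1) (z := w) (w := z) (by rw [mul_comm, hzw]) h3
      simp_rw [mul_comm ((pochCoeff s _ : ℂ) * _)]
      exact this)
  refine ⟨e1.summable, e2.summable, ?_⟩
  rw [e1.tsum_eq, e2.tsum_eq]
  refine hval.unique ?_
  rw [← natPairSplit.hasSum_iff]
  exact HasSum.sum h1.hasSum h2.hasSum
-- Euler's transformation through the hypergeometric differential equation.
section
open PowerSeries

/-- A formal solution of the Gauss hypergeometric equation has the hypergeometric coefficients. -/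
lemma coeff_eq_hypCoeff_of_ode {a b c : ℝ} (hc : 0 < c) {Y : PowerSeries ℝ}
    (h0 : coeff 0 Y = 1)
    (hY : X * (1 - X) * d⁄dX ℝ (d⁄dX ℝ Y) + (C c - C (a + b + 1) * X) * d⁄dX ℝ Y
      - C (a * b) * Y = 0) (n : ℕ) : coeff n Y = hypCoeff a b c n := by
  have hrec : ∀ n, (n + 1) * (c + n) * coeff (n + 1) Y = (a + n) * (b + n) * coeff n Y := by
    intro n
    have h := congrArg (coeff n) hY
    have e : X * (1 - X) * d⁄dX ℝ (d⁄dX ℝ Y) + (C c - C (a + b + 1) * X) * d⁄dX ℝ Y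
        - C (a * b) * Y = X * d⁄dX ℝ (d⁄dX ℝ Y) - X * (X * d⁄dX ℝ (d⁄dX ℝ Y)) + C c * d⁄dX ℝ Y
          - C (a + b + 1) * (X * d⁄dX ℝ Y) - C (a * b) * Y := by ring
    rw [e] at h
    generalize hd : a + b + 1 = d at h
    generalize hf : a * b = f at h
    rcases n with _ | _ | n <;>
    · simp only [map_sub, map_add, coeff_zero_X_mul, coeff_succ_X_mul, coeff_C_mul,
        coeff_derivative, map_zero] at h
      push_cast at h ⊢
      subst hd hf
      linarith
  induction n with
  | zero => rw [h0, hypCoeff_zero]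
  | succ n ih =>
    rw [hypCoeff_succ, ← ih]
    have h2 : (n + 1 : ℝ) ≠ 0 := by positivity
    have h3 : (c + n : ℝ) ≠ 0 := by positivity
    field_simp
    linarith [hrec n]

lemma hypCoeff_ode (a b : ℝ) {c : ℝ} (hc : 0 < c) :
    X * (1 - X) * d⁄dX ℝ (d⁄dX ℝ (mk (hypCoeff a b c))) +
      (C c - C (a + b + 1) * X) * d⁄dX ℝ (mk (hypCoeff a b c))
      - C (a * b) * mk (hypCoeff a b c) = 0 := by
  have hrec : ∀ n : ℕ, (n + 1) * (c + n) * hypCoeff a b c (n + 1) =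
      (a + n) * (b + n) * hypCoeff a b c n := by
    intro n
    have h2 : (n + 1 : ℝ) ≠ 0 := by positivity
    have h3 : (c + n : ℝ) ≠ 0 := by positivity
    rw [hypCoeff_succ]
    field_simp
  set Y := mk (hypCoeff a b c) with hYdef
  have e : X * (1 - X) * d⁄dX ℝ (d⁄dX ℝ Y) + (C c - C (a + b + 1) * X) * d⁄dX ℝ Y
      - C (a * b) * Y = X * d⁄dX ℝ (d⁄dX ℝ Y) - X * (X * d⁄dX ℝ (d⁄dX ℝ Y)) + C c * d⁄dX ℝ Y
        - C (a + b + 1) * (X * d⁄dX ℝ Y) - C (a * b) * Y := by ring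
  rw [e]
  ext n
  have h := hrec n
  generalize hd : a + b + 1 = d
  generalize hf : a * b = f
  rcases n with _ | _ | n <;>
  · simp only [map_sub, map_add, coeff_zero_X_mul, coeff_succ_X_mul, coeff_C_mul,
      coeff_derivative, map_zero, hYdef, coeff_mk]
    push_cast at h ⊢
    subst hd hf
    linarith

lemma pochCoeff_ode (s : ℝ) :
    (1 - X) * d⁄dX ℝ (mk (pochCoeff s)) = C s * mk (pochCoeff s) := by
  have e : (1 - X) * d⁄dX ℝ (mk (pochCoeff s)) =
    d⁄dX ℝ (mk (pochCoeff s)) - X * d⁄dX ℝ (mk (pochCoeff s)) := by ring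
  rw [e]
  ext n
  have h : pochCoeff s (n + 1) * (n + 1) = pochCoeff s n * (s + n) := by
    rw [pochCoeff_succ]; field_simp
  rcases n with _ | n <;>
  · simp only [map_sub, coeff_zero_X_mul, coeff_succ_X_mul, coeff_C_mul, coeff_derivative, coeff_mk]
    push_cast at h ⊢
    linarith

/-- Euler's transformation, at the level of formal power series. -/
lemma mk_pochCoeff_mul_mk_hypCoeff (a b : ℝ) {c : ℝ} (hc : 0 < c) (n : ℕ) :
    coeff n (mk (pochCoeff (c - a - b)) * mk (hypCoeff a b c)) =
      hypCoeff (c - a) (c - b) c n := by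
  refine coeff_eq_hypCoeff_of_ode hc ?_ ?_ n
  · simp [coeff_mul, pochCoeff_zero, hypCoeff_zero]
  have hY := hypCoeff_ode a b hc
  have h1 := pochCoeff_ode (c - a - b)
  set Y := mk (hypCoeff a b c)
  set B := mk (pochCoeff (c - a - b))
  have h2 := congrArg (d⁄dX ℝ) h1
  simp only [Derivation.leibniz, smul_eq_mul, map_sub, Derivation.map_one_eq_zero, derivative_X,
    derivative_C] at h2
  simp only [Derivation.leibniz, smul_eq_mul, map_add, map_sub, map_mul, map_one] at hY h1 h2 ⊢
  set B' := d⁄dX ℝ B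
  set B'' := d⁄dX ℝ B'
  set Y' := d⁄dX ℝ Y
  set Y'' := d⁄dX ℝ Y'
  set ca : PowerSeries ℝ := C a
  set cb : PowerSeries ℝ := C b
  set cc : PowerSeries ℝ := C c
  have hne : (1 - X : PowerSeries ℝ) ≠ 0 := by
    intro h
    have := congrArg (coeff 0) h
    simp at this
  -- The equation for `B` controls `(1 - X) B'` rather than `B'`, so the derivatives of `B` can be
  -- eliminated only after an extra factor `1 - X`.
  apply mul_left_cancel₀ hne
  linear_combination (B * (1 - X)) * hY + X * (1 - X) * Y * h2 +
    (X * Y + X * Y * (cc - ca - cb) + 2 * X * (1 - X) * Y' + (cc - (cc - ca + (cc - cb) + 1) * X) * Y) * h1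

end
lemma hasSum_one_sub_rpow_neg (s : ℝ) {x : ℝ} (hx : |x| < 1) :
    HasSum (fun n => pochCoeff s n * x ^ n) ((1 - x) ^ (-s)) := by
  have h := hasSum_one_sub_cpow_neg s (z := (x : ℂ)) (by simpa using hx)
  have h1 : (0 : ℝ) ≤ 1 - x := by linarith [(abs_lt.1 hx).2]
  have e : (1 - (x : ℂ)) ^ (-(s : ℂ)) = (((1 - x) ^ (-s) : ℝ) : ℂ) := by
    rw [Complex.ofReal_cpow h1]; push_cast; rfl
  rw [e] at h
  rw [← Complex.hasSum_ofReal]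
  simpa using h

/-- **Euler's transformation** of the hypergeometric function. -/
theorem ordinaryHypergeometric_euler (a b : ℝ) {c x : ℝ} (hc : 0 < c) (hx : |x| < 1) :
    ordinaryHypergeometric (c - a) (c - b) c x =
      (1 - x) ^ (a + b - c) * ordinaryHypergeometric a b c x := by
  have h1 := hasSum_one_sub_rpow_neg (c - a - b) hx
  have h2 : Summable fun n => ‖hypCoeff a b c n * x ^ n‖ := summable_hypCoeff_mul_pow hx
  rw [ordinaryHypergeometric_eq_tsum_hypCoeff, ordinaryHypergeometric_eq_tsum_hypCoeff,
    show a + b - c = -(c - a - b) by ring, ← h1.tsum_eq,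
    tsum_mul_tsum_eq_tsum_sum_antidiagonal_of_summable_norm (summable_pochCoeff_mul_pow _ hx) h2]
  refine tsum_congr fun n => ?_
  rw [← mk_pochCoeff_mul_mk_hypCoeff a b hc, PowerSeries.coeff_mul, Finset.sum_mul]
  refine Finset.sum_congr rfl fun p hp => ?_
  rw [Finset.HasAntidiagonal.mem_antidiagonal] at hp
  simp only [PowerSeries.coeff_mk]
  rw [← hp, pow_add]
  ring

/-- Follows from `(s)_{n+k} = (s)_k (s+k)_n` and `(n+k)! = k! (k+1)_n`: a diagonal of the product
expansion is itself a hypergeometric series, to which Euler's transformation applies. -/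
lemma pochCoeff_mul_hypCoeff (s t : ℝ) (k n : ℕ) :
    pochCoeff s k * hypCoeff (s + k) t (k + 1) n = pochCoeff s (n + k) * pochCoeff t n := by
  induction n with
  | zero => simp [hypCoeff_zero, pochCoeff_zero]
  | succ n ih =>
    rw [hypCoeff_succ, ← mul_assoc, ih, show n + 1 + k = n + k + 1 by ring, pochCoeff_succ,
      pochCoeff_succ]
    have h2 : (n + 1 : ℝ) ≠ 0 := by positivity
    have h3 : ((k : ℝ) + 1 + n) ≠ 0 := by positivity
    have h4 : ((n : ℝ) + k + 1) ≠ 0 := by positivity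
    push_cast
    field_simp
    ring

lemma pochCoeff_mul_ordinaryHypergeometric (s t : ℝ) (k : ℕ) (x : ℝ) :
    pochCoeff s k * ordinaryHypergeometric (s + k) t (k + 1) x = pochDiag s t k x := by
  rw [ordinaryHypergeometric_eq_tsum_hypCoeff, pochDiag, ← tsum_mul_left]
  refine tsum_congr fun n => ?_
  rw [← pochCoeff_mul_hypCoeff]
  ring

/-- The functions in the series form of `(α, β)`-harmonic functions, in terms of the Laurent
coefficients of the kernel. -/
theorem pochCoeff_mul_seriesFun (α β : ℝ) (k : ℕ) {x : ℝ} (hx : |x| < 1) :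
    pochCoeff (1 + α) k * ordinaryHypergeometric (-α) ((k : ℝ) - β) ((k : ℝ) + 1) x =
      (1 - x) ^ (1 + α + β) * pochDiag (1 + α) (1 + β) k x := by
  have h := ordinaryHypergeometric_euler (1 + α + k) (1 + β) (c := (k : ℝ) + 1) (by positivity) hx
  rw [show (k : ℝ) + 1 - (1 + α + k) = -α by ring, show (k : ℝ) + 1 - (1 + β) = k - β by ring,
    show 1 + α + k + (1 + β) - ((k : ℝ) + 1) = 1 + α + β by ring] at h
  rw [h, ← pochCoeff_mul_ordinaryHypergeometric]
  ring

/-! ### Gauss's summation theorem at the point 1. -/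

section Gauss

variable {a b c : ℝ}

/-- The last factor tends to `c - a - b`. When this is positive, sums of coefficients are controlled
by the boundary terms `n * hypCoeff a b c n`. -/
lemma hypCoeff_telescope (hc : 0 < c) (n : ℕ) :
    n * hypCoeff a b c n - (n + 1 : ℕ) * hypCoeff a b c (n + 1) =
      hypCoeff a b c n * ((n * (c - a - b) - a * b) / (n + c)) := by
  have h2 : (n + 1 : ℝ) ≠ 0 := by positivity
  have h3 : (c + n : ℝ) ≠ 0 := by positivity
  have h4 : (n + c : ℝ) ≠ 0 := by positivity
  rw [hypCoeff_succ]
  push_cast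
  field_simp
  ring

/-- Raabe's test: from some index on the ratios are nonnegative, so the telescoping identity holds
for absolute values too, with factor at least `(c - a - b) / 2`. -/
lemma summable_abs_hypCoeff (hc : 0 < c) (hσ : 0 < c - a - b) :
    Summable fun n => |hypCoeff a b c n| := by
  have hlim : Tendsto (fun n : ℕ => ((n : ℝ) * (c - a - b) - a * b) / (n + c)) atTop
      (𝓝 (c - a - b)) := by
    have := tendsto_add_mul_div_add_mul_atTop_nhds (𝕜 := ℝ) (-(a * b)) c (c - a - b) one_ne_zero
    rw [div_one] at this
    refine this.congr fun n => ?_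
    congr 1 <;> ring
  have hev : ∀ᶠ n : ℕ in atTop, 0 ≤ a + n ∧ 0 ≤ b + n ∧
      (c - a - b) / 2 ≤ ((n : ℝ) * (c - a - b) - a * b) / (n + c) := by
    refine ((tendsto_atTop_add_const_left _ a tendsto_natCast_atTop_atTop).eventually_ge_atTop
      0).and (((tendsto_atTop_add_const_left _ b tendsto_natCast_atTop_atTop).eventually_ge_atTop
      0).and (hlim.eventually_const_le (by linarith)))
  obtain ⟨N, hN⟩ := eventually_atTop.1 hev
  rw [← summable_nat_add_iff N]
  have hstep : ∀ n ≥ N, (c - a - b) / 2 * |hypCoeff a b c n| ≤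
      n * |hypCoeff a b c n| - (n + 1 : ℕ) * |hypCoeff a b c (n + 1)| := by
    intro n hn
    obtain ⟨h1, h2, h3⟩ := hN n hn
    have h4 : (n + 1 : ℝ) ≠ 0 := by positivity
    have h5 : (0 : ℝ) < n + c := by positivity
    have e : |hypCoeff a b c (n + 1)| =
        |hypCoeff a b c n| * ((a + n) * (b + n) / ((c + n) * (n + 1))) := by
      rw [hypCoeff_succ, abs_mul, abs_of_nonneg (a := _ / _) (by positivity)]
    have e2 : n * |hypCoeff a b c n| - (n + 1 : ℕ) * |hypCoeff a b c (n + 1)| =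
        |hypCoeff a b c n| * ((n * (c - a - b) - a * b) / (n + c)) := by
      rw [e]
      have h6 : (c + n : ℝ) ≠ 0 := by positivity
      push_cast
      field_simp
      ring
    rw [e2, mul_comm]
    exact mul_le_mul_of_nonneg_left h3 (abs_nonneg _)
  refine summable_of_sum_range_le (c := N * |hypCoeff a b c N| / ((c - a - b) / 2))
    (fun n => abs_nonneg _) fun n => ?_
  rw [le_div_iff₀ (by linarith), mul_comm, Finset.mul_sum]
  have : ∀ n : ℕ, ∑ i ∈ Finset.range n, (c - a - b) / 2 * |hypCoeff a b c (i + N)| ≤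
      N * |hypCoeff a b c N| - (n + N : ℕ) * |hypCoeff a b c (n + N)| := by
    intro n
    induction n with
    | zero => simp
    | succ n ih =>
      rw [Finset.sum_range_succ]
      have := hstep (n + N) (by omega)
      rw [show n + 1 + N = n + N + 1 by ring]
      linarith
  refine (this n).trans ?_
  have : (0 : ℝ) ≤ (n + N : ℕ) * |hypCoeff a b c (n + N)| := by positivity
  linarith

/-- Telescoping shows that `n * hypCoeff a b c n` converges; a nonzero limit would make the harmonic
series converge. -/
lemma tendsto_natCast_mul_hypCoeff (hc : 0 < c) (hσ : 0 < c - a - b) :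
    Tendsto (fun n : ℕ => n * hypCoeff a b c n) atTop (𝓝 0) ∧
    HasSum (fun n : ℕ => hypCoeff a b c n * ((n * (c - a - b) - a * b) / (n + c))) 0 := by
  have hs := summable_abs_hypCoeff hc hσ
  have hlim : Tendsto (fun n : ℕ => ((n : ℝ) * (c - a - b) - a * b) / (n + c)) atTop
      (𝓝 (c - a - b)) := by
    have := tendsto_add_mul_div_add_mul_atTop_nhds (𝕜 := ℝ) (-(a * b)) c (c - a - b) one_ne_zero
    rw [div_one] at this
    refine this.congr fun n => ?_
    congr 1 <;> ring
  have hsum : Summable (fun n : ℕ => hypCoeff a b c n *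
      ((n * (c - a - b) - a * b) / (n + c))) := by
    obtain ⟨C, hC⟩ := hlim.abs.bddAbove_range
    refine Summable.of_norm_bounded (hs.mul_right C) fun n => ?_
    rw [norm_mul, Real.norm_eq_abs, Real.norm_eq_abs]
    exact mul_le_mul_of_nonneg_left (hC ⟨n, rfl⟩) (abs_nonneg _)
  have h1 := hsum.hasSum.tendsto_sum_nat
  have e : ∀ N : ℕ, ∑ n ∈ Finset.range N, hypCoeff a b c n *
      ((n * (c - a - b) - a * b) / (n + c)) = -(N * hypCoeff a b c N) := by
    intro N
    simp_rw [← hypCoeff_telescope hc]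
    rw [Finset.sum_range_sub' (fun n : ℕ => (n : ℝ) * hypCoeff a b c n)]
    simp
  simp_rw [e] at h1
  have h2 := h1.neg
  simp only [neg_neg] at h2
  set l := -∑' n : ℕ, hypCoeff a b c n * ((n * (c - a - b) - a * b) / (n + c)) with hl
  have hl0 : l = 0 := by
    by_contra hne
    have hpos : 0 < |l| := abs_pos.2 hne
    refine Real.not_summable_natCast_inv ?_
    have hev := h2.abs.eventually_const_le (half_lt_self hpos)
    refine Summable.of_norm_bounded_eventually_nat (hs.mul_right (2 / |l|)) ?_
    filter_upwards [hev, eventually_gt_atTop 0] with n hn hn0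
    have hn0' : (0 : ℝ) < n := by exact_mod_cast hn0
    rw [norm_inv, Real.norm_natCast, ← mul_div_assoc, le_div_iff₀ hpos, inv_mul_le_iff₀ hn0']
    rw [abs_mul, Nat.abs_cast] at hn
    linarith
  rw [hl0] at h2
  refine ⟨h2, ?_⟩
  have := hsum.hasSum
  rwa [show ∑' n : ℕ, hypCoeff a b c n * ((n * (c - a - b) - a * b) / (n + c)) = 0 by
    linarith] at this

lemma hypCoeff_succ_right (hc : 0 < c) (n : ℕ) :
    hypCoeff a b (c + 1) n = hypCoeff a b c n * (c / (c + n)) := by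
  induction n with
  | zero => simp [hypCoeff_zero, hc.ne']
  | succ n ih =>
    rw [hypCoeff_succ, hypCoeff_succ, ih]
    have h2 : (n + 1 : ℝ) ≠ 0 := by positivity
    have h3 : (c + n : ℝ) ≠ 0 := by positivity
    have h4 : (c + 1 + n : ℝ) ≠ 0 := by positivity
    have h5 : (c + (n + 1) : ℝ) ≠ 0 := by positivity
    push_cast
    field_simp
    ring

/-- The combination `(c-a-b) h_n(c) - ((c-a)(c-b)/c) h_n(c+1)` is exactly the telescoping term,
whose sum is zero. -/
lemma tsum_hypCoeff_contiguous (hc : 0 < c) (hσ : 0 < c - a - b) :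
    ∑' n, hypCoeff a b c n =
      (c - a) * (c - b) / (c * (c - a - b)) * ∑' n, hypCoeff a b (c + 1) n := by
  have h0 := (tendsto_natCast_mul_hypCoeff (a := a) (b := b) hc hσ).2
  have h1 := (summable_abs_hypCoeff hc hσ).of_abs.hasSum
  have h2 := (summable_abs_hypCoeff (a := a) (b := b) (c := c + 1) (by linarith)
    (by linarith)).of_abs.hasSum
  have h3 := (h1.mul_left (c - a - b)).sub (h2.mul_left ((c - a) * (c - b) / c))
  have h4 := h0.unique (h3.congr_fun ?_)
  · field_simp at h4 ⊢
    linarith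
  · intro n
    rw [hypCoeff_succ_right hc]
    have h3 : (c + n : ℝ) ≠ 0 := by positivity
    have h3' : (n + c : ℝ) ≠ 0 := by positivity
    field_simp
    ring

lemma abs_hypCoeff_add_natCast_le (hc : 0 < c) (N n : ℕ) :
    |hypCoeff a b (c + N) n| ≤ |hypCoeff a b c n| := by
  induction N with
  | zero => simp
  | succ N ih =>
    have hcN : 0 < c + N := by positivity
    rw [Nat.cast_succ, ← add_assoc, hypCoeff_succ_right hcN, abs_mul]
    refine le_trans (mul_le_of_le_one_right (abs_nonneg _) ?_) ih
    rw [abs_of_nonneg (by positivity)]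
    exact div_le_one_of_le₀ (by linarith [n.cast_nonneg (α := ℝ)]) (by positivity)

/-- Every coefficient except the constant one tends to `0` as the lower parameter grows, and all are
dominated by those at `c`. -/
lemma tendsto_tsum_hypCoeff_add_natCast (hc : 0 < c) (hσ : 0 < c - a - b) :
    Tendsto (fun N : ℕ => ∑' n, hypCoeff a b (c + N) n) atTop (𝓝 1) := by
  have h := tendsto_tsum_of_dominated_convergence (𝓕 := atTop)
    (f := fun N n : ℕ => hypCoeff a b (c + N) n)
    (g := fun n : ℕ => if n = 0 then (1 : ℝ) else 0) (summable_abs_hypCoeff hc hσ) ?_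
    (Eventually.of_forall fun N n => abs_hypCoeff_add_natCast_le hc N n)
  · simpa using h
  · intro n
    rcases n with _ | n
    · simp [hypCoeff_zero]
    · simp only [Nat.succ_ne_zero, if_false]
      have h1 : Tendsto (fun N : ℕ => |hypCoeff a b c n| *
          |(a + n) * (b + n) / ((c + N + n) * (n + 1))|) atTop (𝓝 0) := by
        have : Tendsto (fun N : ℕ => (c + N + n) * ((n : ℝ) + 1)) atTop atTop :=
          (tendsto_atTop_add_const_right _ _ (tendsto_atTop_add_const_left _ c
            tendsto_natCast_atTop_atTop)).atTop_mul_const (by positivity)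
        simpa using (((tendsto_const_nhds (x := (a + n) * (b + n))).div_atTop this).abs).const_mul
          |hypCoeff a b c n|
      refine squeeze_zero_norm (fun N => ?_) h1
      rw [hypCoeff_succ, norm_mul]
      exact mul_le_mul_of_nonneg_right (abs_hypCoeff_add_natCast_le hc N n) (abs_nonneg _)

/-- **Gauss's summation theorem**. -/
theorem tsum_hypCoeff_eq (hc : 0 < c) (hσ : 0 < c - a - b)
    (ha : ∀ n : ℕ, c - a ≠ -n) (hb : ∀ n : ℕ, c - b ≠ -n) :
    ∑' n, hypCoeff a b c n =
      Real.Gamma c * Real.Gamma (c - a - b) / (Real.Gamma (c - a) * Real.Gamma (c - b)) := by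
  have hprod : ∀ N : ℕ, ∑' n, hypCoeff a b c n =
      (∏ j ∈ Finset.range N, ((c - a + j) * (c - b + j) / ((c + j) * (c - a - b + j)))) *
        ∑' n, hypCoeff a b (c + N) n := by
    intro N
    induction N with
    | zero => simp
    | succ N ih =>
      rw [ih, Finset.prod_range_succ, mul_assoc, tsum_hypCoeff_contiguous (c := c + N)
        (by positivity) (by have : (0 : ℝ) ≤ N := N.cast_nonneg
                            linarith)]
      rw [Nat.cast_succ, ← add_assoc, show c + N - a = c - a + N by ring,
        show c + N - b = c - b + N by ring, show c - a + N - b = c - a - b + N by ring]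
  have hG : Tendsto (fun n : ℕ => Real.GammaSeq c n * Real.GammaSeq (c - a - b) n /
      (Real.GammaSeq (c - a) n * Real.GammaSeq (c - b) n)) atTop
      (𝓝 (Real.Gamma c * Real.Gamma (c - a - b) / (Real.Gamma (c - a) * Real.Gamma (c - b)))) :=
    ((Real.GammaSeq_tendsto_Gamma _).mul (Real.GammaSeq_tendsto_Gamma _)).div
      ((Real.GammaSeq_tendsto_Gamma _).mul (Real.GammaSeq_tendsto_Gamma _))
      (mul_ne_zero (Real.Gamma_ne_zero ha) (Real.Gamma_ne_zero hb))
  -- `Real.GammaSeq s n` contains the `n + 1` factors `s, ..., s + n`, so the contiguous relation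
  -- has to be iterated `n + 1` times to match it.
  have hS := (tendsto_tsum_hypCoeff_add_natCast (a := a) (b := b) hc hσ).comp (tendsto_add_atTop_nat 1)
  have hlim := hG.mul hS
  rw [mul_one] at hlim
  refine tendsto_nhds_unique (tendsto_const_nhds.congr' ?_) hlim
  filter_upwards [eventually_gt_atTop 0] with n hn
  have hn0 : (0 : ℝ) < n := by exact_mod_cast hn
  rw [hprod (n + 1)]
  simp only [Function.comp_def]
  congr 1
  simp only [Real.GammaSeq]
  rw [Finset.prod_div_distrib, Finset.prod_mul_distrib, Finset.prod_mul_distrib]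
  -- The powers of `n` in the four Gamma sequences cancel because `c + (c-a-b) = (c-a) + (c-b)`.
  have hp : (n : ℝ) ^ c * (n : ℝ) ^ (c - a - b) = (n : ℝ) ^ (c - a) * (n : ℝ) ^ (c - b) := by
    rw [← Real.rpow_add hn0, ← Real.rpow_add hn0]; congr 1; ring
  have hne : ∀ s : ℝ, (∀ n : ℕ, s ≠ -n) → ∏ j ∈ Finset.range (n + 1), (s + j) ≠ 0 := by
    intro s hs
    exact Finset.prod_ne_zero_iff.2 fun j _ h => hs j (by linarith)
  have n1 := hne (c - a) ha
  have n2 := hne (c - b) hb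
  have n3 : ∏ j ∈ Finset.range (n + 1), (c + j) ≠ 0 := by
    refine hne c fun n h => ?_
    have : (0 : ℝ) ≤ n := n.cast_nonneg
    linarith
  have n4 : ∏ j ∈ Finset.range (n + 1), (c - a - b + j) ≠ 0 := by
    refine hne _ fun n h => ?_
    have : (0 : ℝ) ≤ n := n.cast_nonneg
    linarith
  have p1 := (Real.rpow_pos_of_pos hn0 (c - a)).ne'
  have p2 := (Real.rpow_pos_of_pos hn0 (c - b)).ne'
  have hf : (n.factorial : ℝ) ≠ 0 := by positivity
  rw [div_mul_div_comm, div_mul_div_comm,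
    show (n : ℝ) ^ c * n.factorial * ((n : ℝ) ^ (c - a - b) * n.factorial) =
      (n : ℝ) ^ (c - a) * (n : ℝ) ^ (c - b) * (n.factorial * n.factorial) by rw [← hp]; ring]
  field_simp

/-- Abel's theorem for the hypergeometric series in the absolutely convergent case. -/
theorem tendsto_ordinaryHypergeometric_one (hc : 0 < c) (hσ : 0 < c - a - b) :
    Tendsto (fun x : ℝ => ordinaryHypergeometric a b c x) (𝓝[<] 1)
      (𝓝 (∑' n, hypCoeff a b c n)) := by
  simp_rw [ordinaryHypergeometric_eq_tsum_hypCoeff]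
  refine tendsto_tsum_of_dominated_convergence (summable_abs_hypCoeff hc hσ) (fun n => ?_) ?_
  · have : Tendsto (fun x : ℝ => hypCoeff a b c n * x ^ n) (𝓝 1) (𝓝 (hypCoeff a b c n * 1 ^ n)) :=
      (continuous_const.mul (continuous_pow n)).tendsto 1
    simpa using this.mono_left nhdsWithin_le_nhds
  · have h0 : ∀ᶠ x : ℝ in 𝓝[<] 1, 0 < x := nhdsWithin_le_nhds (lt_mem_nhds one_pos)
    filter_upwards [self_mem_nhdsWithin, h0] with x hx hx0 n
    rw [norm_mul, Real.norm_eq_abs, norm_pow, Real.norm_eq_abs, abs_of_pos hx0]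
    exact mul_le_of_le_one_right (abs_nonneg _) (pow_le_one₀ hx0.le (le_of_lt hx))

end Gauss

/-! ### Approximate identities on the circle. -/

section Fatou

open MeasureTheory AddCircle

lemma unitAddCircle_volume_eq : (volume : Measure UnitAddCircle) = haarAddCircle := by
  simp [AddCircle.volume_eq_smul_haarAddCircle]

lemma norm_fourier_apply (n : ℤ) (y : UnitAddCircle) : ‖fourier n y‖ = 1 :=
  Circle.norm_coe _

lemma norm_ofReal_mul_fourier {r : ℝ} (hr : 0 ≤ r) (n : ℤ) (y : UnitAddCircle) :
    ‖(r : ℂ) * fourier n y‖ = r := by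
  rw [norm_mul, norm_fourier_apply, mul_one, Complex.norm_real, Real.norm_of_nonneg hr]

lemma one_sub_le_norm_one_sub_mul_fourier {r : ℝ} (hr : 0 ≤ r) (n : ℤ) (y : UnitAddCircle) :
    1 - r ≤ ‖1 - (r : ℂ) * fourier n y‖ := by
  have := norm_sub_norm_le (1 : ℂ) ((r : ℂ) * fourier n y)
  rwa [norm_ofReal_mul_fourier hr, norm_one] at this

lemma normSq_one_sub_mul_exp (r θ : ℝ) :
    ‖1 - (r : ℂ) * Complex.exp (θ * Complex.I)‖ ^ 2 =
      (1 - r) ^ 2 + 4 * r * Real.sin (θ / 2) ^ 2 := by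
  rw [← Complex.normSq_eq_norm_sq, Complex.normSq_apply, Complex.exp_mul_I, ← Complex.ofReal_cos,
    ← Complex.ofReal_sin]
  simp
  rw [Complex.cos_ofReal_re, Complex.sin_ofReal_re]
  have h1 := Real.sin_sq_add_cos_sq θ
  have h2 : Real.cos θ = 1 - 2 * Real.sin (θ / 2) ^ 2 := by
    have := Real.cos_two_mul (θ / 2)
    rw [show 2 * (θ / 2) = θ by ring] at this
    nlinarith [Real.sin_sq_add_cos_sq (θ / 2)]
  have h3 : Real.sin (θ / 2) ^ 2 = (1 - Real.cos θ) / 2 := by linarith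
  rw [h3]
  linear_combination r ^ 2 * h1

/-- Here `|1 - r e^{iθ}|² ≥ 4r sin²(θ/2)`. The restriction `r ≥ 1/4` removes the factor `4r`, and
Jordan's inequality bounds the sine below. -/
lemma norm_le_norm_one_sub_mul_fourier {r : ℝ} (hr : 1 / 4 ≤ r) (y : UnitAddCircle) :
    ‖y‖ ≤ ‖1 - (r : ℂ) * fourier 1 y‖ := by
  induction y using QuotientAddGroup.induction_on with
  | H t =>
  set s : ℝ := t - round t with hs
  have e : ((t : ℝ) : UnitAddCircle) = ((s : ℝ) : UnitAddCircle) := by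
    have : ((round t : ℝ) : UnitAddCircle) = 0 := by
      rw [AddCircle.coe_eq_zero_iff]; exact ⟨round t, by simp⟩
    rw [hs, AddCircle.coe_sub, this, sub_zero]
  have hn : ‖((t : ℝ) : UnitAddCircle)‖ = |s| := UnitAddCircle.norm_eq
  have hs2 : |s| ≤ 1 / 2 := abs_sub_round t
  change ‖((t : ℝ) : UnitAddCircle)‖ ≤ ‖1 - (r : ℂ) * fourier 1 ((t : ℝ) : UnitAddCircle)‖
  rw [hn, e, fourier_coe_apply]
  have e2 : (2 * (Real.pi : ℂ) * Complex.I * ((1 : ℤ) : ℂ) * (s : ℂ) / ((1 : ℝ) : ℂ)) =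
      ((2 * Real.pi * s : ℝ) : ℂ) * Complex.I := by push_cast; ring
  rw [e2]
  refine le_of_sq_le_sq ?_ (norm_nonneg _)
  rw [normSq_one_sub_mul_exp, sq_abs, show 2 * Real.pi * s / 2 = Real.pi * s by ring]
  have h1 : 2 * |s| ≤ |Real.sin (Real.pi * s)| := by
    have := Real.mul_le_sin (x := Real.pi * |s|) (by positivity)
      (by nlinarith [Real.pi_pos])
    have h2 : 2 / Real.pi * (Real.pi * |s|) = 2 * |s| := by
      field_simp
    rw [h2] at this
    rcases abs_cases s with ⟨h, _⟩ | ⟨h, _⟩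
    · rw [h] at this ⊢
      exact this.trans (le_abs_self _)
    · rw [h, show Real.pi * -s = -(Real.pi * s) by ring, Real.sin_neg] at this
      rw [h]
      exact this.trans (neg_le_abs _)
  have h2 : 4 * s ^ 2 ≤ Real.sin (Real.pi * s) ^ 2 := by
    rw [← sq_abs (Real.sin _), ← sq_abs s]
    nlinarith [abs_nonneg s]
  nlinarith [sq_nonneg (1 - r), sq_nonneg (Real.sin (Real.pi * s))]

/-- Approximate identity property at a Lebesgue point: the kernels
`(1 - r²)ᵃ / |1 - r e^{iθ}|^{1 + a}` integrate functions with vanishing averages to `0`. -/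
theorem tendsto_integral_kernel {a : ℝ} (ha : 0 < a) (x : UnitAddCircle) {ψ : UnitAddCircle → ℝ}
    (hψ : Integrable ψ haarAddCircle) (h0 : 0 ≤ ψ)
    (hL : Tendsto (fun h : ℝ => h⁻¹ * ∫ y in Metric.closedBall x h, ψ y ∂haarAddCircle)
      (𝓝[>] 0) (𝓝 0)) :
    Tendsto (fun r : ℝ => ∫ y, (1 - r ^ 2) ^ a / ‖1 - (r : ℂ) * fourier 1 (x - y)‖ ^ (1 + a) * ψ y
      ∂haarAddCircle) (𝓝[<] 1) (𝓝 0) := by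
  set A : ℝ → ℝ := fun h => h⁻¹ * ∫ y in Metric.closedBall x h, ψ y ∂haarAddCircle with hA
  have hA0 : ∀ h, 0 < h → 0 ≤ A h := fun h hh =>
    mul_nonneg (inv_nonneg.2 hh.le) (integral_nonneg h0)
  -- Boundedness of the averages is what allows dominated convergence over all dyadic scales: small
  -- radii by the Lebesgue point hypothesis, large ones by the total integral.
  obtain ⟨B, hB⟩ : ∃ B, ∀ h, 0 < h → A h ≤ B := by
    have h1 := hL.eventually_le_const one_pos
    rw [eventually_nhdsWithin_iff, Metric.eventually_nhds_iff] at h1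
    obtain ⟨ε, hε, h1⟩ := h1
    refine ⟨max 1 (ε⁻¹ * ∫ y, ψ y ∂haarAddCircle), fun h hh => ?_⟩
    rcases lt_or_ge h ε with h2 | h2
    · exact (h1 (by simpa [abs_of_pos hh] using h2) hh).trans (le_max_left _ _)
    · refine le_trans ?_ (le_max_right _ _)
      exact mul_le_mul (inv_anti₀ hε h2) (setIntegral_le_integral hψ (Eventually.of_forall h0))
        (integral_nonneg h0) (inv_nonneg.2 hε.le)
  -- At distance about `2^j (1 - r)` the kernel is at most `C q^j` divided by that distance.
  -- Positivity of `a` makes this geometric gain summable in `j`.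
  set q : ℝ := (2 : ℝ) ^ (-a) with hq
  have hq0 : 0 < q := Real.rpow_pos_of_pos two_pos _
  have hq1 : q < 1 := Real.rpow_lt_one_of_one_lt_of_neg one_lt_two (by linarith)
  set C : ℝ := 2 ^ a * 2 ^ (1 + a) with hC
  have hC0 : 0 < C := by positivity
  have hlim : Tendsto (fun r : ℝ => ∑' j : ℕ, C * q ^ j * A (2 ^ j * (1 - r))) (𝓝[<] 1) (𝓝 0) := by
    have hsub : ∀ j : ℕ, Tendsto (fun r : ℝ => 2 ^ j * (1 - r)) (𝓝[<] 1) (𝓝[>] 0) := by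
      intro j
      refine tendsto_nhdsWithin_iff.2 ⟨?_, ?_⟩
      · have : Tendsto (fun r : ℝ => 2 ^ j * (1 - r)) (𝓝 1) (𝓝 (2 ^ j * (1 - 1))) :=
          (by fun_prop : Continuous fun r : ℝ => (2 : ℝ) ^ j * (1 - r)).tendsto 1
        simpa using this.mono_left nhdsWithin_le_nhds
      · filter_upwards [self_mem_nhdsWithin] with r hr
        have : 0 < 1 - r := sub_pos.2 hr
        exact mul_pos (by positivity) this
    have := tendsto_tsum_of_dominated_convergence (𝓕 := 𝓝[<] (1 : ℝ))
      (f := fun (r : ℝ) (j : ℕ) => C * q ^ j * A (2 ^ j * (1 - r))) (g := fun _ => (0 : ℝ))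
      (bound := fun j => C * q ^ j * B)
      (((summable_geometric_of_lt_one hq0.le hq1).mul_left C).mul_right B) ?_ ?_
    · simpa using this
    · intro j
      simpa using (hL.comp (hsub j)).const_mul (C * q ^ j)
    · filter_upwards [self_mem_nhdsWithin] with r hr j
      have h1 : 0 < 2 ^ j * (1 - r) := mul_pos (by positivity) (sub_pos.2 hr)
      rw [Real.norm_of_nonneg (mul_nonneg (by positivity) (hA0 _ h1))]
      exact mul_le_mul_of_nonneg_left (hB _ h1) (by positivity)
  refine squeeze_zero' ?_ ?_ hlim
  · have h00 : ∀ᶠ r : ℝ in 𝓝[<] 1, 0 < r := nhdsWithin_le_nhds (lt_mem_nhds one_pos)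
    filter_upwards [self_mem_nhdsWithin, h00] with r hr hr0
    refine integral_nonneg fun y => mul_nonneg (div_nonneg (Real.rpow_nonneg ?_ _)
      (Real.rpow_nonneg (norm_nonneg _) _)) (h0 y)
    have : r < 1 := hr
    nlinarith
  have h00 : ∀ᶠ r : ℝ in 𝓝[<] 1, 1 / 4 < r := nhdsWithin_le_nhds (lt_mem_nhds (by norm_num))
  filter_upwards [self_mem_nhdsWithin, h00] with r hr hr0
  have hr1 : r < 1 := hr
  set δ := 1 - r with hδ
  have hδ0 : 0 < δ := by linarith
  obtain ⟨N, hN⟩ := pow_unbounded_of_one_lt (1 / δ) (one_lt_two (α := ℝ))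
  have hN' : 1 < 2 ^ N * δ := by rwa [div_lt_iff₀ hδ0] at hN
  -- pointwise bound by a finite sum over dyadic balls
  have hpt : ∀ y, (1 - r ^ 2) ^ a / ‖1 - (r : ℂ) * fourier 1 (x - y)‖ ^ (1 + a) * ψ y ≤
      ∑ j ∈ Finset.range (N + 1), C * q ^ j * (2 ^ j * δ)⁻¹ *
        (Metric.closedBall x (2 ^ j * δ)).indicator ψ y := by
    intro y
    have hex : ∃ j : ℕ, ‖x - y‖ ≤ 2 ^ j * δ := ⟨N, by
      refine le_trans ?_ hN'.le
      have := AddCircle.norm_le_half_period (1 : ℝ) one_ne_zero (x := x - y)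
      rw [abs_one] at this
      linarith⟩
    classical
    set j := Nat.find hex with hj
    have hj1 : ‖x - y‖ ≤ 2 ^ j * δ := Nat.find_spec hex
    have hjN : j ≤ N := Nat.find_min' hex (by
      refine le_trans ?_ hN'.le
      have := AddCircle.norm_le_half_period (1 : ℝ) one_ne_zero (x := x - y)
      rw [abs_one] at this
      linarith)
    -- For the innermost ball this is the trivial bound by `1 - r`; otherwise minimality of `j` puts
    -- `y` outside the previous dyadic ball.
    have hm : 2 ^ j * δ / 2 ≤ ‖1 - (r : ℂ) * fourier 1 (x - y)‖ := by
      rcases Nat.eq_zero_or_pos j with h | h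
      · rw [h]
        have := one_sub_le_norm_one_sub_mul_fourier (r := r) (by linarith) 1 (x - y)
        linarith
      · have h2 := Nat.find_min hex (m := j - 1) (by omega)
        rw [not_le] at h2
        refine le_trans (le_of_eq ?_) (h2.le.trans (norm_le_norm_one_sub_mul_fourier hr0.le _))
        obtain ⟨i, hi⟩ : ∃ i, j = i + 1 := ⟨j - 1, by omega⟩
        rw [hi]
        simp [pow_succ]
        ring
    have hterm : (1 - r ^ 2) ^ a / ‖1 - (r : ℂ) * fourier 1 (x - y)‖ ^ (1 + a) ≤
        C * q ^ j * (2 ^ j * δ)⁻¹ := by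
      have hρ : 0 < 2 ^ j * δ / 2 := by positivity
      have h1 : (1 - r ^ 2) ^ a ≤ (2 * δ) ^ a := by
        refine Real.rpow_le_rpow (by nlinarith) ?_ ha.le
        rw [hδ]; nlinarith
      have h2 : (2 ^ j * δ / 2) ^ (1 + a) ≤ ‖1 - (r : ℂ) * fourier 1 (x - y)‖ ^ (1 + a) :=
        Real.rpow_le_rpow hρ.le hm (by linarith)
      refine (div_le_div₀ (by positivity) h1 (Real.rpow_pos_of_pos hρ _) h2).trans (le_of_eq ?_)
      have h3 : (2 ^ j * δ : ℝ) ^ (1 + a) = 2 ^ j * δ * (δ ^ a * (q ^ j)⁻¹) := by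
        rw [Real.rpow_add (by positivity), Real.rpow_one, Real.mul_rpow (by positivity) hδ0.le,
          hq, Real.rpow_neg two_pos.le, inv_pow, inv_inv, ← Real.rpow_natCast_mul two_pos.le,
          ← Real.rpow_mul_natCast two_pos.le]
        ring_nf
      rw [Real.div_rpow (by positivity) two_pos.le, h3, Real.mul_rpow two_pos.le hδ0.le, hC]
      have : (0 : ℝ) < δ ^ a := Real.rpow_pos_of_pos hδ0 _
      field_simp
    have hmem : y ∈ Metric.closedBall x (2 ^ j * δ) := by
      rw [Metric.mem_closedBall, dist_comm, dist_eq_norm]; exact hj1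
    refine (mul_le_mul_of_nonneg_right hterm (h0 y)).trans ?_
    have := Finset.single_le_sum (f := fun j => C * q ^ j * (2 ^ j * δ)⁻¹ *
        (Metric.closedBall x (2 ^ j * δ)).indicator ψ y) (s := Finset.range (N + 1))
        (fun i _ => mul_nonneg (by positivity) (indicator_nonneg (fun y _ => h0 y) _))
        (Finset.mem_range.2 (Nat.lt_succ_of_le hjN))
    simp only [indicator_of_mem hmem] at this
    exact this
  have hint : ∀ j : ℕ, Integrable (fun y => C * q ^ j * (2 ^ j * δ)⁻¹ *
        (Metric.closedBall x (2 ^ j * δ)).indicator ψ y) haarAddCircle := fun j =>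
    (hψ.indicator measurableSet_closedBall).const_mul _
  refine (integral_mono_of_nonneg (Eventually.of_forall fun y => ?_)
    (integrable_finsetSum _ fun j _ => hint j) (Eventually.of_forall hpt)).trans ?_
  · refine mul_nonneg (div_nonneg (Real.rpow_nonneg ?_ _)
      (Real.rpow_nonneg (norm_nonneg _) _)) (h0 y)
    nlinarith
  rw [integral_finsetSum _ fun j _ => hint j]
  have e : ∀ j : ℕ, ∫ y, C * q ^ j * (2 ^ j * δ)⁻¹ *
        (Metric.closedBall x (2 ^ j * δ)).indicator ψ y ∂haarAddCircle =
        C * q ^ j * A (2 ^ j * δ) := by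
    intro j
    rw [integral_const_mul, integral_indicator measurableSet_closedBall, hA]
    ring
  simp_rw [e]
  refine Summable.sum_le_tsum _ (fun j _ => mul_nonneg (by positivity) (hA0 _ (by positivity))) ?_
  refine Summable.of_nonneg_of_le (fun j => mul_nonneg (by positivity) (hA0 _ (by positivity)))
    (fun j => mul_le_mul_of_nonneg_left (hB _ (by positivity)) (by positivity))
    (((summable_geometric_of_lt_one hq0.le hq1).mul_left C).mul_right B)

/-! ### The `(α, β)`-Poisson kernel and its Fourier coefficients. -/

/-- The Laurent coefficients of the `(α, β)`-Poisson kernel on the circle of radius `r`. -/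
noncomputable def kernCoeff (α β r : ℝ) : ℤ → ℝ
  | Int.ofNat n => (1 - r ^ 2) ^ (1 + α + β) * pochDiag (1 + α) (1 + β) n (r ^ 2) * r ^ n
  | Int.negSucc n =>
    (1 - r ^ 2) ^ (1 + α + β) * pochDiag (1 + β) (1 + α) (n + 1) (r ^ 2) * r ^ (n + 1)

/-- The (unnormalized) `(α, β)`-Poisson kernel on the circle of radius `r`. -/
noncomputable def kern (α β r : ℝ) (y : UnitAddCircle) : ℂ :=
  (((1 - r ^ 2) ^ (1 + α + β) : ℝ) : ℂ) *
    ((1 - (r : ℂ) * fourier 1 y) ^ (-((1 + α : ℝ) : ℂ)) *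
      (1 - (r : ℂ) * fourier (-1) y) ^ (-((1 + β : ℝ) : ℂ)))

/-- The coefficients of a series form, normalized so that they multiply the Laurent coefficients
of the `(α, β)`-Poisson kernel. -/
noncomputable def normalizedCoeff (α β : ℝ) (c : ℤ → ℂ) : ℤ → ℂ
  | Int.ofNat n => c n / pochCoeff (1 + α) n
  | Int.negSucc n => c (-((n : ℤ) + 1)) / pochCoeff (1 + β) (n + 1)

lemma fourier_natCast_eq_pow (n : ℕ) (y : UnitAddCircle) :
    fourier (n : ℤ) y = fourier 1 y ^ n := by
  simp [fourier_apply, AddCircle.toCircle_nsmul]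

lemma fourier_neg_natCast_eq_pow (n : ℕ) (y : UnitAddCircle) :
    fourier (-(n : ℤ)) y = fourier (-1) y ^ n := by
  rw [fourier_neg, fourier_natCast_eq_pow, fourier_neg, map_pow]

/-- For `z = r e^{iy}` and `w = r e^{-iy}` the product `z w = r²` does not depend on `y`, so the
diagonals of the product expansion are genuine Fourier coefficients. -/
lemma hasSum_kernCoeff (α β : ℝ) {r : ℝ} (hr0 : 0 ≤ r) (hr1 : r < 1) (y : UnitAddCircle) :
    HasSum (fun k : ℤ => (kernCoeff α β r k : ℂ) * fourier k y) (kern α β r y) := by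
  have hz : ‖(r : ℂ) * fourier 1 y‖ < 1 := by rwa [norm_ofReal_mul_fourier hr0]
  have hw : ‖(r : ℂ) * fourier (-1) y‖ < 1 := by rwa [norm_ofReal_mul_fourier hr0]
  have hzw : (r : ℂ) * fourier 1 y * ((r : ℂ) * fourier (-1) y) = ((r ^ 2 : ℝ) : ℂ) := by
    have : (fourier 1 y : ℂ) * fourier (-1) y = 1 := by
      rw [← fourier_add]; simp
    push_cast
    linear_combination (r : ℂ) ^ 2 * this
  obtain ⟨h1, h2, h3⟩ := hasSum_one_sub_cpow_mul (1 + α) (1 + β) hz hw hzw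
  rw [kern, h3, mul_add]
  refine HasSum.of_nat_of_neg_add_one ?_ ?_
  · refine (h1.hasSum.mul_left _).congr_fun fun n => ?_
    change ((_ * _ * _ : ℝ) : ℂ) * _ = _
    rw [fourier_natCast_eq_pow, mul_pow]
    push_cast
    ring
  · refine (h2.hasSum.mul_left _).congr_fun fun n => ?_
    have : (-((n : ℤ) + 1)) = Int.negSucc n := by rw [Int.negSucc_eq]
    rw [show kernCoeff α β r (-((n : ℤ) + 1)) = _ from congrArg _ this]
    change ((_ * _ * _ : ℝ) : ℂ) * _ = _
    rw [← Nat.cast_add_one, fourier_neg_natCast_eq_pow, mul_pow]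
    push_cast
    ring

lemma summable_abs_kernCoeff (α β : ℝ) {r : ℝ} (hr0 : 0 ≤ r) (hr1 : r < 1) :
    Summable fun k => |kernCoeff α β r k| := by
  have := (hasSum_kernCoeff α β hr0 hr1 0).summable.norm
  simpa [norm_fourier_apply] using this

/-- The exponents are real and the two bases conjugate, so the modulus depends only on `α + β`.
Hence `α + β > -1` is all that the approximate identity needs. -/
lemma norm_kern (α β : ℝ) {r : ℝ} (hr0 : 0 ≤ r) (hr1 : r < 1) (y : UnitAddCircle) :
    ‖kern α β r y‖ =
      (1 - r ^ 2) ^ (1 + α + β) / ‖1 - (r : ℂ) * fourier 1 y‖ ^ (1 + (1 + α + β)) := by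
  have h1 : 0 ≤ (1 - r ^ 2) ^ (1 + α + β) := Real.rpow_nonneg (by nlinarith) _
  have h2 : 0 < ‖1 - (r : ℂ) * fourier 1 y‖ := by
    linarith [one_sub_le_norm_one_sub_mul_fourier hr0 1 y]
  have h3 : ‖1 - (r : ℂ) * fourier (-1) y‖ = ‖1 - (r : ℂ) * fourier 1 y‖ := by
    rw [← Complex.norm_conj (1 - (r : ℂ) * fourier 1 y), map_sub, map_mul, fourier_neg]
    simp
  rw [kern, norm_mul, norm_mul, Complex.norm_real, Real.norm_of_nonneg h1, ← Complex.ofReal_neg,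
    ← Complex.ofReal_neg, Complex.norm_cpow_real, Complex.norm_cpow_real, h3, ← Real.rpow_add h2,
    div_eq_mul_inv, ← Real.rpow_neg h2.le]
  congr 2
  ring

/-- Convolution with the kernel acts on Fourier coefficients. -/
lemma hasSum_integral_kern_mul (α β : ℝ) {r : ℝ} (hr0 : 0 ≤ r) (hr1 : r < 1) {f : UnitAddCircle → ℂ}
    (hf : Integrable f haarAddCircle) (x : UnitAddCircle) :
    HasSum (fun k : ℤ => (kernCoeff α β r k : ℂ) * fourierCoeff f k * fourier k x)
      (∫ y, kern α β r (x - y) * f y ∂haarAddCircle) := by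
  have hint : ∀ k : ℤ, Integrable (fun y => (kernCoeff α β r k : ℂ) * fourier k (x - y) * f y)
      haarAddCircle := fun k =>
    hf.bdd_mul (c := |kernCoeff α β r k|) (by fun_prop) (Eventually.of_forall fun y => by
      rw [norm_mul, norm_fourier_apply, mul_one, Complex.norm_real, Real.norm_eq_abs])
  have hnorm : ∀ k : ℤ, ∫ y, ‖(kernCoeff α β r k : ℂ) * fourier k (x - y) * f y‖ ∂haarAddCircle =
      |kernCoeff α β r k| * ∫ y, ‖f y‖ ∂haarAddCircle := by
    intro k
    rw [← integral_const_mul]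
    refine integral_congr_ae (Eventually.of_forall fun y => ?_)
    simp only [norm_mul, norm_fourier_apply, mul_one, Complex.norm_real, Real.norm_eq_abs]
  have h := hasSum_integral_of_summable_integral_norm hint (by
    simp_rw [hnorm]
    exact (summable_abs_kernCoeff α β hr0 hr1).mul_right _)
  have e : ∀ y, ∑' k : ℤ, (kernCoeff α β r k : ℂ) * fourier k (x - y) * f y =
      kern α β r (x - y) * f y := by
    intro y
    rw [tsum_mul_right, (hasSum_kernCoeff α β hr0 hr1 (x - y)).tsum_eq]
  simp_rw [e] at h
  refine h.congr_fun fun k => ?_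
  rw [fourierCoeff, mul_assoc, ← integral_mul_const, ← integral_const_mul]
  refine integral_congr_ae (Eventually.of_forall fun y => ?_)
  have : (fourier k (x - y) : ℂ) = fourier k x * fourier (-k) y := by
    simp [fourier_apply, sub_eq_add_neg, smul_add, AddCircle.toCircle_add]
  simp only [smul_eq_mul]
  rw [this]
  ring

lemma integral_kern_mul_fourier (α β : ℝ) {r : ℝ} (hr0 : 0 ≤ r) (hr1 : r < 1) (n : ℤ)
    (x : UnitAddCircle) :
    ∫ y, kern α β r (x - y) * fourier n y ∂haarAddCircle = kernCoeff α β r n * fourier n x := by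
  have h := hasSum_integral_kern_mul α β hr0 hr1 (f := fun y => (fourier n y : ℂ))
    (ContinuousMap.continuous _ |>.integrable_of_hasCompactSupport
      (HasCompactSupport.of_compactSpace _)) x
  refine h.unique ?_
  have h2 := hasSum_ite_eq n ((kernCoeff α β r n : ℂ) * fourier n x)
  refine h2.congr_fun fun k => ?_
  rw [fourierCoeff_fourier]
  split_ifs with hk
  · subst hk; simp
  · simp [hk]

lemma kern_continuous (α β : ℝ) {r : ℝ} (hr0 : 0 ≤ r) (hr1 : r < 1) :
    Continuous (kern α β r) := by
  have h : ∀ (n : ℤ) (y : UnitAddCircle), 1 - (r : ℂ) * fourier n y ∈ Complex.slitPlane := by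
    intro n y
    refine Or.inl ?_
    have h1 := Complex.re_le_norm ((r : ℂ) * fourier n y)
    rw [norm_ofReal_mul_fourier hr0] at h1
    rw [Complex.sub_re, Complex.one_re]
    linarith
  unfold kern
  refine continuous_const.mul (Continuous.mul ?_ ?_) <;>
  · refine Continuous.cpow (by fun_prop) continuous_const (fun y => h _ y)

/-! ### The series form as a Fourier series, and the limit of the kernel coefficients. -/

section SeriesForm

variable {α β : ℝ} {u : ℂ → ℂ} {c : ℤ → ℂ}

lemma seriesTermPos_eq (hα : ∀ n : ℕ, α ≠ -((n : ℝ) + 1)) {r : ℝ} (hr0 : 0 ≤ r) (hr1 : r < 1)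
    (y : UnitAddCircle) (n : ℕ) :
    seriesTermPos α β c (r * fourier 1 y) n =
      normalizedCoeff α β c (n : ℤ) * kernCoeff α β r (n : ℤ) * fourier (n : ℤ) y := by
  have hx : |r ^ 2| < 1 := by
    rw [abs_of_nonneg (by positivity)]; nlinarith
  have hne : (pochCoeff (1 + α) n : ℂ) ≠ 0 := by
    exact_mod_cast pochCoeff_ne_zero (fun m h => hα m (by linarith)) n
  have h := pochCoeff_mul_seriesFun α β n hx
  have e : normalizedCoeff α β c (n : ℤ) = c n / pochCoeff (1 + α) n := rfl
  have e2 : kernCoeff α β r (n : ℤ) =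
    (1 - r ^ 2) ^ (1 + α + β) * pochDiag (1 + α) (1 + β) n (r ^ 2) * r ^ n := rfl
  rw [seriesTermPos, norm_ofReal_mul_fourier hr0, e, e2, ← h, fourier_natCast_eq_pow, mul_pow]
  push_cast
  field_simp

lemma seriesTermNeg_eq (hβ : ∀ n : ℕ, β ≠ -((n : ℝ) + 1)) {r : ℝ} (hr0 : 0 ≤ r) (hr1 : r < 1)
    (y : UnitAddCircle) (n : ℕ) :
    seriesTermNeg α β c (r * fourier 1 y) (n + 1) =
      normalizedCoeff α β c (-((n : ℤ) + 1)) * kernCoeff α β r (-((n : ℤ) + 1)) *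
        fourier (-((n : ℤ) + 1)) y := by
  have hx : |r ^ 2| < 1 := by
    rw [abs_of_nonneg (by positivity)]; nlinarith
  have hne : (pochCoeff (1 + β) (n + 1) : ℂ) ≠ 0 := by
    exact_mod_cast pochCoeff_ne_zero (fun m h => hβ m (by linarith)) (n + 1)
  have h := pochCoeff_mul_seriesFun β α (n + 1) hx
  rw [show 1 + β + α = 1 + α + β by ring] at h
  have e : normalizedCoeff α β c (Int.negSucc n) =
    c (-((n : ℤ) + 1)) / pochCoeff (1 + β) (n + 1) := rfl
  have e2 : kernCoeff α β r (Int.negSucc n) =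
    (1 - r ^ 2) ^ (1 + α + β) * pochDiag (1 + β) (1 + α) (n + 1) (r ^ 2) * r ^ (n + 1) := rfl
  have e3 : -((n : ℤ) + 1) = Int.negSucc n := by rw [Int.negSucc_eq]
  rw [seriesTermNeg, norm_ofReal_mul_fourier hr0]
  rw [show normalizedCoeff α β c (-((n : ℤ) + 1)) = _ from congrArg _ e3,
    show kernCoeff α β r (-((n : ℤ) + 1)) = _ from congrArg _ e3]
  have e4 : (fourier (-((n : ℤ) + 1)) y : ℂ) = fourier (-1) y ^ (n + 1) := by
    rw [← fourier_neg_natCast_eq_pow, Nat.cast_add_one]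
  rw [e, e2, ← h, e4, map_mul, mul_pow, fourier_neg, Complex.conj_ofReal]
  push_cast
  field_simp

lemma HasSeriesForm.hasSum (h : HasSeriesForm α β u c) (hα : ∀ n : ℕ, α ≠ -((n : ℝ) + 1))
    (hβ : ∀ n : ℕ, β ≠ -((n : ℝ) + 1)) {r : ℝ} (hr0 : 0 ≤ r) (hr1 : r < 1) (y : UnitAddCircle) :
    HasSum (fun k : ℤ => normalizedCoeff α β c k * kernCoeff α β r k * fourier k y)
      (u (r * fourier 1 y)) := by
  have hz : (r : ℂ) * fourier 1 y ∈ unitDisk := by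
    rw [Metric.mem_ball, dist_zero_right, norm_ofReal_mul_fourier hr0]; exact hr1
  obtain ⟨h1, h2, h3⟩ := h.2 _ hz
  rw [h3]
  refine HasSum.of_nat_of_neg_add_one ?_ ?_
  · exact h1.hasSum.congr_fun fun n => (seriesTermPos_eq hα hr0 hr1 y n).symm
  · exact h2.hasSum.congr_fun fun n => (seriesTermNeg_eq hβ hr0 hr1 y n).symm

/-- By Euler's transformation the zeroth coefficient is `F(-α, -β; 1; r²)`, and Gauss's theorem
evaluates its limit. -/
lemma tendsto_kernCoeff_zero (hα : ∀ n : ℕ, α ≠ -((n : ℝ) + 1))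
    (hβ : ∀ n : ℕ, β ≠ -((n : ℝ) + 1)) (hαβ : -1 < α + β) :
    Tendsto (fun r => kernCoeff α β r 0) (𝓝[<] 1)
      (𝓝 (Real.Gamma (1 + α + β) / (Real.Gamma (1 + α) * Real.Gamma (1 + β)))) := by
  have h1 := tendsto_ordinaryHypergeometric_one (a := -α) (b := -β) (c := 1) one_pos (by linarith)
  rw [tsum_hypCoeff_eq one_pos (by linarith) (fun n h => hα n (by linarith))
    (fun n h => hβ n (by linarith)), Real.Gamma_one, one_mul] at h1
  simp only [sub_neg_eq_add] at h1
  have hsq : Tendsto (fun r : ℝ => r ^ 2) (𝓝[<] 1) (𝓝[<] 1) := by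
    refine tendsto_nhdsWithin_iff.2 ⟨?_, ?_⟩
    · have : Tendsto (fun r : ℝ => r ^ 2) (𝓝 1) (𝓝 (1 ^ 2)) := (continuous_pow 2).tendsto 1
      simpa using this.mono_left nhdsWithin_le_nhds
    · have h0 : ∀ᶠ x : ℝ in 𝓝[<] 1, 0 < x := nhdsWithin_le_nhds (lt_mem_nhds one_pos)
      filter_upwards [self_mem_nhdsWithin, h0] with r hr hr0
      have : r < 1 := hr
      exact mem_Iio.2 (by nlinarith)
  refine (h1.comp hsq).congr' ?_
  have h0 : ∀ᶠ x : ℝ in 𝓝[<] 1, 0 < x := nhdsWithin_le_nhds (lt_mem_nhds one_pos)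
  filter_upwards [self_mem_nhdsWithin, h0] with r hr hr0
  have hr1 : r < 1 := hr
  have h := pochCoeff_mul_seriesFun α β 0 (x := r ^ 2)
    (by rw [abs_of_nonneg (by positivity)]; nlinarith)
  rw [pochCoeff_zero, one_mul] at h
  have e2 : kernCoeff α β r 0 =
    (1 - r ^ 2) ^ (1 + α + β) * pochDiag (1 + α) (1 + β) 0 (r ^ 2) * r ^ 0 := rfl
  rw [e2, ← h]
  simp

/-- Convergence of `kernel ∗ f` at Lebesgue points of `f`. -/
lemma tendsto_integral_kern_sub (hαβ : -1 < α + β) {f : UnitAddCircle → ℂ} {x : UnitAddCircle}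
    (hf : Integrable f haarAddCircle)
    (hL : Tendsto (fun h : ℝ => h⁻¹ * ∫ y in Metric.closedBall x h, ‖f y - f x‖ ∂haarAddCircle)
      (𝓝[>] 0) (𝓝 0)) :
    Tendsto (fun r : ℝ => (∫ y, kern α β r (x - y) * f y ∂haarAddCircle) - kernCoeff α β r 0 * f x)
      (𝓝[<] 1) (𝓝 0) := by
  have hsub : Integrable (fun y => f y - f x) haarAddCircle := hf.sub (integrable_const _)
  have h := tendsto_integral_kernel (a := 1 + α + β) (by linarith) x (ψ := fun y => ‖f y - f x‖)
    hsub.norm (fun y => norm_nonneg _) hL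
  refine squeeze_zero_norm' ?_ h
  have h0 : ∀ᶠ x : ℝ in 𝓝[<] 1, 0 < x := nhdsWithin_le_nhds (lt_mem_nhds one_pos)
  filter_upwards [self_mem_nhdsWithin, h0] with r hr hr0
  have hr1 : r < 1 := hr
  have hk : Continuous fun y => kern α β r (x - y) :=
    (kern_continuous α β hr0.le hr1).comp (continuous_const.sub continuous_id)
  obtain ⟨B, hB⟩ := (isCompact_range hk).isBounded.exists_norm_le
  have hB' : ∀ᵐ y ∂haarAddCircle, ‖kern α β r (x - y)‖ ≤ B :=
    Eventually.of_forall fun y => hB _ ⟨y, rfl⟩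
  have e1 : ∫ y, kern α β r (x - y) * f x ∂haarAddCircle = kernCoeff α β r 0 * f x := by
    rw [integral_mul_const]
    have := integral_kern_mul_fourier α β hr0.le hr1 0 x
    simp only [fourier_zero, mul_one] at this
    rw [this]
  rw [← e1, ← integral_sub (hf.bdd_mul hk.aestronglyMeasurable hB')
    ((integrable_const _).bdd_mul hk.aestronglyMeasurable hB')]
  refine (norm_integral_le_integral_norm _).trans (le_of_eq ?_)
  refine integral_congr_ae (Eventually.of_forall fun y => ?_)
  simp only
  rw [← mul_sub, norm_mul, norm_kern α β hr0.le hr1]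

/-- Points of continuity are Lebesgue points; needed only for the characters. -/
lemma tendsto_average_of_continuousAt {ψ : UnitAddCircle → ℝ} {x : UnitAddCircle}
    (hψ : ContinuousAt ψ x) (hx : ψ x = 0) (h0 : 0 ≤ ψ) (hint : Integrable ψ haarAddCircle) :
    Tendsto (fun h : ℝ => h⁻¹ * ∫ y in Metric.closedBall x h, ψ y ∂haarAddCircle)
      (𝓝[>] 0) (𝓝 0) := by
  rw [Metric.tendsto_nhds]
  intro ε hε
  have h1 := hψ.eventually_lt_const (u := ε / 3) (by rw [hx]; positivity)
  rw [Metric.eventually_nhds_iff] at h1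
  obtain ⟨δ, hδ, h1⟩ := h1
  filter_upwards [Ioo_mem_nhdsGT hδ] with h hh
  have hvol : haarAddCircle.real (Metric.closedBall x h) ≤ 2 * h := by
    rw [measureReal_def, ← unitAddCircle_volume_eq, AddCircle.volume_closedBall,
      ENNReal.toReal_ofReal (by have := hh.1; positivity)]
    exact min_le_right _ _
  rw [dist_zero_right, Real.norm_of_nonneg (mul_nonneg (inv_nonneg.2 hh.1.le) (integral_nonneg h0)),
    inv_mul_lt_iff₀ hh.1]
  calc ∫ y in Metric.closedBall x h, ψ y ∂haarAddCircle
      ≤ ∫ y in Metric.closedBall x h, ε / 3 ∂haarAddCircle := by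
        refine setIntegral_mono_on hint.integrableOn (integrable_const _).integrableOn
          measurableSet_closedBall fun y hy => (h1 (lt_of_le_of_lt hy hh.2)).le
    _ = haarAddCircle.real (Metric.closedBall x h) * (ε / 3) := by
        rw [setIntegral_const, smul_eq_mul]
    _ ≤ 2 * h * (ε / 3) := mul_le_mul_of_nonneg_right hvol (by positivity)
    _ < h * ε := by nlinarith [hh.1]

/-- Convolving the kernel with the `k`-th character and evaluating at `0` produces the `k`-th
coefficient, and the approximate identity property forces it to share the limit of the zeroth one.
Thus a single application of Gauss's theorem suffices. -/
lemma tendsto_kernCoeff (hα : ∀ n : ℕ, α ≠ -((n : ℝ) + 1))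
    (hβ : ∀ n : ℕ, β ≠ -((n : ℝ) + 1)) (hαβ : -1 < α + β) (k : ℤ) :
    Tendsto (fun r => kernCoeff α β r k) (𝓝[<] 1)
      (𝓝 (Real.Gamma (1 + α + β) / (Real.Gamma (1 + α) * Real.Gamma (1 + β)))) := by
  have hint : Integrable (fun y : UnitAddCircle => (fourier k y : ℂ)) haarAddCircle :=
    ContinuousMap.continuous _ |>.integrable_of_hasCompactSupport
      (HasCompactSupport.of_compactSpace _)
  have h := tendsto_integral_kern_sub hαβ (x := 0) hint
    (tendsto_average_of_continuousAt (by fun_prop) (by simp) (fun y => norm_nonneg _)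
      (hint.sub (integrable_const _)).norm)
  have h2 : Tendsto (fun r : ℝ => kernCoeff α β r k - kernCoeff α β r 0) (𝓝[<] 1) (𝓝 0) := by
    rw [tendsto_zero_iff_norm_tendsto_zero] at h ⊢
    refine h.congr' ?_
    have h0 : ∀ᶠ x : ℝ in 𝓝[<] 1, 0 < x := nhdsWithin_le_nhds (lt_mem_nhds one_pos)
    filter_upwards [self_mem_nhdsWithin, h0] with r hr hr0
    rw [integral_kern_mul_fourier α β hr0.le hr]
    simp only [fourier_eval_zero, mul_one]
    rw [← Complex.ofReal_sub, Complex.norm_real]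
  simpa using h2.add (tendsto_kernCoeff_zero hα hβ hαβ)

end SeriesForm

end Fatou
-- Fatou's theorem and the Heinz quantity on the boundary.
section Fatou2

open MeasureTheory AddCircle

/-- Bessel's inequality for absolutely convergent Fourier series bounded by `1`. -/
lemma sum_sq_norm_le_one_of_hasSum {v : ℤ → ℂ} {U : UnitAddCircle → ℂ}
    (hU : ∀ y, HasSum (fun k : ℤ => v k * fourier k y) (U y)) (hle : ∀ y, ‖U y‖ ≤ 1)
    (s : Finset ℤ) : ∑ k ∈ s, ‖v k‖ ^ 2 ≤ 1 := by
  have hv : Summable fun k => ‖v k‖ := by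
    have := (hU 0).summable.norm
    simpa [norm_fourier_apply] using this
  have hsum : Summable fun k : ℤ => v k • (fourier k : C(UnitAddCircle, ℂ)) := by
    refine Summable.of_norm (hv.congr fun k => ?_)
    rw [norm_smul, fourier_norm, mul_one]
  set f : C(UnitAddCircle, ℂ) := ∑' k, v k • fourier k with hf
  have hfU : ∀ y, f y = U y := by
    intro y
    have h1 := hsum.hasSum.mapL (ContinuousMap.evalCLM ℂ y)
    exact h1.unique (by simpa using hU y)
  have hfn : ‖f‖ ≤ 1 := by
    rw [ContinuousMap.norm_le _ zero_le_one]
    intro y; rw [hfU]; exact hle y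
  set F : Lp ℂ 2 haarAddCircle := ContinuousMap.toLp (E := ℂ) 2 haarAddCircle ℂ f with hF
  have hFn : ‖F‖ ≤ 1 := by
    refine ((ContinuousMap.toLp (E := ℂ) 2 haarAddCircle ℂ).le_opNorm f).trans ?_
    have h2 : ‖ContinuousMap.toLp (E := ℂ) 2 (haarAddCircle : Measure UnitAddCircle) ℂ‖ ≤ 1 := by
      refine (ContinuousMap.toLp_norm_le _).trans (le_of_eq ?_)
      simp [measureUnivNNReal]
    exact mul_le_one₀ h2 (norm_nonneg _) hfn
  have hin : ∀ j, inner ℂ (fourierLp (T := 1) 2 j) F = v j := by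
    intro j
    have h1 := (hsum.hasSum.mapL (ContinuousMap.toLp (E := ℂ) 2 haarAddCircle ℂ)).mapL
      (innerSL ℂ (fourierLp (T := 1) 2 j))
    refine h1.unique ?_
    have h2 := hasSum_ite_eq j (v j)
    refine h2.congr_fun fun k => ?_
    simp only [map_smul, innerSL_apply_apply, smul_eq_mul]
    have := orthonormal_iff_ite.1 (orthonormal_fourier (T := (1 : ℝ))) j k
    rw [fourierLp, fourierLp] at this
    rw [fourierLp, this]
    by_cases hjk : j = k
    · simp [hjk]
    · simp [hjk, Ne.symm hjk]
  have := (orthonormal_fourier (T := (1 : ℝ))).sum_inner_products_le F (s := s)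
  simp_rw [hin] at this
  refine this.trans ?_
  nlinarith [norm_nonneg F]

variable {α β : ℝ} {u : ℂ → ℂ} {c : ℤ → ℂ}

/-- **Fatou's theorem**: a bounded function in series form has radial limits almost everywhere,
whose Fourier coefficients are multiples of the coefficients of the series form. -/
theorem HasSeriesForm.exists_radial_limit (h : HasSeriesForm α β u c)
    (hα : ∀ n : ℕ, α ≠ -((n : ℝ) + 1)) (hβ : ∀ n : ℕ, β ≠ -((n : ℝ) + 1)) (hαβ : -1 < α + β)
    (hu : ∀ z ∈ unitDisk, ‖u z‖ ≤ 1) :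
    ∃ g : UnitAddCircle → ℂ, MemLp g 2 haarAddCircle ∧
      (∀ᵐ x ∂haarAddCircle, Tendsto (fun r : ℝ => u (r * fourier 1 x)) (𝓝[<] 1) (𝓝 (g x))) ∧
      ∀ k, fourierCoeff g k =
        (Real.Gamma (1 + α + β) / (Real.Gamma (1 + α) * Real.Gamma (1 + β)) : ℝ) *
          normalizedCoeff α β c k := by
  set M := Real.Gamma (1 + α + β) / (Real.Gamma (1 + α) * Real.Gamma (1 + β)) with hM
  have hM0 : M ≠ 0 := div_ne_zero (Real.Gamma_pos_of_pos (by linarith)).ne'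
    (mul_ne_zero (Real.Gamma_ne_zero fun n hn => hα n (by linarith))
      (Real.Gamma_ne_zero fun n hn => hβ n (by linarith)))
  set b := normalizedCoeff α β c with hb
  have h0 : ∀ᶠ x : ℝ in 𝓝[<] 1, 0 < x := nhdsWithin_le_nhds (lt_mem_nhds one_pos)
  -- Bessel's inequality on each circle of radius `r`, for finitely many frequencies, followed by `r
  -- → 1`.
  have hbes : ∀ s : Finset ℤ, ∑ k ∈ s, ‖b k‖ ^ 2 ≤ 1 / M ^ 2 := by
    intro s
    have h1 : ∀ᶠ r : ℝ in 𝓝[<] 1, ∑ k ∈ s, ‖b k * kernCoeff α β r k‖ ^ 2 ≤ 1 := by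
      filter_upwards [self_mem_nhdsWithin, h0] with r hr hr0
      refine sum_sq_norm_le_one_of_hasSum (U := fun y => u (r * fourier 1 y))
        (fun y => h.hasSum hα hβ hr0.le hr y) (fun y => hu _ ?_) s
      rw [Metric.mem_ball, dist_zero_right, norm_ofReal_mul_fourier hr0.le]; exact hr
    have h2 : Tendsto (fun r : ℝ => ∑ k ∈ s, ‖b k * kernCoeff α β r k‖ ^ 2) (𝓝[<] 1)
        (𝓝 (∑ k ∈ s, ‖b k * (M : ℂ)‖ ^ 2)) := by
      refine tendsto_finsetSum _ fun k _ => ?_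
      exact ((((Complex.continuous_ofReal.tendsto M).comp
        (tendsto_kernCoeff hα hβ hαβ k)).const_mul (b k)).norm).pow 2
    have h3 := le_of_tendsto h2 h1
    rw [le_div_iff₀ (by positivity), Finset.sum_mul]
    refine le_trans (le_of_eq (Finset.sum_congr rfl fun k _ => ?_)) h3
    rw [norm_mul, mul_pow, Complex.norm_real, Real.norm_eq_abs, sq_abs]
  have hsq : Summable fun k => ‖b k‖ ^ 2 :=
    summable_of_sum_le (fun k => by positivity) hbes
  have hmem : Memℓp b 2 := by
    rw [memℓp_gen_iff (by norm_num)]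
    simpa using hsq
  -- Riesz–Fischer provides a candidate boundary function before any radial limit is known to exist.
  set G : Lp ℂ 2 (haarAddCircle : Measure UnitAddCircle) :=
    fourierBasis.repr.symm ⟨b, hmem⟩ with hG
  have hGc : ∀ k, fourierCoeff (G : UnitAddCircle → ℂ) k = b k := by
    intro k
    rw [← fourierBasis_repr, hG, LinearIsometryEquiv.apply_symm_apply]
  have hGmem : MemLp (G : UnitAddCircle → ℂ) 2 haarAddCircle := Lp.memLp G
  have hGint : Integrable (G : UnitAddCircle → ℂ) haarAddCircle := hGmem.integrable (by norm_num)
  refine ⟨fun x => M * G x, hGmem.const_mul _, ?_, fun k => ?_⟩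
  · have hleb := IsUnifLocDoublingMeasure.ae_tendsto_average_norm_sub
      (volume : Measure UnitAddCircle) (f := (G : UnitAddCircle → ℂ))
      (by rw [unitAddCircle_volume_eq]; exact hGint.locallyIntegrable) 1
    rw [unitAddCircle_volume_eq] at hleb
    filter_upwards [hleb] with x hx
    have hx' := hx (l := 𝓝[>] (0 : ℝ)) (fun _ => x) (fun h => h) tendsto_id (by
      filter_upwards [self_mem_nhdsWithin] with h hh
      have : 0 < h := hh
      simpa using this.le)
    have hL : Tendsto (fun h : ℝ => h⁻¹ * ∫ y in Metric.closedBall x h, ‖G y - G x‖ ∂haarAddCircle)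
        (𝓝[>] 0) (𝓝 0) := by
      have := hx'.const_mul 2
      rw [mul_zero] at this
      refine this.congr' ?_
      filter_upwards [Ioo_mem_nhdsGT (show (0 : ℝ) < 1 / 2 by norm_num)] with h hh
      have hv : haarAddCircle.real (Metric.closedBall x h) = 2 * h := by
        rw [measureReal_def, ← unitAddCircle_volume_eq, AddCircle.volume_closedBall,
          min_eq_right (by linarith [hh.2]), ENNReal.toReal_ofReal (by have := hh.1; positivity)]
      rw [setAverage_eq, hv, smul_eq_mul]
      have := hh.1.ne'
      field_simp
    have h1 := tendsto_integral_kern_sub hαβ hGint hL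
    have h2 := ((Complex.continuous_ofReal.tendsto M).comp
        (tendsto_kernCoeff_zero hα hβ hαβ)).mul_const (G x)
    have h3 := h1.add h2
    rw [zero_add] at h3
    refine h3.congr' ?_
    filter_upwards [self_mem_nhdsWithin, h0] with r hr hr0
    simp only [Function.comp_def, sub_add_cancel]
    -- Both `u` on the circle of radius `r` and the convolution of the kernel with `G` are sums of
    -- the same Fourier series, so they agree.
    refine (hasSum_integral_kern_mul α β hr0.le hr hGint x).unique ?_
    refine (h.hasSum hα hβ hr0.le hr x).congr_fun fun k => ?_
    rw [hGc]
    ring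
  · rw [← hGc k, ← smul_eq_mul, ← fourierCoeff.const_smul]
    rfl

/-- The Heinz quantity in terms of the Fourier coefficients of the boundary function. -/
lemma heinzQuantity_eq {g : UnitAddCircle → ℂ} (hg : ∀ k, fourierCoeff g k =
        (Real.Gamma (1 + α + β) / (Real.Gamma (1 + α) * Real.Gamma (1 + β)) : ℝ) *
          normalizedCoeff α β c k) :
    heinzQuantity α β c = ‖fourierCoeff g 1‖ ^ 2 + 3 * √3 / Real.pi * ‖fourierCoeff g 0‖ ^ 2 +
      ‖fourierCoeff g (-1)‖ ^ 2 := by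
  have e1 : normalizedCoeff α β c 1 = c 1 / pochCoeff (1 + α) 1 := rfl
  have e0 : normalizedCoeff α β c 0 = c 0 / pochCoeff (1 + α) 0 := rfl
  have e2 : normalizedCoeff α β c (-1) = c (-1) / pochCoeff (1 + β) 1 := rfl
  have hp : ∀ s, pochCoeff s 1 = s := fun s => by
    rw [← zero_add 1, pochCoeff_succ, pochCoeff_zero]; simp
  rw [hg, hg, hg, e1, e0, e2, hp, hp, pochCoeff_zero, heinzQuantity]
  simp only [norm_mul, norm_div, Complex.norm_real, mul_pow, div_pow, Real.norm_eq_abs, sq_abs,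
    one_pow, abs_one]
  ring

end Fatou2

/-! ### Parametrisation of the circle by full turns. -/

/-- The point `e^{2πit}` of the unit circle. -/
noncomputable def circ (t : ℝ) : ℂ := Complex.exp ((2 * Real.pi * t : ℝ) * Complex.I)

lemma norm_circ (t : ℝ) : ‖circ t‖ = 1 := Complex.norm_exp_ofReal_mul_I _

lemma circ_ne_zero (t : ℝ) : circ t ≠ 0 := Complex.exp_ne_zero _

lemma continuous_circ : Continuous circ := by unfold circ; fun_prop

lemma circ_add (s t : ℝ) : circ (s + t) = circ s * circ t := by
  rw [circ, circ, circ, ← Complex.exp_add]; congr 1; push_cast; ring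

lemma circ_zero : circ 0 = 1 := by simp [circ]

lemma circ_intCast (n : ℤ) : circ n = 1 := by
  rw [circ, Complex.exp_eq_one_iff]; exact ⟨n, by push_cast; ring⟩

lemma circ_eq_iff {s t : ℝ} : circ s = circ t ↔ ∃ n : ℤ, s = t + n := by
  constructor
  · intro h
    rw [circ, circ, Complex.exp_eq_exp_iff_exists_int] at h
    obtain ⟨n, hn⟩ := h
    refine ⟨n, ?_⟩
    have h1 := congrArg Complex.im hn
    simp at h1
    have h2 : 2 * Real.pi * (s - t - n) = 0 := by linarith
    have h3 : (2 * Real.pi) ≠ 0 := by positivity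
    have := (mul_eq_zero.1 h2).resolve_left h3
    linarith
  · rintro ⟨n, rfl⟩
    rw [circ_add, circ_intCast, mul_one]

lemma fourier_one_coe (t : ℝ) : (fourier 1 (t : UnitAddCircle) : ℂ) = circ t := by
  rw [fourier_coe_apply, circ]; congr 1; push_cast; ring

lemma re_circ_mul_conj_circ (s t : ℝ) :
    (circ s * conj (circ t)).re = Real.cos (2 * Real.pi * (s - t)) := by
  have : circ s * conj (circ t) = circ (s - t) := by
    rw [circ, circ, circ, ← Complex.exp_conj, ← Complex.exp_add]
    congr 1
    rw [map_mul, Complex.conj_ofReal, Complex.conj_I]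
    push_cast
    ring
  rw [this, circ, Complex.exp_ofReal_mul_I_re]

lemma exists_eq_norm_mul_circ (z : ℂ) (φ : ℝ) :
    z = ‖z‖ * circ (φ + Complex.arg (z / circ φ) / (2 * Real.pi)) := by
  have h := Complex.norm_mul_exp_arg_mul_I (z / circ φ)
  rw [norm_div, norm_circ, div_one, eq_div_iff (circ_ne_zero φ)] at h
  have e : circ (Complex.arg (z / circ φ) / (2 * Real.pi)) =
      Complex.exp (Complex.arg (z / circ φ) * Complex.I) := by
    rw [circ]; congr 2; congr 1; field_simp
  rw [circ_add, e]
  nth_rw 1 [← h]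
  ring

lemma norm_circ_sub_circ_le (s t : ℝ) : ‖circ s - circ t‖ ≤ 2 * Real.pi * |s - t| := by
  have e : circ s - circ t = circ t * (Complex.exp (Complex.I * (2 * Real.pi * (s - t) : ℝ)) - 1) := by
    have : s = t + (s - t) := by ring
    rw [mul_sub, mul_one]
    nth_rw 1 [this]
    rw [circ_add]
    congr 2
    rw [circ, mul_comm]
  rw [e, norm_mul, norm_circ, one_mul]
  refine (Real.norm_exp_I_mul_ofReal_sub_one_le).trans (le_of_eq ?_)
  rw [norm_mul, Real.norm_of_nonneg (by positivity), Real.norm_eq_abs]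

/-! ### Radial limits of a disk homeomorphism respect the cyclic order. -/

section BoundaryOrder

variable {u v : ℂ → ℂ}

/-- A compact initial segment of the ray has image at positive distance from the circle, and the
remaining segment is mapped close to the limit. -/
lemma ray_near_limit (hu : ContinuousOn u unitDisk) (hmaps : MapsTo u unitDisk unitDisk) {x : ℝ}
    {g : ℂ} (hlim : Tendsto (fun r : ℝ => u (r * circ x)) (𝓝[<] 1) (𝓝 g)) {d : ℝ} (hd : 0 < d) :
    ∃ ε > 0, ∀ r : ℝ, 0 ≤ r → r < 1 →
      ‖u (r * circ x)‖ ≤ 1 - ε ∨ ‖u (r * circ x) - g‖ < d := by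
  have hev := Metric.tendsto_nhds.1 hlim d hd
  rw [eventually_nhdsWithin_iff, Metric.eventually_nhds_iff] at hev
  obtain ⟨δ, hδ, hev⟩ := hev
  have hmem : ∀ r : ℝ, 0 ≤ r → r < 1 → (r : ℂ) * circ x ∈ unitDisk := by
    intro r h0 h1
    rw [Metric.mem_ball, dist_zero_right, norm_mul, norm_circ, mul_one, Complex.norm_real,
      Real.norm_of_nonneg h0]
    exact h1
  have hr1 : max 0 (1 - δ) < 1 := max_lt one_pos (by linarith)
  have hcont : ContinuousOn (fun r : ℝ => ‖u (r * circ x)‖) (Icc 0 (max 0 (1 - δ))) := by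
    refine (hu.comp (f := fun r : ℝ => (r : ℂ) * circ x) (by fun_prop) ?_).norm
    exact fun r hr => hmem r hr.1 (hr.2.trans_lt hr1)
  obtain ⟨r₀, hr₀, hmax⟩ := isCompact_Icc.exists_isMaxOn
    (nonempty_Icc.2 (le_max_left _ _)) hcont
  refine ⟨1 - ‖u (r₀ * circ x)‖, ?_, fun r h0 h1 => ?_⟩
  · have := hmaps (hmem r₀ hr₀.1 (hr₀.2.trans_lt hr1))
    rw [Metric.mem_ball, dist_zero_right] at this
    linarith
  · rcases le_or_gt r (max 0 (1 - δ)) with h | h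
    · left
      have := hmax (⟨h0, h⟩ : r ∈ Icc 0 (max 0 (1 - δ)))
      simp only [mem_ofPred_eq] at this
      linarith
    · right
      have h2 : 1 - δ < r := (le_max_right _ _).trans_lt h
      rw [← dist_eq_norm]
      exact hev (by rw [Real.dist_eq, abs_lt]; constructor <;> linarith) h1

/-- A homeomorphism of the disk with radial limits cannot interleave them: if `x₁ < x₂ < x₃ < x₄`
in cyclic order, the limits at `x₂` and `x₄` do not lie on a common arc avoiding the limits at `x₁`
and `x₃`. -/
theorem radial_limits_not_interleaved (hu : ContinuousOn u unitDisk)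
    (hmaps : MapsTo u unitDisk unitDisk) (hv : ContinuousOn v unitDisk)
    (hvmaps : MapsTo v unitDisk unitDisk) (huv : ∀ w ∈ unitDisk, u (v w) = w)
    (hvu : ∀ z ∈ unitDisk, v (u z) = z) {x₁ x₂ x₃ x₄ : ℝ} (h12 : x₁ < x₂) (h23 : x₂ < x₃)
    (h34 : x₃ < x₄) (h41 : x₄ < x₁ + 1) {g₁ g₃ : ℂ} {φ₂ φ₄ : ℝ}
    (hl₁ : Tendsto (fun r : ℝ => u (r * circ x₁)) (𝓝[<] 1) (𝓝 g₁))
    (hl₂ : Tendsto (fun r : ℝ => u (r * circ x₂)) (𝓝[<] 1) (𝓝 (circ φ₂)))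
    (hl₃ : Tendsto (fun r : ℝ => u (r * circ x₃)) (𝓝[<] 1) (𝓝 g₃))
    (hl₄ : Tendsto (fun r : ℝ => u (r * circ x₄)) (𝓝[<] 1) (𝓝 (circ φ₄)))
    (havoid : ∀ φ ∈ uIcc φ₂ φ₄, circ φ ≠ g₁ ∧ circ φ ≠ g₃) : False := by
  -- distance from the arc to `g₁`, `g₃`
  obtain ⟨d, hd, hdist⟩ : ∃ d > 0, ∀ φ ∈ uIcc φ₂ φ₄, d ≤ ‖circ φ - g₁‖ ∧ d ≤ ‖circ φ - g₃‖ := by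
    have hc : ContinuousOn (fun φ => min ‖circ φ - g₁‖ ‖circ φ - g₃‖) (uIcc φ₂ φ₄) := by
      have := continuous_circ
      fun_prop
    obtain ⟨φ₀, hφ₀, hmin⟩ := isCompact_uIcc.exists_isMinOn nonempty_uIcc hc
    refine ⟨min ‖circ φ₀ - g₁‖ ‖circ φ₀ - g₃‖, ?_, fun φ hφ => ?_⟩
    · obtain ⟨a, b⟩ := havoid φ₀ hφ₀
      exact lt_min (norm_pos_iff.2 (sub_ne_zero.2 a)) (norm_pos_iff.2 (sub_ne_zero.2 b))
    · have := hmin hφ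
      simp only [mem_ofPred_eq] at this
      exact ⟨this.trans (min_le_left _ _), this.trans (min_le_right _ _)⟩
  obtain ⟨ε₁, hε₁, hray₁⟩ := ray_near_limit hu hmaps hl₁ (half_pos hd)
  obtain ⟨ε₃, hε₃, hray₃⟩ := ray_near_limit hu hmaps hl₃ (half_pos hd)
  set ε := min (min ε₁ ε₃) (min (d / 8) (1 / 2)) with hε
  have hε0 : 0 < ε := by
    simp only [hε, lt_min_iff]; exact ⟨⟨hε₁, hε₃⟩, by positivity, by norm_num⟩
  have hεε₁ : ε ≤ ε₁ := (min_le_left _ _).trans (min_le_left _ _)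
  have hεε₃ : ε ≤ ε₃ := (min_le_left _ _).trans (min_le_right _ _)
  have hεd : ε ≤ d / 8 := (min_le_right _ _).trans (min_le_left _ _)
  have hε2 : ε ≤ 1 / 2 := (min_le_right _ _).trans (min_le_right _ _)
  -- An angular error of `η` turns moves a point of the circle by at most `2πη = d/8`; with a radial
  -- error of at most `d/8`, every point of `S` is within `d/4` of the arc.
  set η := d / (16 * Real.pi) with hη
  have hη0 : 0 < η := by positivity
  -- A thin sector of an annulus along the arc. It is connected and contains image points of the
  -- second and the fourth ray, but it misses the images of the first and the third ray, which stay
  -- either deeper in the disk or close to `g₁` and `g₃`.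
  set S : Set ℂ := (fun p : ℝ × ℝ => (p.1 : ℂ) * circ p.2) ''
    (Ioo (1 - ε) 1 ×ˢ Ioo (min φ₂ φ₄ - η) (max φ₂ φ₄ + η)) with hS
  have hSconn : IsPreconnected S := by
    refine IsPreconnected.image ?_ _ ?_
    · exact ((convex_Ioo _ _).prod (convex_Ioo _ _)).isPreconnected
    · have := continuous_circ
      fun_prop
  have hSnorm : ∀ w ∈ S, 1 - ε < ‖w‖ ∧ ‖w‖ < 1 := by
    rintro _ ⟨⟨ρ, φ⟩, ⟨hρ, -⟩, rfl⟩
    have : 0 ≤ ρ := by linarith [hρ.1]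
    simp only [norm_mul, norm_circ, mul_one, Complex.norm_real, Real.norm_of_nonneg this]
    exact hρ
  have hSfar : ∀ w ∈ S, d / 2 ≤ ‖w - g₁‖ ∧ d / 2 ≤ ‖w - g₃‖ := by
    rintro _ ⟨⟨ρ, φ⟩, ⟨hρ, hφ⟩, rfl⟩
    obtain ⟨φ', hφ', hφφ'⟩ : ∃ φ' ∈ uIcc φ₂ φ₄, |φ - φ'| ≤ η := by
      rcases le_or_gt φ (min φ₂ φ₄) with h | h
      · refine ⟨min φ₂ φ₄, ⟨le_rfl, min_le_max⟩, ?_⟩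
        rw [abs_le]; constructor <;> linarith [hφ.1]
      · rcases le_or_gt φ (max φ₂ φ₄) with h' | h'
        · exact ⟨φ, ⟨h.le, h'⟩, by simpa using hη0.le⟩
        · refine ⟨max φ₂ φ₄, ⟨min_le_max, le_rfl⟩, ?_⟩
          rw [abs_le]; constructor <;> linarith [hφ.2]
    have h1 : ‖(ρ : ℂ) * circ φ - circ φ'‖ ≤ d / 4 := by
      have e : (ρ : ℂ) * circ φ - circ φ' = ((ρ - 1 : ℝ) : ℂ) * circ φ + (circ φ - circ φ') := by
        push_cast; ring
      rw [e]
      refine (norm_add_le _ _).trans ?_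
      rw [norm_mul, norm_circ, mul_one, Complex.norm_real, Real.norm_eq_abs, abs_of_nonpos
        (by linarith [hρ.2])]
      have h2 := norm_circ_sub_circ_le φ φ'
      have h3 : 2 * Real.pi * |φ - φ'| ≤ 2 * Real.pi * η :=
        mul_le_mul_of_nonneg_left hφφ' (by positivity)
      have h4 : 2 * Real.pi * η = d / 8 := by rw [hη]; field_simp; norm_num
      linarith [hρ.1]
    obtain ⟨a, b⟩ := hdist φ' hφ'
    have h2 := norm_sub_le_norm_sub_add_norm_sub (circ φ') ((ρ : ℂ) * circ φ) g₁
    have h3 := norm_sub_le_norm_sub_add_norm_sub (circ φ') ((ρ : ℂ) * circ φ) g₃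
    rw [norm_sub_rev (circ φ') ((ρ : ℂ) * circ φ)] at h2 h3
    constructor <;> simp only <;> linarith
  have hmem : ∀ (x r : ℝ), 0 ≤ r → r < 1 → (r : ℂ) * circ x ∈ unitDisk := by
    intro x r h0 h1
    rw [Metric.mem_ball, dist_zero_right, norm_mul, norm_circ, mul_one, Complex.norm_real,
      Real.norm_of_nonneg h0]
    exact h1
  -- points of the second and fourth ray whose image lies in `S`
  have hpoint : ∀ x φ : ℝ, φ ∈ uIcc φ₂ φ₄ →
      Tendsto (fun r : ℝ => u (r * circ x)) (𝓝[<] 1) (𝓝 (circ φ)) →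
      ∃ r : ℝ, 0 < r ∧ r < 1 ∧ u (r * circ x) ∈ S := by
    intro x φ hφ hl
    have h1 : ∀ᶠ w in 𝓝 (circ φ), |Complex.arg (w / circ φ)| < 2 * Real.pi * η := by
      have hc : ContinuousAt (fun w => |Complex.arg (w / circ φ)|) (circ φ) := by
        refine ContinuousAt.abs (ContinuousAt.comp (g := Complex.arg) ?_
          (continuousAt_id.div_const _))
        rw [div_self (circ_ne_zero φ)]
        exact Complex.continuousAt_arg (by simp)
      refine hc.eventually_lt_const ?_
      change |Complex.arg (circ φ / circ φ)| < _
      rw [div_self (circ_ne_zero φ), Complex.arg_one, abs_zero]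
      positivity
    have h2 : ∀ᶠ w in 𝓝 (circ φ), 1 - ε < ‖w‖ :=
      continuous_norm.continuousAt.eventually_const_lt (by
      change _ < ‖circ φ‖; rw [norm_circ]; linarith)
    have h0 : ∀ᶠ x : ℝ in 𝓝[<] 1, 0 < x := nhdsWithin_le_nhds (lt_mem_nhds one_pos)
    obtain ⟨r, ⟨ha, hb⟩, hr0, hr1⟩ := ((hl.eventually (h1.and h2)).and
      (h0.and self_mem_nhdsWithin)).exists
    have hr1' : r < 1 := hr1
    refine ⟨r, hr0, hr1, ?_⟩
    have hw := hmaps (hmem x r hr0.le hr1)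
    rw [Metric.mem_ball, dist_zero_right] at hw
    refine ⟨(‖u (r * circ x)‖, φ + Complex.arg (u (r * circ x) / circ φ) / (2 * Real.pi)),
      ⟨⟨hb, hw⟩, ?_⟩, (exists_eq_norm_mul_circ _ _).symm⟩
    have h3 : |Complex.arg (u (r * circ x) / circ φ) / (2 * Real.pi)| < η := by
      rw [abs_div, abs_of_pos (a := 2 * Real.pi) (by positivity), div_lt_iff₀ (by positivity)]
      linarith
    rw [abs_lt] at h3
    exact ⟨by linarith [hφ.1, h3.1], by linarith [hφ.2, h3.2]⟩
  obtain ⟨r₂, hr₂0, hr₂1, hS₂⟩ := hpoint x₂ φ₂ left_mem_uIcc hl₂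
  obtain ⟨r₄, hr₄0, hr₄1, hS₄⟩ := hpoint x₄ φ₄ right_mem_uIcc hl₄
  -- a function on the disk vanishing exactly on the first and the third ray
  set m := (x₁ + x₃) / 2 with hm
  set h := (x₃ - x₁) / 2 with hh
  set q : ℂ → ℝ := fun z => (z * conj (circ m)).re - ‖z‖ * Real.cos (2 * Real.pi * h) with hq
  have hqray : ∀ x r : ℝ, 0 ≤ r → q (r * circ x) =
      r * (Real.cos (2 * Real.pi * (x - m)) - Real.cos (2 * Real.pi * h)) := by
    intro x r hr
    simp only [hq]
    rw [norm_mul, norm_circ, mul_one, Complex.norm_real, Real.norm_of_nonneg hr, mul_assoc,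
      Complex.re_ofReal_mul, re_circ_mul_conj_circ]
    ring
  have hh0 : 0 < h := by rw [hh]; linarith
  have hh1 : h < 1 / 2 := by rw [hh]; linarith
  have hpi := Real.pi_pos
  have hq₂ : 0 < q (v (u (r₂ * circ x₂))) := by
    rw [hvu _ (hmem x₂ r₂ hr₂0.le hr₂1), hqray _ _ hr₂0.le]
    refine mul_pos hr₂0 (sub_pos.2 ?_)
    rw [← Real.cos_abs (2 * Real.pi * (x₂ - m))]
    refine Real.cos_lt_cos_of_nonneg_of_le_pi (abs_nonneg _) (by nlinarith) ?_
    rw [abs_mul, abs_of_pos (a := 2 * Real.pi) (by positivity)]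
    refine mul_lt_mul_of_pos_left ?_ (by positivity)
    rw [abs_lt]; constructor <;> linarith
  have hq₄ : q (v (u (r₄ * circ x₄))) < 0 := by
    rw [hvu _ (hmem x₄ r₄ hr₄0.le hr₄1), hqray _ _ hr₄0.le]
    refine mul_neg_of_pos_of_neg hr₄0 (sub_neg.2 ?_)
    have e : Real.cos (2 * Real.pi * (x₄ - m)) =
        -Real.cos |2 * Real.pi * (x₄ - m - 1 / 2)| := by
      rw [Real.cos_abs, ← Real.cos_add_pi]
      congr 1; ring
    have e2 : Real.cos (2 * Real.pi * h) = -Real.cos (2 * Real.pi * (1 / 2 - h)) := by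
      rw [show 2 * Real.pi * (1 / 2 - h) = Real.pi - 2 * Real.pi * h by ring, Real.cos_pi_sub,
        neg_neg]
    rw [e, e2, neg_lt_neg_iff]
    refine Real.cos_lt_cos_of_nonneg_of_le_pi (abs_nonneg _) (by nlinarith) ?_
    rw [abs_mul, abs_of_pos (a := 2 * Real.pi) (by positivity)]
    refine mul_lt_mul_of_pos_left ?_ (by positivity)
    rw [abs_lt]; constructor <;> linarith
  have hSD : S ⊆ unitDisk := fun w hw => by
    rw [Metric.mem_ball, dist_zero_right]; exact (hSnorm w hw).2
  have hqc : ContinuousOn (fun w => q (v w)) S := by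
    have : Continuous q := by fun_prop
    exact this.comp_continuousOn (hv.mono hSD)
  -- Pulled back by `v`, the connected set `S` joins the two sides of the pair of rays 1 and 3 (a
  -- cut of the disk), so it must meet one of these rays: a contradiction.
  obtain ⟨w, hwS, hw0⟩ := hSconn.intermediate_value hS₄ hS₂ hqc
    (show (0 : ℝ) ∈ Icc _ _ from ⟨hq₄.le, hq₂.le⟩)
  have hvw := hvmaps (hSD hwS)
  rw [Metric.mem_ball, dist_zero_right] at hvw
  have hz := exists_eq_norm_mul_circ (v w) 0
  set x := 0 + Complex.arg (v w / circ 0) / (2 * Real.pi) with hx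
  set r := ‖v w‖ with hr
  have hr0 : 0 ≤ r := norm_nonneg _
  have hq0 : q (v w) = 0 := hw0
  rw [hz, hqray _ _ hr0] at hq0
  have huw : u (v w) = w := huv w (hSD hwS)
  have hcases : v w = r * circ x₁ ∨ v w = r * circ x₃ := by
    rcases mul_eq_zero.1 hq0 with h0 | h0
    · left; rw [hz, h0]; simp
    · rw [sub_eq_zero, Real.cos_eq_cos_iff] at h0
      obtain ⟨k, hk | hk⟩ := h0
      · right
        rw [hz]
        congr 1
        rw [circ_eq_iff]
        refine ⟨-k, ?_⟩
        have h1 : 2 * Real.pi * (h - k - (x - m)) = 0 := by linarith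
        have h2 := (mul_eq_zero.1 h1).resolve_left (by positivity)
        push_cast
        linarith
      · left
        rw [hz]
        congr 1
        rw [circ_eq_iff]
        refine ⟨k, ?_⟩
        have h1 : 2 * Real.pi * (h - k + (x - m)) = 0 := by linarith
        have h2 := (mul_eq_zero.1 h1).resolve_left (by positivity)
        linarith
  rcases hcases with hc | hc
  · rcases hray₁ r hr0 hvw with h1 | h1
    · rw [← hc, huw] at h1
      linarith [(hSnorm w hwS).1]
    · rw [← hc, huw] at h1
      linarith [(hSfar w hwS).1]
  · rcases hray₃ r hr0 hvw with h1 | h1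
    · rw [← hc, huw] at h1
      linarith [(hSnorm w hwS).1]
    · rw [← hc, huw] at h1
      linarith [(hSfar w hwS).2]

end BoundaryOrder

/-! ### Sense-preserving maps are local homeomorphisms; properness of disk maps. -/

section LocalHomeo

lemma fderiv_apply_eq_wirtinger (u : ℂ → ℂ) (z w : ℂ) :
    fderiv ℝ u z w = wirtingerDz u z * w + wirtingerDzbar u z * conj w := by
  have h : fderiv ℝ u z w = w.re * fderiv ℝ u z 1 + w.im * fderiv ℝ u z Complex.I := by
    have e : w = w.re • (1 : ℂ) + w.im • Complex.I := by
      simp [Complex.re_add_im]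
    nth_rw 1 [e]
    rw [map_add, map_smul, map_smul, Complex.real_smul, Complex.real_smul]
  have e1 : conj w = w.re - w.im * Complex.I := by
    apply Complex.ext <;> simp
  rw [h, wirtingerDz, wirtingerDzbar, e1]
  nth_rw 3 [← Complex.re_add_im w]
  linear_combination ((w.im : ℂ) * fderiv ℝ u z Complex.I) * Complex.I_sq

/-- A kernel vector `w` would satisfy `|u_z| |w| = |u_z̄| |w|`. -/
lemma injective_fderiv_of_wirtinger {u : ℂ → ℂ} {z : ℂ}
    (h : ‖wirtingerDzbar u z‖ < ‖wirtingerDz u z‖) : Function.Injective (fderiv ℝ u z) := by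
  refine (injective_iff_map_eq_zero _).2 fun w hw => ?_
  rw [fderiv_apply_eq_wirtinger] at hw
  have h2 := congrArg norm (eq_neg_of_add_eq_zero_left hw)
  rw [norm_neg, norm_mul, norm_mul, RCLike.norm_conj] at h2
  by_contra hne
  have : 0 < ‖w‖ := norm_pos_iff.2 hne
  nlinarith

lemma exists_hasStrictFDerivAt_equiv_of_wirtinger {u : ℂ → ℂ} {z : ℂ} (hu : ContDiffAt ℝ 1 u z)
    (h : ‖wirtingerDzbar u z‖ < ‖wirtingerDz u z‖) :
    ∃ e : ℂ ≃L[ℝ] ℂ, HasStrictFDerivAt u (e : ℂ →L[ℝ] ℂ) z := by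
  have hinj := injective_fderiv_of_wirtinger h
  refine ⟨(LinearEquiv.ofInjectiveEndo (fderiv ℝ u z : ℂ →ₗ[ℝ] ℂ) hinj).toContinuousLinearEquiv, ?_⟩
  convert! hu.hasStrictFDerivAt one_ne_zero

variable {α β : ℝ} {u : ℂ → ℂ} {c : ℤ → ℂ}

lemma isOpen_unitDisk : IsOpen unitDisk := Metric.isOpen_ball

lemma mem_unitDisk {z : ℂ} : z ∈ unitDisk ↔ ‖z‖ < 1 := by
  rw [Metric.mem_ball, dist_zero_right]

lemma map_nhds_eq_of_sensePreserving (hu : ContDiffOn ℝ 2 u unitDisk) (hs : IsSensePreserving u)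
    {z : ℂ} (hz : z ∈ unitDisk) : map u (𝓝 z) = 𝓝 (u z) := by
  obtain ⟨e, he⟩ := exists_hasStrictFDerivAt_equiv_of_wirtinger
    ((hu.contDiffAt (isOpen_unitDisk.mem_nhds hz)).of_le (by norm_num)) (hs z hz)
  exact he.map_nhds_eq_of_equiv

lemma exists_injOn_nhds_of_sensePreserving (hu : ContDiffOn ℝ 2 u unitDisk)
    (hs : IsSensePreserving u) {z : ℂ} (hz : z ∈ unitDisk) : ∃ W ∈ 𝓝 z, InjOn u W := by
  obtain ⟨e, he⟩ := exists_hasStrictFDerivAt_equiv_of_wirtinger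
    ((hu.contDiffAt (isOpen_unitDisk.mem_nhds hz)).of_le (by norm_num)) (hs z hz)
  exact ⟨_, (he.toOpenPartialHomeomorph u).open_source.mem_nhds
    he.mem_toOpenPartialHomeomorph_source, (he.toOpenPartialHomeomorph u).injOn⟩

lemma IsABHarmonicDiskMap.mapsTo (h : IsABHarmonicDiskMap α β u c) :
    MapsTo u unitDisk unitDisk := fun _ hz => h.onto ▸ mem_image_of_mem u hz

lemma IsABHarmonicDiskMap.exists_inverse (h : IsABHarmonicDiskMap α β u c) :
    ∃ v : ℂ → ℂ, ContinuousOn v unitDisk ∧ MapsTo v unitDisk unitDisk ∧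
      (∀ w ∈ unitDisk, u (v w) = w) ∧ ∀ z ∈ unitDisk, v (u z) = z := by
  have hv : ∀ w ∈ unitDisk, ∃ z ∈ unitDisk, u z = w := fun w hw => by
    rwa [← h.onto] at hw
  choose! v hvm hv using hv
  have hvu : ∀ z ∈ unitDisk, v (u z) = z := fun z hz =>
    h.univalent (hvm _ (h.mapsTo hz)) hz (hv _ (h.mapsTo hz))
  refine ⟨v, fun w hw => ContinuousAt.continuousWithinAt ?_, hvm, hv, hvu⟩
  have hm := map_nhds_eq_of_sensePreserving h.harmonic.1 h.sensePreserving (hvm w hw)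
  rw [hv w hw] at hm
  rw [ContinuousAt, ← hm, tendsto_map'_iff]
  refine tendsto_id.congr' ?_
  filter_upwards [isOpen_unitDisk.mem_nhds (hvm w hw)] with z hz using (hvu z hz).symm

/-- A homeomorphism of the disk is proper. Were the limit interior, the end of the ray would lie in
the image under `v` of a closed disk of radius less than 1, which is compact in the open disk. -/
lemma norm_eq_one_of_radial_limit {v : ℂ → ℂ} (hmaps : MapsTo u unitDisk unitDisk)
    (hv : ContinuousOn v unitDisk) (hvmaps : MapsTo v unitDisk unitDisk)
    (hvu : ∀ z ∈ unitDisk, v (u z) = z) {x : ℝ} {g : ℂ}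
    (hlim : Tendsto (fun r : ℝ => u (r * circ x)) (𝓝[<] 1) (𝓝 g)) : ‖g‖ = 1 := by
  have hmem : ∀ᶠ r : ℝ in 𝓝[<] 1, 0 < r ∧ r < 1 ∧ (r : ℂ) * circ x ∈ unitDisk := by
    filter_upwards [nhdsWithin_le_nhds (lt_mem_nhds (one_pos (α := ℝ))), self_mem_nhdsWithin]
      with r h0 h1
    refine ⟨h0, h1, ?_⟩
    rw [mem_unitDisk, norm_mul, norm_circ, mul_one, Complex.norm_real, Real.norm_of_nonneg h0.le]
    exact h1
  refine le_antisymm ?_ ?_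
  · refine le_of_tendsto hlim.norm ?_
    filter_upwards [hmem] with r hr
    exact (mem_unitDisk.1 (hmaps hr.2.2)).le
  · by_contra hg
    obtain ⟨ρ, hρ1, hρ2⟩ := exists_between (not_le.1 hg)
    have hK : IsCompact (v '' Metric.closedBall 0 ρ) := by
      refine (isCompact_closedBall _ _).image_of_continuousOn (hv.mono ?_)
      exact Metric.closedBall_subset_ball hρ2
    have hne : (v '' Metric.closedBall 0 ρ).Nonempty :=
      ⟨v 0, mem_image_of_mem _ (by simpa using (norm_nonneg g).trans hρ1.le)⟩
    obtain ⟨z₀, hz₀, hmax⟩ := hK.exists_isMaxOn hne continuous_norm.continuousOn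
    have hz₀1 : ‖z₀‖ < 1 := by
      obtain ⟨w, hw, rfl⟩ := hz₀
      exact mem_unitDisk.1 (hvmaps (Metric.closedBall_subset_ball hρ2 hw))
    obtain ⟨r, ⟨hr, hr0⟩, hr3⟩ := ((hmem.and (nhdsWithin_le_nhds (lt_mem_nhds hz₀1))).and
      (hlim.norm.eventually (gt_mem_nhds hρ1))).exists
    have : (r : ℂ) * circ x ∈ v '' Metric.closedBall 0 ρ :=
      ⟨u (r * circ x), by simpa using hr3.le, hvu _ hr.2.2⟩
    have h2 := hmax this
    simp only [mem_ofPred_eq, norm_mul, norm_circ, mul_one, Complex.norm_real,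
      Real.norm_of_nonneg hr.1.le] at h2
    linarith

end LocalHomeo

/-! ### Squared side lengths of inscribed polygons. -/

section CyclicSums

/-- Half the squared length of the chord spanned by an arc of `t` full turns. -/
noncomputable def chord (t : ℝ) : ℝ := 1 - Real.cos (2 * Real.pi * t)

lemma chord_add_int (t : ℝ) (n : ℤ) : chord (t + n) = chord t := by
  rw [chord, chord, mul_add, show 2 * Real.pi * (n : ℝ) = n * (2 * Real.pi) by ring,
    Real.cos_add_int_mul_two_pi]

lemma chord_neg (t : ℝ) : chord (-t) = chord t := by rw [chord, chord, mul_neg, Real.cos_neg]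

lemma chord_zero : chord 0 = 0 := by simp [chord]

lemma norm_sq_circ_sub_circ (s t : ℝ) : ‖circ s - circ t‖ ^ 2 = 2 * chord (s - t) := by
  have h := re_circ_mul_conj_circ s t
  rw [← Complex.normSq_eq_norm_sq, Complex.normSq_sub, Complex.normSq_eq_norm_sq,
    Complex.normSq_eq_norm_sq, norm_circ, norm_circ, h, chord]
  ring

/-- When two adjacent arcs total at most a half circle, the angle between their chords is at least a
right angle; merging the two sides then increases the sum of squares. -/
lemma chord_add_le {x y : ℝ} (hx : 0 ≤ x) (hy : 0 ≤ y) (hxy : x + y ≤ 1 / 2) :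
    chord x + chord y ≤ chord (x + y) := by
  have hpi := Real.pi_pos
  set a := Real.pi * (x + y) with ha
  set b := Real.pi * (x - y) with hb
  have h1 : Real.cos (2 * Real.pi * x) + Real.cos (2 * Real.pi * y) =
      2 * Real.cos a * Real.cos b := by
    rw [Real.cos_add_cos, show (2 * Real.pi * x + 2 * Real.pi * y) / 2 = a by rw [ha]; ring,
      show (2 * Real.pi * x - 2 * Real.pi * y) / 2 = b by rw [hb]; ring]
  have h2 : Real.cos (2 * Real.pi * (x + y)) = 2 * Real.cos a ^ 2 - 1 := by
    rw [← Real.cos_two_mul]; congr 1; rw [ha]; ring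
  have h3 : 0 ≤ Real.cos a :=
    Real.cos_nonneg_of_mem_Icc ⟨by nlinarith [mul_nonneg hpi.le (add_nonneg hx hy)],
      by nlinarith⟩
  have h4 : Real.cos a ≤ Real.cos b := by
    rw [← Real.cos_abs b]
    refine Real.cos_le_cos_of_nonneg_of_le_pi (abs_nonneg _) (by nlinarith) ?_
    rw [hb, abs_mul, abs_of_pos hpi]
    refine mul_le_mul_of_nonneg_left ?_ hpi.le
    rw [abs_le]; constructor <;> linarith
  rw [chord, chord, chord]
  nlinarith [mul_le_mul_of_nonneg_left h4 h3]

/-- Equivalent to `|1 + e^{iX} + e^{-iY}|² ≥ 0`; the two squares passed to `nlinarith` are the real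
and imaginary parts. The maximum belongs to the equilateral triangle. -/
lemma chord_add_chord_add_chord_le {x y z : ℝ} (h : x + y + z = 1) :
    chord x + chord y + chord z ≤ 9 / 2 := by
  have e : chord z = chord (x + y) := by
    rw [show z = -(x + y) + (1 : ℤ) by push_cast; linarith, chord_add_int, chord_neg]
  rw [e, chord, chord, chord, mul_add]
  set X := 2 * Real.pi * x
  set Y := 2 * Real.pi * y
  rw [Real.cos_add]
  nlinarith [sq_nonneg (Real.cos X + 1 + Real.cos Y), sq_nonneg (Real.sin X - Real.sin Y),
    Real.sin_sq_add_cos_sq X, Real.sin_sq_add_cos_sq Y]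

lemma sum_chord_le {ψ : ℕ → ℝ} (hψ : Monotone ψ) (a m : ℕ) (h : ψ (a + m) - ψ a ≤ 1 / 2) :
    ∑ i ∈ Finset.range m, chord (ψ (a + i + 1) - ψ (a + i)) ≤ chord (ψ (a + m) - ψ a) := by
  induction m with
  | zero => simp [chord_zero]
  | succ m ih =>
    have h1 : ψ (a + m) ≤ ψ (a + (m + 1)) := hψ (by omega)
    have h2 : ψ a ≤ ψ (a + m) := hψ (by omega)
    rw [Finset.sum_range_succ]
    have h3 := ih (by linarith)
    have h4 := chord_add_le (x := ψ (a + m) - ψ a) (y := ψ (a + m + 1) - ψ (a + m))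
      (by linarith) (sub_nonneg.2 h1) (by rw [← add_assoc] at h; linarith)
    rw [← add_assoc]
    rw [show ψ (a + m) - ψ a + (ψ (a + m + 1) - ψ (a + m)) = ψ (a + m + 1) - ψ a by ring] at h4
    linarith

/-- Exactly one step crosses the half turn. The steps before it and those after it can each be
merged into one side, which leaves a triangle. -/
lemma sum_chord_le_of_monotone {ψ : ℕ → ℝ} (hψ : Monotone ψ) (h0 : ψ 0 = 0) {N : ℕ}
    (hN : ψ N = 1) : ∑ i ∈ Finset.range N, chord (ψ (i + 1) - ψ i) ≤ 9 / 2 := by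
  have hex : ∃ k, 1 / 2 < ψ k := ⟨N, by rw [hN]; norm_num⟩
  classical
  obtain ⟨k, hk⟩ : ∃ k, Nat.find hex = k + 1 := by
    refine Nat.exists_eq_succ_of_ne_zero fun h => ?_
    have := Nat.find_spec hex
    rw [h, h0] at this
    norm_num at this
  have hk1 : 1 / 2 < ψ (k + 1) := hk ▸ Nat.find_spec hex
  have hk0 : ψ k ≤ 1 / 2 := not_lt.1 (Nat.find_min hex (by omega))
  have hkN : k + 1 ≤ N := hk ▸ Nat.find_min' hex (by rw [hN]; norm_num)
  obtain ⟨m, rfl⟩ := Nat.exists_eq_add_of_le hkN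
  rw [Finset.sum_range_add, Finset.sum_range_succ]
  have h1 := sum_chord_le hψ 0 k (by rw [h0, zero_add]; linarith)
  have h2 := sum_chord_le hψ (k + 1) m (by rw [hN]; linarith)
  have h3 := chord_add_chord_add_chord_le (x := ψ k) (y := ψ (k + 1) - ψ k)
    (z := 1 - ψ (k + 1)) (by ring)
  simp only [zero_add, h0, sub_zero] at h1
  rw [hN] at h2
  linarith

/-- A finite sequence of phases starting at `0` whose cyclic order is preserved or reversed. -/
lemma sum_chord_le_of_betweenness {n : ℕ} {φ : ℕ → ℝ} (hφ0 : φ 0 = 0) (hφ : ∀ i, 0 ≤ φ i ∧ φ i < 1)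
    (hlt : ∀ j k l, 0 < j → j < k → k < l → l ≤ n → ¬ (0 < φ j ∧ φ j < φ k ∧ 0 < φ l ∧ φ l < φ k))
    (hgt : ∀ j k l, 0 < j → j < k → k < l → l ≤ n → ¬ (φ k < φ j ∧ φ k < φ l)) :
    ∑ i ∈ Finset.range n, chord (φ (i + 1) - φ i) + chord (φ n) ≤ 9 / 2 := by
  classical
  by_cases hex : ∃ i, i ≤ n ∧ 0 < φ i
  swap
  · push Not at hex
    have hz : ∀ i ≤ n, φ i = 0 := fun i hi => le_antisymm (hex i hi) (hφ i).1
    rw [hz n le_rfl, chord_zero, add_zero, Finset.sum_eq_zero]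
    · norm_num
    · intro i hi
      have := Finset.mem_range.1 hi
      rw [hz i (by omega), hz (i + 1) (by omega), sub_zero, chord_zero]
  set p := Nat.find hex with hp
  obtain ⟨hpn, hp0⟩ := Nat.find_spec hex
  rw [← hp] at hpn hp0
  have hpmin : ∀ i < p, φ i = 0 := fun i hi =>
    le_antisymm (not_lt.1 fun h => Nat.find_min hex hi ⟨by omega, h⟩) (hφ i).1
  set q := Nat.findGreatest (fun i => 0 < φ i) n with hq
  have hq0 : 0 < φ q := Nat.findGreatest_spec (P := fun i => 0 < φ i) hpn hp0
  have hqn : q ≤ n := Nat.findGreatest_le n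
  have hpq : p ≤ q := Nat.le_findGreatest hpn hp0
  have hqmax : ∀ i, q < i → i ≤ n → φ i = 0 := fun i h1 h2 =>
    le_antisymm (not_lt.1 (Nat.findGreatest_is_greatest (P := fun i => 0 < φ i) h1 h2)) (hφ i).1
  have hp1 : 0 < p := by
    rcases Nat.eq_zero_or_pos p with h | h
    · rw [h, hφ0] at hp0; exact absurd hp0 (lt_irrefl _)
    · exact h
  -- positivity and monotonicity between `p` and `q`
  have hpos : ∀ k, p ≤ k → k ≤ q → 0 < φ k := by
    intro k h1 h2
    rcases h1.eq_or_lt with rfl | h1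
    · exact hp0
    rcases h2.eq_or_lt with rfl | h2
    · exact hq0
    refine lt_of_le_of_ne (hφ k).1 fun h => hgt p k q hp1 h1 h2 hqn ?_
    rw [← h]; exact ⟨hp0, hq0⟩
  -- `s` records the orientation. Outside `[p, q]` the phases vanish, hence are integers, so `χ`
  -- extends by `0` on the left and `1` on the right to a monotone lift `ψ` of the whole polygon;
  -- the index `n + 1` closes it up.
  suffices H : ∃ (s : ℝ) (χ : ℕ → ℝ), (s = 1 ∨ s = -1) ∧
      (∀ i, p ≤ i → i ≤ q → 0 ≤ χ i ∧ χ i ≤ 1 ∧ ∃ m : ℤ, χ i = s * φ i + m) ∧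
      ∀ i j, p ≤ i → i ≤ j → j ≤ q → χ i ≤ χ j by
    obtain ⟨s, χ, hs, hχ, hmono⟩ := H
    set ψ : ℕ → ℝ := fun i => if i < p then 0 else if i ≤ q then χ i else 1 with hψdef
    have hψmono : Monotone ψ := by
      intro i j hij
      simp only [hψdef]
      split_ifs with h1 h2 h3 h4 h5 h6 h7 h8
      all_goals first
        | exact le_rfl
        | omega
        | exact (hχ _ (by omega) (by omega)).1
        | exact (hχ _ (by omega) (by omega)).2.1
        | exact hmono _ _ (by omega) (by omega) (by omega)
        | norm_num
    have hψint : ∀ i ≤ n, ∃ m : ℤ, ψ i = s * φ i + m := by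
      intro i hi
      simp only [hψdef]
      split_ifs with h1 h2
      · exact ⟨0, by rw [hpmin i h1]; simp⟩
      · exact (hχ i (by omega) h2).2.2
      · exact ⟨1, by rw [hqmax i (by omega) hi]; simp⟩
    have hψ1 : ψ (n + 1) = 1 := by
      simp only [hψdef]
      rw [if_neg (by omega), if_neg (by omega)]
    have hchord : ∀ t : ℝ, chord (s * t) = chord t := by
      intro t
      rcases hs with rfl | rfl
      · rw [one_mul]
      · rw [neg_one_mul, chord_neg]
    have hmain := sum_chord_le_of_monotone hψmono (by simp only [hψdef]; rw [if_pos hp1]) hψ1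
    rw [Finset.sum_range_succ] at hmain
    refine le_of_eq_of_le ?_ hmain
    congr 1
    · refine Finset.sum_congr rfl fun i hi => ?_
      have hi' := Finset.mem_range.1 hi
      obtain ⟨m, hm⟩ := hψint i (by omega)
      obtain ⟨m', hm'⟩ := hψint (i + 1) (by omega)
      rw [hm, hm', show s * φ (i + 1) + (m' : ℝ) - (s * φ i + m) =
        s * (φ (i + 1) - φ i) + ((m' - m : ℤ) : ℝ) by push_cast; ring, chord_add_int, hchord]
    · obtain ⟨m, hm⟩ := hψint n le_rfl
      rw [hψ1, hm, show (1 : ℝ) - (s * φ n + m) = -(s * φ n) + ((1 - m : ℤ) : ℝ) by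
        push_cast; ring, chord_add_int, chord_neg, hchord]
  -- Phases at intermediate indices are neither above nor below both end phases, so comparing `φ p`
  -- with `φ q` decides the orientation.
  have hbet1 : ∀ k, p < k → k < q → ¬ (φ p < φ k ∧ φ q < φ k) := fun k h1 h2 h =>
    hlt p k q hp1 h1 h2 hqn ⟨hp0, h.1, hq0, h.2⟩
  have hbet2 : ∀ k, p < k → k < q → ¬ (φ k < φ p ∧ φ k < φ q) := fun k h1 h2 h =>
    hgt p k q hp1 h1 h2 hqn h
  rcases le_total (φ p) (φ q) with hle | hle
  · refine ⟨1, φ, Or.inl rfl, fun i h1 h2 => ⟨(hφ i).1, (hφ i).2.le, 0, by simp⟩, ?_⟩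
    intro i j h1 h2 h3
    by_contra hlt'
    push Not at hlt'
    rcases h2.eq_or_lt with rfl | h2
    · exact lt_irrefl _ hlt'
    have a1 : p < i → φ i ≤ φ q := fun h => not_lt.1 fun h' =>
      hbet1 i h (by omega) ⟨by linarith, h'⟩
    have a2 : j < q → φ p ≤ φ j := fun h => not_lt.1 fun h' =>
      hbet2 j (by omega) h ⟨h', by linarith⟩
    rcases h1.eq_or_lt with rfl | h1
    · rcases h3.eq_or_lt with rfl | h3
      · linarith
      · linarith [a2 h3]
    · rcases h3.eq_or_lt with rfl | h3
      · linarith [a1 h1]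
      · refine hgt i j q (by omega) h2 h3 hqn ⟨hlt', by linarith [a1 h1]⟩
  · refine ⟨-1, fun i => 1 - φ i, Or.inr rfl, fun i h1 h2 =>
      ⟨by linarith [(hφ i).2], by linarith [(hφ i).1], 1, by push_cast; ring⟩, ?_⟩
    intro i j h1 h2 h3
    by_contra hlt'
    push Not at hlt'
    replace hlt' : φ i < φ j := by linarith
    rcases h2.eq_or_lt with rfl | h2
    · exact lt_irrefl _ hlt'
    have a1 : p < i → φ q ≤ φ i := fun h => not_lt.1 fun h' =>
      hbet2 i h (by omega) ⟨by linarith, h'⟩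
    have a2 : j < q → φ j ≤ φ p := fun h => not_lt.1 fun h' =>
      hbet1 j (by omega) h ⟨h', by linarith⟩
    rcases h1.eq_or_lt with rfl | h1
    · rcases h3.eq_or_lt with rfl | h3
      · linarith
      · linarith [a2 h3]
    · rcases h3.eq_or_lt with rfl | h3
      · linarith [a1 h1]
      · exact hlt i j q (by omega) h2 h3 hqn ⟨hpos i h1.le (by omega), hlt', hq0,
          by linarith [a1 h1]⟩

end CyclicSums

/-! ### The polygon inequality for radial limits. -/

section CyclicRadialLimits

variable {u v : ℂ → ℂ}

/-- The radial limits of a homeomorphism of the disk at cyclically ordered points form a polygon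
inscribed in the circle whose sides have sum of squares at most `9`. -/
theorem sum_norm_sq_radial_limits_le (hu : ContinuousOn u unitDisk)
    (hmaps : MapsTo u unitDisk unitDisk) (hv : ContinuousOn v unitDisk)
    (hvmaps : MapsTo v unitDisk unitDisk) (huv : ∀ w ∈ unitDisk, u (v w) = w)
    (hvu : ∀ z ∈ unitDisk, v (u z) = z) {n : ℕ} {x : ℕ → ℝ}
    (hx : ∀ i j, i < j → j ≤ n → x i < x j) (hxn : x n < x 0 + 1) {g : ℕ → ℂ}
    (hlim : ∀ i ≤ n, Tendsto (fun r : ℝ => u (r * circ (x i))) (𝓝[<] 1) (𝓝 (g i))) :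
    ∑ i ∈ Finset.range n, ‖g (i + 1) - g i‖ ^ 2 + ‖g n - g 0‖ ^ 2 ≤ 9 := by
  have hnorm : ∀ i ≤ n, ‖g i‖ = 1 := fun i hi =>
    norm_eq_one_of_radial_limit hmaps hv hvmaps hvu (hlim i hi)
  obtain ⟨c, hc⟩ : ∃ c, g 0 = circ c := by
    have := exists_eq_norm_mul_circ (g 0) 0
    rw [hnorm 0 (Nat.zero_le _), Complex.ofReal_one, one_mul] at this
    exact ⟨_, this⟩
  have hex : ∀ i, ∃ t : ℝ, (0 ≤ t ∧ t < 1) ∧ (i ≤ n → g i = circ (c + t)) := by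
    intro i
    by_cases hi : i ≤ n
    · have := exists_eq_norm_mul_circ (g i) c
      rw [hnorm i hi, Complex.ofReal_one, one_mul] at this
      set s := Complex.arg (g i / circ c) / (2 * Real.pi)
      refine ⟨Int.fract s, ⟨Int.fract_nonneg s, Int.fract_lt_one s⟩, fun _ => ?_⟩
      rw [this, circ_eq_iff]
      exact ⟨⌊s⌋, by linarith [Int.fract_add_floor s]⟩
    · exact ⟨0, ⟨le_rfl, one_pos⟩, fun h => absurd h hi⟩
  choose φ hφ hgφ using hex
  have hφ0 : φ 0 = 0 := by
    have h1 := hgφ 0 (Nat.zero_le _)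
    rw [hc, circ_eq_iff] at h1
    obtain ⟨m, hm⟩ := h1
    have h2 : φ 0 = ((-m : ℤ) : ℝ) := by push_cast; linarith
    have h3 := hφ 0
    rw [h2] at h3
    have h4 : 0 ≤ -m := by exact_mod_cast h3.1
    have h5 : -m < 1 := by exact_mod_cast h3.2
    rw [h2, show -m = 0 by omega, Int.cast_zero]
  have hne : ∀ (s t : ℝ), 0 ≤ s → s < 1 → 0 ≤ t → t < 1 → s ≠ t → circ (c + s) ≠ circ (c + t) := by
    intro s t hs0 hs1 ht0 ht1 hst h
    rw [circ_eq_iff] at h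
    obtain ⟨m, hm⟩ := h
    have h1 : (m : ℝ) < 1 := by linarith
    have h2 : (-1 : ℝ) < m := by linarith
    have h3 : m < 1 := by exact_mod_cast h1
    have h4 : -1 < m := by exact_mod_cast h2
    have h5 : m = 0 := by omega
    rw [h5, Int.cast_zero] at hm
    exact hst (by linarith)
  -- The phases are measured from `g 0`. The open intervals `(0, φ k)` and `(φ k, 1)` are the two
  -- arcs cut out by `g 0` and `g k`, and non-interleaving of the rays `0, j, k, l` says that
  -- neither arc contains both `g j` and `g l`.
  have hinter : ∀ j k l, 0 < j → j < k → k < l → l ≤ n → ∀ a b : ℝ, 0 ≤ a → b ≤ 1 →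
      (∀ t, a < t → t < b → t ≠ φ k ∧ 0 < t) → ¬ ((a < φ j ∧ φ j < b) ∧ (a < φ l ∧ φ l < b)) := by
    intro j k l hj hjk hkl hl a b ha hb hab ⟨⟨h1, h2⟩, h3, h4⟩
    have hl₂ := hlim j (by omega)
    have hl₄ := hlim l (by omega)
    rw [hgφ j (by omega)] at hl₂
    rw [hgφ l (by omega)] at hl₄
    refine radial_limits_not_interleaved hu hmaps hv hvmaps huv hvu (hx 0 j hj (by omega))
      (hx j k hjk (by omega)) (hx k l hkl hl) ?_ (hlim 0 (by omega)) hl₂ (hlim k (by omega)) hl₄ ?_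
    · rcases hl.eq_or_lt with rfl | hl
      · exact hxn
      · exact (hx l n hl le_rfl).trans hxn
    · intro t ht
      rw [mem_uIcc] at ht
      have ht1 : a < t - c := by rcases ht with ht | ht <;> linarith
      have ht2 : t - c < b := by rcases ht with ht | ht <;> linarith
      obtain ⟨h5, h6⟩ := hab _ ht1 ht2
      rw [show t = c + (t - c) by ring, hgφ k (by omega)]
      refine ⟨?_, hne _ _ h6.le (by linarith) (hφ k).1 (hφ k).2 h5⟩
      have := hne (t - c) 0 h6.le (by linarith) le_rfl one_pos h6.ne'
      rwa [add_zero, ← hc] at this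
  have hmain := sum_chord_le_of_betweenness (n := n) hφ0 hφ
    (fun j k l hj hjk hkl hl h => hinter j k l hj hjk hkl hl 0 (φ k) le_rfl (hφ k).2.le
      (fun t h1 h2 => ⟨h2.ne, h1⟩) ⟨⟨h.1, h.2.1⟩, h.2.2⟩)
    (fun j k l hj hjk hkl hl h => hinter j k l hj hjk hkl hl (φ k) 1 (hφ k).1 le_rfl
      (fun t h1 h2 => ⟨h1.ne', (hφ k).1.trans_lt h1⟩) ⟨⟨h.1, (hφ j).2⟩, h.2, (hφ l).2⟩)
  have e1 : ∀ i ∈ Finset.range n, ‖g (i + 1) - g i‖ ^ 2 = 2 * chord (φ (i + 1) - φ i) := by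
    intro i hi
    have hi' := Finset.mem_range.1 hi
    rw [hgφ i (by omega), hgφ (i + 1) (by omega), norm_sq_circ_sub_circ]
    congr 2; ring
  have e2 : ‖g n - g 0‖ ^ 2 = 2 * chord (φ n) := by
    rw [hgφ n le_rfl, hc, norm_sq_circ_sub_circ]
    congr 2; ring
  rw [Finset.sum_congr rfl e1, e2, ← Finset.mul_sum]
  linarith

end CyclicRadialLimits

/-! ### The extremal problem for cosine series. -/

section CosineInequality

/-- The test function of the Heinz inequality. -/
noncomputable def heinzWeight (y : ℝ) : ℝ := Real.sin (2 * Real.pi * y + Real.pi / 3)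

lemma continuous_heinzWeight : Continuous heinzWeight := by unfold heinzWeight; fun_prop

lemma heinzWeight_le_one (y : ℝ) : heinzWeight y ≤ 1 := Real.sin_le_one _

lemma heinzWeight_nonneg {y : ℝ} (h0 : 0 ≤ y) (h1 : y ≤ 1 / 3) : 0 ≤ heinzWeight y := by
  have := Real.pi_pos
  exact Real.sin_nonneg_of_nonneg_of_le_pi (by positivity) (by nlinarith)

lemma half_le_heinzWeight {y : ℝ} (h0 : 0 ≤ y) (h1 : y ≤ 1 / 4) : 1 / 2 ≤ heinzWeight y := by
  have hpi := Real.pi_pos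
  have h2 : heinzWeight y = Real.cos |2 * Real.pi * y + Real.pi / 3 - Real.pi / 2| := by
    rw [Real.cos_abs, Real.cos_sub_pi_div_two, heinzWeight]
  rw [h2, ← Real.cos_pi_div_three]
  refine Real.cos_le_cos_of_nonneg_of_le_pi (abs_nonneg _) (by linarith) ?_
  rw [abs_le]
  constructor <;> nlinarith

lemma hasDerivAt_affine_angle (a b y : ℝ) : HasDerivAt (fun y => a * y + b) a y := by
  simpa using ((hasDerivAt_id y).const_mul a).add_const b

lemma integral_heinzWeight : ∫ y in (0:ℝ)..(1 / 3), heinzWeight y = 3 / (4 * Real.pi) := by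
  have hd : ∀ y ∈ uIcc (0 : ℝ) (1 / 3), HasDerivAt
      (fun y => -Real.cos (2 * Real.pi * y + Real.pi / 3) / (2 * Real.pi)) (heinzWeight y) y := by
    intro y _
    have h := (((hasDerivAt_affine_angle (2 * Real.pi) (Real.pi / 3) y).cos).neg).div_const
      (2 * Real.pi)
    refine h.congr_deriv ?_
    simp only [heinzWeight]; field_simp
  rw [intervalIntegral.integral_eq_sub_of_hasDerivAt hd
    (continuous_heinzWeight.intervalIntegrable _ _)]
  rw [show 2 * Real.pi * (1 / 3) + Real.pi / 3 = Real.pi by ring, mul_zero, zero_add,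
    Real.cos_pi, Real.cos_pi_div_three]
  field_simp
  norm_num

lemma integral_affine_mul_heinzWeight :
    ∫ y in (0:ℝ)..(1 / 3), (1 - 9 / 2 * y) * heinzWeight y = 9 * √3 / (16 * Real.pi ^ 2) := by
  have hd : ∀ y ∈ uIcc (0 : ℝ) (1 / 3), HasDerivAt
      (fun y => -((1 - 9 / 2 * y) * Real.cos (2 * Real.pi * y + Real.pi / 3)) / (2 * Real.pi) -
        9 / 2 * Real.sin (2 * Real.pi * y + Real.pi / 3) / (4 * Real.pi ^ 2))
      ((1 - 9 / 2 * y) * heinzWeight y) y := by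
    intro y _
    have h0 := hasDerivAt_affine_angle (2 * Real.pi) (Real.pi / 3) y
    have h1 : HasDerivAt (fun y : ℝ => 1 - 9 / 2 * y) (-(9 / 2)) y := by
      simpa using ((hasDerivAt_id y).const_mul (9 / 2 : ℝ)).const_sub 1
    have h := ((h1.mul h0.cos).neg.div_const (2 * Real.pi)).sub
      ((h0.sin.const_mul (9 / 2 : ℝ)).div_const (4 * Real.pi ^ 2))
    refine h.congr_deriv ?_
    simp only [heinzWeight]; field_simp; ring
  rw [intervalIntegral.integral_eq_sub_of_hasDerivAt hd
    (Continuous.intervalIntegrable (by have := continuous_heinzWeight; fun_prop) _ _)]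
  rw [show 2 * Real.pi * (1 / 3) + Real.pi / 3 = Real.pi by ring,
    show 2 * Real.pi * 0 + Real.pi / 3 = Real.pi / 3 by ring, Real.cos_pi, Real.sin_pi, Real.cos_pi_div_three, Real.sin_pi_div_three]
  field_simp
  ring

lemma integral_cos_mul_heinzWeight :
    ∫ y in (0:ℝ)..(1 / 3), Real.cos (2 * Real.pi * y) * heinzWeight y = √3 / 12 := by
  have hd : ∀ y ∈ uIcc (0 : ℝ) (1 / 3), HasDerivAt
      (fun y => √3 / 4 * y - Real.cos (4 * Real.pi * y + Real.pi / 3) / (8 * Real.pi))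
      (Real.cos (2 * Real.pi * y) * heinzWeight y) y := by
    intro y _
    have h0 := hasDerivAt_affine_angle (4 * Real.pi) (Real.pi / 3) y
    have h1 : HasDerivAt (fun y : ℝ => √3 / 4 * y) (√3 / 4) y := by
      simpa using (hasDerivAt_id y).const_mul (√3 / 4 : ℝ)
    have h := h1.sub (h0.cos.div_const (8 * Real.pi))
    refine h.congr_deriv ?_
    have e : 4 * Real.pi * y + Real.pi / 3 = 2 * Real.pi * y + (2 * Real.pi * y + Real.pi / 3) := by
      ring
    have e2 : √3 / 2 = Real.sin ((2 * Real.pi * y + Real.pi / 3) - 2 * Real.pi * y) := by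
      rw [add_sub_cancel_left, Real.sin_pi_div_three]
    have e3 := Real.sin_add (2 * Real.pi * y) (2 * Real.pi * y + Real.pi / 3)
    have e4 := Real.sin_sub (2 * Real.pi * y + Real.pi / 3) (2 * Real.pi * y)
    rw [show heinzWeight y = Real.sin (2 * Real.pi * y + Real.pi / 3) from rfl, e, e3, show √3 / 4 = (√3 / 2) / 2 by ring, e2, e4]
    field_simp
    ring
  rw [intervalIntegral.integral_eq_sub_of_hasDerivAt hd
    (Continuous.intervalIntegrable (by have := continuous_heinzWeight; fun_prop) _ _)]
  rw [show 4 * Real.pi * (1 / 3) + Real.pi / 3 = -(Real.pi / 3) + 2 * Real.pi by ring,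
    Real.cos_add_two_pi, Real.cos_neg]
  simp
  ring

/-- The triple angle formula gives `(c - 1)(2c + 1)² = 0`: the cosine is `1` or `-1/2`. -/
lemma neg_half_le_cos_two_pi_div_three_mul (n : ℤ) :
    -(1 / 2) ≤ Real.cos (2 * Real.pi * n * (1 / 3)) := by
  have h := Real.cos_three_mul (2 * Real.pi * n * (1 / 3))
  rw [show 3 * (2 * Real.pi * n * (1 / 3)) = n * (2 * Real.pi) by ring,
    Real.cos_int_mul_two_pi] at h
  set c := Real.cos (2 * Real.pi * n * (1 / 3))
  have h2 : (c - 1) * (2 * c + 1) ^ 2 = 0 := by nlinarith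
  rcases mul_eq_zero.1 h2 with h3 | h3
  · linarith
  · have := pow_eq_zero_iff (two_ne_zero) |>.1 h3
    linarith

/-- The integral is a positive multiple of `-(2 cos(2πn/3) + 1)`. It vanishes unless 3 divides `n`,
and the three-valued step function has frequencies only in `1 + 3ℤ`; so nothing is lost in the
extremal case. -/
lemma integral_cos_int_mul_heinzWeight_nonpos {n : ℤ} (hn : 2 ≤ |n|) :
    ∫ y in (0:ℝ)..(1 / 3), Real.cos (2 * Real.pi * n * y) * heinzWeight y ≤ 0 := by
  have hn2 : (1 : ℝ) < (n : ℝ) ^ 2 := by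
    have h1 : (2 : ℝ) ≤ |(n : ℝ)| := by exact_mod_cast hn
    have := sq_abs (n : ℝ)
    nlinarith
  have hK : 0 < 4 * Real.pi ^ 2 * ((n : ℝ) ^ 2 - 1) := by
    have := Real.pi_pos
    have := sub_pos.2 hn2
    positivity
  have hd : ∀ y ∈ uIcc (0 : ℝ) (1 / 3), HasDerivAt
      (fun y => (2 * Real.pi * Real.cos (2 * Real.pi * y + Real.pi / 3) *
          Real.cos (2 * Real.pi * n * y + 0) + Real.sin (2 * Real.pi * y + Real.pi / 3) *
          (2 * Real.pi * n * Real.sin (2 * Real.pi * n * y + 0))) /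
          (4 * Real.pi ^ 2 * ((n : ℝ) ^ 2 - 1)))
      (Real.cos (2 * Real.pi * n * y) * heinzWeight y) y := by
    intro y _
    have h0 := hasDerivAt_affine_angle (2 * Real.pi) (Real.pi / 3) y
    have h1 := hasDerivAt_affine_angle (2 * Real.pi * n) 0 y
    have h := (((h0.cos.const_mul (2 * Real.pi)).mul h1.cos).add (h0.sin.mul
      (h1.sin.const_mul (2 * Real.pi * n)))).div_const (4 * Real.pi ^ 2 * ((n : ℝ) ^ 2 - 1))
    refine h.congr_deriv ?_
    rw [show heinzWeight y = Real.sin (2 * Real.pi * y + Real.pi / 3) from rfl, div_eq_iff hK.ne',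
      add_zero]
    ring
  rw [intervalIntegral.integral_eq_sub_of_hasDerivAt hd
    (Continuous.intervalIntegrable (by have := continuous_heinzWeight; fun_prop) _ _)]
  rw [← sub_div]
  refine div_nonpos_of_nonpos_of_nonneg ?_ hK.le
  rw [show 2 * Real.pi * (1 / 3) + Real.pi / 3 = Real.pi by ring]
  simp only [mul_zero, zero_add, add_zero, Real.cos_pi, Real.sin_pi, Real.cos_pi_div_three,
    Real.cos_zero, Real.sin_zero]
  have := neg_half_le_cos_two_pi_div_three_mul n
  nlinarith [Real.pi_pos]

/-- The weights obtained from `heinzWeight` by successively eliminating the values of a function on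
`[1/(m+1), 1/m]`, where `m = j + 3`. -/
noncomputable def cascadeWeight : ℕ → ℝ → ℝ
  | 0, y => heinzWeight y
  | j + 1, y => cascadeWeight j y - cascadeWeight j ((1 - y) / (j + 3)) / (j + 3) ^ 2

lemma continuous_cascadeWeight (j : ℕ) : Continuous (cascadeWeight j) := by
  induction j with
  | zero => exact continuous_heinzWeight
  | succ j ih =>
    change Continuous fun y => cascadeWeight j y - cascadeWeight j ((1 - y) / (j + 3)) / (j + 3) ^ 2
    fun_prop

/-- Each elimination subtracts at most `1/(j+3)² ≤ 1/(j+2) - 1/(j+3)`, so the total loss telescopes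
to less than `1/2`. After the first step only `y ≤ 1/4` matters, where the original weight is at
least `1/2`, and the weights stay nonnegative. -/
lemma cascadeWeight_bounds (j : ℕ) : ∀ y : ℝ, 0 ≤ y → y ≤ 1 / (j + 3) →
    heinzWeight y - (1 / 2 - 1 / (j + 2)) ≤ cascadeWeight j y ∧ cascadeWeight j y ≤ heinzWeight y ∧
      0 ≤ cascadeWeight j y := by
  induction j with
  | zero =>
    intro y h0 h1
    norm_num at h1
    refine ⟨?_, le_rfl, heinzWeight_nonneg h0 h1⟩
    norm_num [cascadeWeight]
  | succ j ih =>
    intro y h0 h1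
    have hj : (0 : ℝ) ≤ j := Nat.cast_nonneg j
    push_cast at h1 ⊢
    have h1' : y ≤ 1 / (j + 3) := h1.trans (one_div_le_one_div_of_le (by linarith) (by linarith))
    have hy1 : y ≤ 1 := h1.trans (by rw [div_le_one (by linarith)]; linarith)
    obtain ⟨a1, a2, a3⟩ := ih y h0 h1'
    obtain ⟨b1, b2, b3⟩ := ih ((1 - y) / (j + 3)) (div_nonneg (by linarith) (by linarith))
      (div_le_div_of_nonneg_right (by linarith) (by linarith))
    have hb := b2.trans (heinzWeight_le_one _)
    have hsq : (0 : ℝ) < (j + 3) ^ 2 := by positivity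
    have c1 : cascadeWeight j ((1 - y) / (j + 3)) / (j + 3) ^ 2 ≤ 1 / (j + 3) ^ 2 :=
      div_le_div_of_nonneg_right hb hsq.le
    have c2 : 0 ≤ cascadeWeight j ((1 - y) / (j + 3)) / (j + 3) ^ 2 := div_nonneg b3 hsq.le
    have c3 : (1 : ℝ) / (j + 3) ^ 2 ≤ 1 / (j + 2) - 1 / (j + 1 + 2) := by
      rw [div_sub_div _ _ (by positivity) (by positivity), div_le_div_iff₀ hsq (by positivity)]
      nlinarith
    have c4 : heinzWeight y - (1 / 2 - 1 / (j + 1 + 2)) ≤ cascadeWeight (j + 1) y := by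
      rw [cascadeWeight]; linarith
    have h4 : y ≤ 1 / 4 := h1.trans (one_div_le_one_div_of_le (by norm_num) (by linarith))
    refine ⟨c4, by rw [cascadeWeight]; linarith, ?_⟩
    have := half_le_heinzWeight h0 h4
    have : (0 : ℝ) ≤ 1 / (j + 1 + 2) := by positivity
    linarith

/-- On `[1/(m+1), 1/m]` the hypothesis bounds `D y` by `-D (1 - m y) / m`. The substitution `r = 1 -
m y` carries this interval onto `[0, 1/(m+1)]` with Jacobian `1/m`, whence the factor `1/m²` in the
recursion. -/
lemma integral_mul_cascadeWeight_le {D : ℝ → ℝ} (hD : Continuous D)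
    (h : ∀ m : ℕ, 3 ≤ m → ∀ t : ℝ, 1 / ((m : ℝ) + 1) < t → t < 1 / m →
      m * D t + D (1 - m * t) ≤ 0) (j : ℕ) :
    ∫ y in (0:ℝ)..(1 / (j + 3)), D y * cascadeWeight j y ≤
      ∫ y in (0:ℝ)..(1 / ((j + 1 : ℕ) + 3)), D y * cascadeWeight (j + 1) y := by
  have hj : (0 : ℝ) ≤ j := Nat.cast_nonneg j
  set m : ℝ := (j : ℝ) + 3 with hm
  have hm0 : 0 < m := by positivity
  have em : (((j + 1 : ℕ) : ℝ) + 3) = m + 1 := by push_cast; ring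
  rw [em]
  have hcw := continuous_cascadeWeight j
  have hint : ∀ a b : ℝ, IntervalIntegrable (fun y => D y * cascadeWeight j y)
      MeasureTheory.volume a b := fun a b => (hD.mul hcw).intervalIntegrable a b
  rw [← intervalIntegral.integral_add_adjacent_intervals (hint 0 (1 / (m + 1)))
    (hint (1 / (m + 1)) (1 / m))]
  have h1 : ∫ y in (1 / (m + 1))..(1 / m), D y * cascadeWeight j y ≤
      ∫ y in (1 / (m + 1))..(1 / m), -(1 / m) * (D (1 - m * y) * cascadeWeight j y) := by
    refine intervalIntegral.integral_mono_on_of_le_Ioo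
      (one_div_le_one_div_of_le hm0 (by linarith)) (hint _ _)
      (Continuous.intervalIntegrable (by fun_prop) _ _) ?_
    intro y hy
    have hy0 : 0 < y := lt_trans (by positivity) hy.1
    have hc := (cascadeWeight_bounds j y hy0.le hy.2.le).2.2
    have := h (j + 3) (by omega) y (by push_cast; exact hy.1) (by push_cast; exact hy.2)
    push_cast at this
    rw [← hm] at this
    have h2 : D y ≤ -(1 / m) * D (1 - m * y) := by
      rw [neg_mul, one_div_mul_eq_div, le_neg, div_le_iff₀ hm0]
      linarith
    nlinarith
  have h2 : ∫ y in (1 / (m + 1))..(1 / m), -(1 / m) * (D (1 - m * y) * cascadeWeight j y) =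
      -∫ r in (0:ℝ)..(1 / (m + 1)), D r * cascadeWeight j ((1 - r) / m) / m ^ 2 := by
    have := intervalIntegral.integral_comp_sub_mul
      (f := fun r => D r * cascadeWeight j ((1 - r) / m)) (a := 1 / (m + 1)) (b := 1 / m) hm0.ne' 1
    rw [show 1 - m * (1 / m) = 0 by field_simp; ring,
      show 1 - m * (1 / (m + 1)) = 1 / (m + 1) by field_simp; ring] at this
    rw [intervalIntegral.integral_const_mul, intervalIntegral.integral_div]
    have e : ∀ y, D (1 - m * y) * cascadeWeight j ((1 - (1 - m * y)) / m) =
        D (1 - m * y) * cascadeWeight j y := by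
      intro y
      rw [show (1 - (1 - m * y)) / m = y by field_simp; ring]
    simp only [e] at this
    rw [this, smul_eq_mul]
    field_simp
  have h3 : ∫ y in (0:ℝ)..(1 / (m + 1)), D y * cascadeWeight (j + 1) y =
      (∫ y in (0:ℝ)..(1 / (m + 1)), D y * cascadeWeight j y) -
      ∫ r in (0:ℝ)..(1 / (m + 1)), D r * cascadeWeight j ((1 - r) / m) / m ^ 2 := by
    rw [← intervalIntegral.integral_sub (hint _ _)
      (Continuous.intervalIntegrable (by fun_prop) _ _)]
    refine intervalIntegral.integral_congr fun y _ => ?_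
    simp only [cascadeWeight]
    ring
  linarith

/-- The elimination pushes the integral onto the shrinking intervals `[0, 1/(j+3)]`, where the
integrands are uniformly bounded. -/
lemma integral_mul_heinzWeight_nonpos {D : ℝ → ℝ} (hD : Continuous D)
    (h : ∀ m : ℕ, 3 ≤ m → ∀ t : ℝ, 1 / ((m : ℝ) + 1) < t → t < 1 / m →
      m * D t + D (1 - m * t) ≤ 0) :
    ∫ y in (0:ℝ)..(1 / 3), D y * heinzWeight y ≤ 0 := by
  have hle : ∀ j : ℕ, ∫ y in (0:ℝ)..(1 / 3), D y * heinzWeight y ≤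
      ∫ y in (0:ℝ)..(1 / (j + 3)), D y * cascadeWeight j y := by
    intro j
    induction j with
    | zero => simp [cascadeWeight]
    | succ j ih => exact ih.trans (integral_mul_cascadeWeight_le hD h j)
  obtain ⟨C, hC⟩ := isCompact_Icc.exists_bound_of_continuousOn (s := Icc (0 : ℝ) 1) hD.continuousOn
  have hbound : ∀ j : ℕ, ∫ y in (0:ℝ)..(1 / 3), D y * heinzWeight y ≤ C * (1 / ((j : ℝ) + 3)) := by
    intro j
    refine (hle j).trans ((le_abs_self _).trans ?_)
    have hj : (0 : ℝ) ≤ j := Nat.cast_nonneg j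
    have hpos : (0 : ℝ) < 1 / (j + 3) := by positivity
    have h1 : 1 / ((j : ℝ) + 3) ≤ 1 := by rw [div_le_one (by linarith)]; linarith
    have := intervalIntegral.norm_integral_le_of_norm_le_const (a := 0) (b := 1 / ((j : ℝ) + 3))
      (f := fun y => D y * cascadeWeight j y) (C := C) ?_
    · rwa [sub_zero, abs_of_pos hpos, Real.norm_eq_abs] at this
    · intro y hy
      rw [uIoc_of_le hpos.le] at hy
      obtain ⟨-, h2, h3⟩ := cascadeWeight_bounds j y hy.1.le hy.2
      rw [norm_mul, Real.norm_of_nonneg h3]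
      have h4 := hC y ⟨hy.1.le, hy.2.trans h1⟩
      have := h2.trans (heinzWeight_le_one y)
      nlinarith [norm_nonneg (D y)]
  have hlim : Tendsto (fun j : ℕ => C * (1 / ((j : ℝ) + 3))) atTop (𝓝 (C * 0)) := by
    refine Tendsto.const_mul _ ?_
    simp only [one_div]
    exact tendsto_inv_atTop_zero.comp
      (tendsto_atTop_add_const_right _ _ tendsto_natCast_atTop_atTop)
  rw [mul_zero] at hlim
  exact ge_of_tendsto' hlim hbound

/-- A cosine series `1 - ∑ pₙ cos 2πny` with nonnegative coefficients satisfying the polygon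
inequality has large low order coefficients. -/
theorem heinz_cosine_inequality {p : ℤ → ℝ} (hp : ∀ n, 0 ≤ p n) (hsum : Summable p)
    {G : ℝ → ℝ} (hG : ∀ y, HasSum (fun n : ℤ => p n * Real.cos (2 * Real.pi * n * y)) (1 - G y))
    (h : ∀ m : ℕ, 3 ≤ m → ∀ t : ℝ, 1 / ((m : ℝ) + 1) < t → t < 1 / m →
      m * G t + G (1 - m * t) ≤ 9 / 2) :
    27 / (4 * Real.pi ^ 2) ≤ p 1 + 3 * √3 / Real.pi * p 0 + p (-1) := by
  have hbd : ∀ (n : ℤ) (y : ℝ), ‖p n * Real.cos (2 * Real.pi * n * y)‖ ≤ p n := by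
    intro n y
    rw [norm_mul, Real.norm_of_nonneg (hp n)]
    exact mul_le_of_le_one_right (hp n) (Real.abs_cos_le_one _)
  have hGeq : G = fun y => 1 - ∑' n : ℤ, p n * Real.cos (2 * Real.pi * n * y) := by
    ext y; rw [(hG y).tsum_eq]; ring
  have hGc : Continuous G := by
    rw [hGeq]
    exact continuous_const.sub (continuous_tsum (fun n => by fun_prop) hsum hbd)
  have hcw := continuous_heinzWeight
  -- The linear function `9y/2` turns every polygon inequality into an equality, because `m t + (1 -
  -- m t) = 1`; it is the `G` of the three-valued step function on `[0, 1/3]`.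
  have h1 := integral_mul_heinzWeight_nonpos (D := fun y => G y - 9 / 2 * y) (by fun_prop)
    (fun m hm t ht1 ht2 => by have := h m hm t ht1 ht2; linarith)
  have h2 : ∫ y in (0:ℝ)..(1 / 3), (G y - 9 / 2 * y) * heinzWeight y =
      (∫ y in (0:ℝ)..(1 / 3), (1 - 9 / 2 * y) * heinzWeight y) -
      ∫ y in (0:ℝ)..(1 / 3), (1 - G y) * heinzWeight y := by
    rw [← intervalIntegral.integral_sub (Continuous.intervalIntegrable (by fun_prop) _ _)
      (Continuous.intervalIntegrable (by fun_prop) _ _)]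
    exact intervalIntegral.integral_congr fun y _ => by ring
  have h3 : HasSum (fun n : ℤ => ∫ y in (0:ℝ)..(1 / 3),
      (p n * Real.cos (2 * Real.pi * n * y)) * heinzWeight y)
      (∫ y in (0:ℝ)..(1 / 3), (1 - G y) * heinzWeight y) := by
    refine intervalIntegral.hasSum_integral_of_dominated_convergence (fun n _ => p n)
      (fun n => Continuous.aestronglyMeasurable (by fun_prop)) ?_ ?_ ?_ ?_
    · intro n
      refine Eventually.of_forall fun y _ => ?_
      rw [norm_mul]
      have : ‖heinzWeight y‖ ≤ 1 := Real.abs_sin_le_one _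
      nlinarith [hbd n y, hp n, norm_nonneg (heinzWeight y), norm_nonneg (p n * Real.cos (2 * Real.pi * n * y))]
    · exact Eventually.of_forall fun y _ => hsum
    · exact intervalIntegrable_const
    · exact Eventually.of_forall fun y _ => (hG y).mul_right _
  have h4 : ∀ n : ℤ, (∫ y in (0:ℝ)..(1 / 3), (p n * Real.cos (2 * Real.pi * n * y)) * heinzWeight y)
      = p n * ∫ y in (0:ℝ)..(1 / 3), Real.cos (2 * Real.pi * n * y) * heinzWeight y := by
    intro n
    rw [← intervalIntegral.integral_const_mul]
    simp only [mul_assoc]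
  simp only [h4] at h3
  have h5 : (∫ y in (0:ℝ)..(1 / 3), (1 - G y) * heinzWeight y) ≤
      ∑ n ∈ ({-1, 0, 1} : Finset ℤ),
        p n * ∫ y in (0:ℝ)..(1 / 3), Real.cos (2 * Real.pi * n * y) * heinzWeight y := by
    have := sum_le_hasSum ({-1, 0, 1} : Finset ℤ) (fun n hn => ?_) h3.neg
    · rw [Finset.sum_neg_distrib] at this
      exact neg_le_neg_iff.1 this
    · refine neg_nonneg.2 (mul_nonpos_of_nonneg_of_nonpos (hp n)
        (integral_cos_int_mul_heinzWeight_nonpos ?_))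
      simp only [Finset.mem_insert, Finset.mem_singleton, not_or] at hn
      rcases abs_cases n with h | h <;> omega
  rw [Finset.sum_insert (by decide), Finset.sum_insert (by decide), Finset.sum_singleton] at h5
  have e0 : ∫ y in (0:ℝ)..(1 / 3), Real.cos (2 * Real.pi * (0 : ℤ) * y) * heinzWeight y =
      3 / (4 * Real.pi) := by
    rw [← integral_heinzWeight]; simp
  have e1 : ∫ y in (0:ℝ)..(1 / 3), Real.cos (2 * Real.pi * (1 : ℤ) * y) * heinzWeight y =
      √3 / 12 := by
    rw [← integral_cos_mul_heinzWeight]; simp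
  have e2 : ∫ y in (0:ℝ)..(1 / 3), Real.cos (2 * Real.pi * (-1 : ℤ) * y) * heinzWeight y =
      √3 / 12 := by
    rw [← integral_cos_mul_heinzWeight]; simp
  rw [e0, e1, e2] at h5
  have h6 : 9 * √3 / (16 * Real.pi ^ 2) ≤
      p (-1) * (√3 / 12) + (p 0 * (3 / (4 * Real.pi)) + p 1 * (√3 / 12)) := by
    rw [← integral_affine_mul_heinzWeight]
    linarith
  have h7 : √3 * √3 = 3 := Real.mul_self_sqrt (by norm_num)
  -- The factor `4√3` normalises the coefficient `√3/12` of `p 1` and `p (-1)` to `1`.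
  have h8 := mul_le_mul_of_nonneg_left h6 (show 0 ≤ 4 * √3 by positivity)
  have e3 : 4 * √3 * (9 * √3 / (16 * Real.pi ^ 2)) = 27 / (4 * Real.pi ^ 2) := by
    rw [show 4 * √3 * (9 * √3 / (16 * Real.pi ^ 2)) = 36 * (√3 * √3) / (16 * Real.pi ^ 2) by ring,
      h7]
    field_simp
    norm_num
  have e4 : 4 * √3 * (p (-1) * (√3 / 12) + (p 0 * (3 / (4 * Real.pi)) + p 1 * (√3 / 12))) =
      (√3 * √3) / 3 * p 1 + 3 * √3 / Real.pi * p 0 + (√3 * √3) / 3 * p (-1) := by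
    field_simp
    ring
  rw [e3, e4, h7] at h8
  linarith

end CosineInequality

/-! ### From radial limits to the Heinz inequality. -/

section HeinzInequality

open MeasureTheory AddCircle

lemma hasSum_sq_fourierCoeff_of_memLp {f : UnitAddCircle → ℂ} (hf : MemLp f 2 haarAddCircle) :
    HasSum (fun n : ℤ => ‖fourierCoeff f n‖ ^ 2) (∫ x, ‖f x‖ ^ 2 ∂haarAddCircle) := by
  convert hasSum_sq_fourierCoeff hf.toLp using 1
  · ext n; rw [fourierCoeff_congr_ae hf.coeFn_toLp]
  · refine integral_congr_ae ?_
    filter_upwards [hf.coeFn_toLp] with x hx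
    rw [hx]

lemma fourierCoeff_comp_add_right (f : UnitAddCircle → ℂ) (y : UnitAddCircle) (n : ℤ) :
    fourierCoeff (fun x => f (x + y)) n = fourier n y * fourierCoeff f n := by
  have h := integral_add_right_eq_self (μ := haarAddCircle)
    (fun t : UnitAddCircle => fourier (-n) t • f t) y
  rw [fourierCoeff, fourierCoeff, ← h, ← integral_const_mul]
  refine integral_congr_ae (Eventually.of_forall fun x => ?_)
  have e : (fourier n y : ℂ) * fourier (-n) (x + y) = fourier (-n) x := by
    have h1 : (fourier (-n) (x + y) : ℂ) = fourier (-n) x * fourier (-n) y := by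
      simp [fourier_apply, smul_add, AddCircle.toCircle_add]
    have h2 : (fourier n y : ℂ) * fourier (-n) y = 1 := by
      rw [← fourier_add, add_neg_cancel, fourier_zero]
    rw [h1]; linear_combination (fourier (-n) x : ℂ) * h2
  simp only [smul_eq_mul]
  rw [← e]; ring

lemma memLp_comp_add_right {f : UnitAddCircle → ℂ} (hf : MemLp f 2 haarAddCircle)
    (y : UnitAddCircle) : MemLp (fun x => f (x + y)) 2 haarAddCircle :=
  hf.comp_measurePreserving (measurePreserving_add_right haarAddCircle y)

lemma integrable_fourier_smul {f : UnitAddCircle → ℂ} (hf : MemLp f 2 haarAddCircle) (n : ℤ) :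
    Integrable (fun x => fourier n x • f x) haarAddCircle :=
  (hf.integrable (by norm_num)).bdd_mul (c := 1) (map_continuous _).aestronglyMeasurable
    (Eventually.of_forall fun x => (norm_fourier_apply n x).le)

/-- Parseval for the difference of `f` and its translate, whose Fourier coefficients are `(e^{2πiny}
- 1)` times those of `f`. -/
lemma hasSum_sq_fourierCoeff_mul_chord {f : UnitAddCircle → ℂ} (hf : MemLp f 2 haarAddCircle)
    (y : ℝ) : HasSum (fun n : ℤ => ‖fourierCoeff f n‖ ^ 2 * chord (n * y))
      (1 / 2 * ∫ x, ‖f (x + (y : UnitAddCircle)) - f x‖ ^ 2 ∂haarAddCircle) := by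
  have hy := memLp_comp_add_right hf (y : UnitAddCircle)
  have h := (hasSum_sq_fourierCoeff_of_memLp (hy.sub hf)).mul_left (1 / 2)
  refine h.congr_fun ?_
  intro n
  have e : fourierCoeff ((fun x => f (x + (y : UnitAddCircle))) - f) n =
      (circ (n * y) - circ 0) * fourierCoeff f n := by
    have e1 : fourierCoeff ((fun x => f (x + (y : UnitAddCircle))) - f) n =
        fourierCoeff (fun x => f (x + (y : UnitAddCircle))) n - fourierCoeff f n := by
      rw [fourierCoeff, fourierCoeff, fourierCoeff, ← integral_sub (integrable_fourier_smul hy _)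
        (integrable_fourier_smul hf _)]
      simp only [Pi.sub_apply, smul_sub]
    rw [e1, fourierCoeff_comp_add_right, circ_zero, sub_mul, one_mul]
    congr 2
    rw [fourier_coe_apply, circ]; congr 1; push_cast; ring
  rw [e, norm_mul, mul_pow, norm_sq_circ_sub_circ, sub_zero]
  ring

variable {α β : ℝ} {u : ℂ → ℂ} {c : ℤ → ℂ}

lemma ae_comp_add_right {P : UnitAddCircle → Prop} (h : ∀ᵐ x ∂haarAddCircle, P x)
    (y : UnitAddCircle) : ∀ᵐ x ∂haarAddCircle, P (x + y) :=
  (measurePreserving_add_right haarAddCircle y).quasiMeasurePreserving.ae h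

/-- For almost every `x` all points `x + i t` carry radial limits simultaneously. The polygon bound
is then integrated in `x`, and translation invariance makes the first `m` sides contribute equally.
-/
lemma polygon_inequality {v : ℂ → ℂ} (hu : ContinuousOn u unitDisk)
    (hmaps : MapsTo u unitDisk unitDisk) (hv : ContinuousOn v unitDisk)
    (hvmaps : MapsTo v unitDisk unitDisk) (huv : ∀ w ∈ unitDisk, u (v w) = w)
    (hvu : ∀ z ∈ unitDisk, v (u z) = z) {g : UnitAddCircle → ℂ} (hg : MemLp g 2 haarAddCircle)
    (hlim : ∀ᵐ x ∂haarAddCircle, Tendsto (fun r : ℝ => u (r * fourier 1 x)) (𝓝[<] 1) (𝓝 (g x)))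
    {m : ℕ} {t : ℝ} (ht0 : 0 < t) (htm : m * t < 1) :
    m * ∫ x, ‖g (x + (t : UnitAddCircle)) - g x‖ ^ 2 ∂haarAddCircle +
      ∫ x, ‖g (x + ((m * t : ℝ) : UnitAddCircle)) - g x‖ ^ 2 ∂haarAddCircle ≤ 9 := by
  have hae : ∀ᵐ x ∂haarAddCircle, ∀ i : ℕ, Tendsto
      (fun r : ℝ => u (r * fourier 1 (x + ((i * t : ℝ) : UnitAddCircle)))) (𝓝[<] 1)
      (𝓝 (g (x + ((i * t : ℝ) : UnitAddCircle)))) := by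
    rw [ae_all_iff]
    intro i
    exact ae_comp_add_right hlim _
  have hpt : ∀ᵐ x ∂haarAddCircle,
      ∑ i ∈ Finset.range m, ‖g (x + (((i + 1 : ℕ) * t : ℝ) : UnitAddCircle)) -
        g (x + ((i * t : ℝ) : UnitAddCircle))‖ ^ 2 +
      ‖g (x + ((m * t : ℝ) : UnitAddCircle)) - g x‖ ^ 2 ≤ 9 := by
    filter_upwards [hae] with x hx
    obtain ⟨s, rfl⟩ := QuotientAddGroup.mk_surjective x
    have := sum_norm_sq_radial_limits_le hu hmaps hv hvmaps huv hvu (n := m)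
      (x := fun i => s + i * t) (g := fun i => g ((s : UnitAddCircle) + ((i * t : ℝ) : UnitAddCircle)))
      ?_ ?_ ?_
    · simpa using this
    · intro i j hij _
      have : (i : ℝ) < j := by exact_mod_cast hij
      nlinarith
    · simp; exact htm
    · intro i _
      have := hx i
      refine this.congr fun r => ?_
      congr 2
      exact fourier_one_coe (s + i * t)
  have hdiff : ∀ a b : ℝ, Integrable (fun x : UnitAddCircle =>
      ‖g (x + (a : UnitAddCircle)) - g (x + (b : UnitAddCircle))‖ ^ 2) haarAddCircle := fun a b =>
    ((memLp_comp_add_right hg _).sub (memLp_comp_add_right hg _)).integrable_norm_pow (by norm_num)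
  have hdiff0 : Integrable (fun x : UnitAddCircle =>
      ‖g (x + ((m * t : ℝ) : UnitAddCircle)) - g x‖ ^ 2) haarAddCircle :=
    ((memLp_comp_add_right hg _).sub hg).integrable_norm_pow (by norm_num)
  have hint := integral_mono_ae ((integrable_finsetSum _ fun i _ => hdiff _ _).add hdiff0)
    (integrable_const (9 : ℝ)) hpt
  rw [integral_add' (integrable_finsetSum _ fun i _ => hdiff _ _) hdiff0,
    integral_finsetSum _ fun i _ => hdiff _ _] at hint
  have hstep : ∀ i ∈ Finset.range m, ∫ x, ‖g (x + (((i + 1 : ℕ) * t : ℝ) : UnitAddCircle)) -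
      g (x + ((i * t : ℝ) : UnitAddCircle))‖ ^ 2 ∂haarAddCircle =
      ∫ x, ‖g (x + (t : UnitAddCircle)) - g x‖ ^ 2 ∂haarAddCircle := by
    intro i _
    have := integral_add_right_eq_self (μ := haarAddCircle)
      (fun x : UnitAddCircle => ‖g (x + (t : UnitAddCircle)) - g x‖ ^ 2)
      ((i * t : ℝ) : UnitAddCircle)
    rw [← this]
    refine integral_congr_ae (Eventually.of_forall fun x => ?_)
    simp only
    rw [add_assoc x, ← AddCircle.coe_add,
      show (i : ℝ) * t + t = ((i + 1 : ℕ) : ℝ) * t by push_cast; ring]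
  rw [Finset.sum_congr rfl hstep, Finset.sum_const, Finset.card_range, nsmul_eq_mul] at hint
  simpa using hint

/-- **Heinz's inequality** for `(α,β)`-harmonic maps of the disk onto itself. -/
theorem IsABHarmonicDiskMap.heinz_inequality (h : IsABHarmonicDiskMap α β u c)
    (hα : ∀ n : ℕ, α ≠ -((n : ℝ) + 1)) (hβ : ∀ n : ℕ, β ≠ -((n : ℝ) + 1)) (hαβ : -1 < α + β) :
    27 / (4 * Real.pi ^ 2) ≤ heinzQuantity α β c := by
  obtain ⟨g, hg, hlim, hcoeff⟩ := h.series.exists_radial_limit hα hβ hαβ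
    (fun z hz => (mem_unitDisk.1 (h.mapsTo hz)).le)
  obtain ⟨v, hv, hvmaps, huv, hvu⟩ := h.exists_inverse
  rw [heinzQuantity_eq hcoeff]
  have hnorm : ∀ᵐ x ∂haarAddCircle, ‖g x‖ = 1 := by
    filter_upwards [hlim] with x hx
    obtain ⟨s, rfl⟩ := QuotientAddGroup.mk_surjective x
    refine norm_eq_one_of_radial_limit h.mapsTo hv hvmaps hvu (x := s) (hx.congr fun r => ?_)
    congr 2
    exact fourier_one_coe s
  have hone : HasSum (fun n : ℤ => ‖fourierCoeff g n‖ ^ 2) 1 := by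
    have := hasSum_sq_fourierCoeff_of_memLp hg
    rwa [integral_congr_ae (g := fun _ => (1 : ℝ))
      (by filter_upwards [hnorm] with x hx; rw [hx, one_pow]), integral_const, probReal_univ,
      one_smul] at this
  set G : ℝ → ℝ := fun y => 1 / 2 * ∫ x, ‖g (x + (y : UnitAddCircle)) - g x‖ ^ 2 ∂haarAddCircle
    with hG
  have hGsum : ∀ y, HasSum (fun n : ℤ => ‖fourierCoeff g n‖ ^ 2 * chord (n * y)) (G y) :=
    fun y => hasSum_sq_fourierCoeff_mul_chord hg y
  refine heinz_cosine_inequality (p := fun n => ‖fourierCoeff g n‖ ^ 2) (G := G)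
    (fun n => by positivity) hone.summable (fun y => ?_) (fun m hm t ht1 ht2 => ?_)
  · refine (hone.sub (hGsum y)).congr_fun fun n => ?_
    rw [chord, ← mul_assoc (2 * Real.pi)]
    ring
  · have ht0 : 0 < t := lt_trans (by positivity) ht1
    have hm0 : (0 : ℝ) < m := by exact_mod_cast (show 0 < m by omega)
    have hmt : m * t < 1 := by rwa [lt_div_iff₀ hm0, mul_comm] at ht2
    have h1 := polygon_inequality h.harmonic.1.continuousOn h.mapsTo hv hvmaps huv hvu hg hlim
      ht0 hmt
    -- The closing side joins points `m t` apart, while the cosine inequality refers to the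
    -- complementary arc; `G` is even and 1-periodic.
    have h2 : G (1 - m * t) = G (m * t) := by
      refine (hGsum _).unique ((hGsum _).congr_fun fun n => ?_)
      congr 1
      rw [show (n : ℝ) * (1 - m * t) = -(n * (m * t)) + (n : ℤ) by ring, chord_add_int, chord_neg]
    rw [h2]
    simp only [hG]
    linarith

end HeinzInequality

/-! ### Calculus of Wirtinger derivatives. -/

section Wirtinger

/-- The real-linear map `w ↦ a w + b w̄`. -/
noncomputable def wirtingerMap (a b : ℂ) : ℂ →L[ℝ] ℂ :=
  a • ContinuousLinearMap.id ℝ ℂ + b • (Complex.conjCLE : ℂ →L[ℝ] ℂ)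

lemma wirtingerMap_apply (a b w : ℂ) : wirtingerMap a b w = a * w + b * conj w := by
  simp [wirtingerMap]

/-- `f` is real differentiable at `z` with `∂f/∂z = a` and `∂f/∂z̄ = b`. -/
def HasWirtingerAt (f : ℂ → ℂ) (a b z : ℂ) : Prop := HasFDerivAt f (wirtingerMap a b) z

variable {f g φ : ℂ → ℂ} {a b c d e z : ℂ}

lemma HasWirtingerAt.dz (h : HasWirtingerAt f a b z) : wirtingerDz f z = a := by
  rw [wirtingerDz, HasFDerivAt.fderiv h, wirtingerMap_apply, wirtingerMap_apply, Complex.conj_I,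
    map_one]
  linear_combination (b / 2 - a / 2) * Complex.I_sq

lemma HasWirtingerAt.dzbar (h : HasWirtingerAt f a b z) : wirtingerDzbar f z = b := by
  rw [wirtingerDzbar, HasFDerivAt.fderiv h, wirtingerMap_apply, wirtingerMap_apply, Complex.conj_I,
    map_one]
  linear_combination (a / 2 - b / 2) * Complex.I_sq

lemma HasWirtingerAt.congr (h : HasWirtingerAt f a b z) (ha : a = c) (hb : b = d) :
    HasWirtingerAt f c d z := ha ▸ hb ▸ h

lemma HasDerivAt.hasWirtingerAt (h : HasDerivAt f a z) : HasWirtingerAt f a 0 z := by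
  have := h.hasFDerivAt.restrictScalars ℝ
  refine this.congr_fderiv ?_
  refine ContinuousLinearMap.ext fun w => ?_
  simp [wirtingerMap_apply, mul_comm]

lemma hasWirtingerAt_id (z : ℂ) : HasWirtingerAt (fun z => z) 1 0 z := (hasDerivAt_id z).hasWirtingerAt

lemma hasWirtingerAt_conj (z : ℂ) : HasWirtingerAt (fun z => conj z) 0 1 z := by
  have := (Complex.conjCLE : ℂ →L[ℝ] ℂ).hasFDerivAt (x := z)
  refine this.congr_fderiv ?_
  refine ContinuousLinearMap.ext fun w => ?_
  simp [wirtingerMap_apply]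

lemma HasWirtingerAt.add (hf : HasWirtingerAt f a b z) (hg : HasWirtingerAt g c d z) :
    HasWirtingerAt (fun z => f z + g z) (a + c) (b + d) z := by
  refine (HasFDerivAt.add hf hg).congr_fderiv ?_
  refine ContinuousLinearMap.ext fun w => ?_
  simp [wirtingerMap_apply]; ring

lemma HasWirtingerAt.mul (hf : HasWirtingerAt f a b z) (hg : HasWirtingerAt g c d z) :
    HasWirtingerAt (fun z => f z * g z) (a * g z + f z * c) (b * g z + f z * d) z := by
  refine (HasFDerivAt.mul hf hg).congr_fderiv ?_
  refine ContinuousLinearMap.ext fun w => ?_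
  simp [wirtingerMap_apply]; ring

lemma HasWirtingerAt.comp (hφ : HasDerivAt φ e (f z)) (hf : HasWirtingerAt f a b z) :
    HasWirtingerAt (fun z => φ (f z)) (e * a) (e * b) z := by
  refine (hφ.comp_hasFDerivAt z (𝕜' := ℂ) hf).congr_fderiv ?_
  refine ContinuousLinearMap.ext fun w => ?_
  simp [wirtingerMap_apply]; ring

lemma HasWirtingerAt.conj (hf : HasWirtingerAt f a b z) :
    HasWirtingerAt (fun z => conj (f z)) (conj b) (conj a) z := by
  refine ((Complex.conjCLE : ℂ →L[ℝ] ℂ).hasFDerivAt.comp z hf).congr_fderiv ?_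
  refine ContinuousLinearMap.ext fun w => ?_
  simp [wirtingerMap_apply]; ring

lemma HasWirtingerAt.congr_of_eventuallyEq (hf : HasWirtingerAt f a b z) (h : g =ᶠ[𝓝 z] f) :
    HasWirtingerAt g a b z := HasFDerivAt.congr_of_eventuallyEq hf h

lemma continuous_wirtingerMap : Continuous fun p : ℂ × ℂ => wirtingerMap p.1 p.2 := by
  unfold wirtingerMap; fun_prop

lemma norm_wirtingerMap_le (a b : ℂ) : ‖wirtingerMap a b‖ ≤ ‖a‖ + ‖b‖ := by
  refine ContinuousLinearMap.opNorm_le_bound _ (by positivity) fun w => ?_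
  rw [wirtingerMap_apply, add_mul]
  refine (norm_add_le _ _).trans (le_of_eq ?_)
  rw [norm_mul, norm_mul, RCLike.norm_conj]

end Wirtinger

/-! ### Solutions of the `(α, 0)`-equation as integrals of holomorphic functions. -/

section HolomorphicPrimitive

lemma hasWirtingerAt_intervalIntegral {U : Set ℂ} (hU : IsOpen U) {F A B : ℂ → ℝ → ℂ}
    (hF : ContinuousOn (fun p : ℂ × ℝ => F p.1 p.2) (U ×ˢ Icc (0:ℝ) 1))
    (hA : ContinuousOn (fun p : ℂ × ℝ => A p.1 p.2) (U ×ˢ Icc (0:ℝ) 1))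
    (hB : ContinuousOn (fun p : ℂ × ℝ => B p.1 p.2) (U ×ˢ Icc (0:ℝ) 1))
    (hW : ∀ s ∈ Icc (0:ℝ) 1, ∀ z ∈ U, HasWirtingerAt (fun z => F z s) (A z s) (B z s) z)
    {z : ℂ} (hz : z ∈ U) :
    HasWirtingerAt (fun z => ∫ s in (0:ℝ)..1, F z s) (∫ s in (0:ℝ)..1, A z s)
      (∫ s in (0:ℝ)..1, B z s) z := by
  have hsec : ∀ {Φ : ℂ → ℝ → ℂ}, ContinuousOn (fun p : ℂ × ℝ => Φ p.1 p.2) (U ×ˢ Icc (0:ℝ) 1) →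
      ∀ z ∈ U, ContinuousOn (fun s => Φ z s) (uIcc (0:ℝ) 1) := by
    intro Φ hΦ z hz
    rw [uIcc_of_le zero_le_one]
    exact hΦ.comp (f := fun s : ℝ => (z, s)) (by fun_prop) fun s hs => ⟨hz, hs⟩
  obtain ⟨δ, hδ, hball⟩ : ∃ δ > 0, Metric.closedBall z δ ⊆ U :=
    Metric.nhds_basis_closedBall.mem_iff.1 (hU.mem_nhds hz)
  have hcomp : IsCompact (Metric.closedBall z δ ×ˢ Icc (0:ℝ) 1) :=
    (isCompact_closedBall _ _).prod isCompact_Icc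
  have hsub : Metric.closedBall z δ ×ˢ Icc (0:ℝ) 1 ⊆ U ×ˢ Icc (0:ℝ) 1 := prod_mono_left hball
  obtain ⟨C, hC⟩ := hcomp.exists_bound_of_continuousOn (hA.mono hsub)
  obtain ⟨C', hC'⟩ := hcomp.exists_bound_of_continuousOn (hB.mono hsub)
  have hIoc : ∀ s : ℝ, s ∈ uIoc (0:ℝ) 1 → s ∈ Icc (0:ℝ) 1 := fun s hs => by
    rw [uIoc_of_le zero_le_one] at hs; exact Ioc_subset_Icc_self hs
  have hAc := hsec hA z hz
  have hBc := hsec hB z hz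
  have hWc : ContinuousOn (fun s => wirtingerMap (A z s) (B z s)) (uIcc (0:ℝ) 1) :=
    continuous_wirtingerMap.comp_continuousOn (hAc.prodMk hBc)
  have hmW : MeasureTheory.AEStronglyMeasurable (fun s => wirtingerMap (A z s) (B z s))
      (MeasureTheory.volume.restrict (uIoc (0:ℝ) 1)) :=
    (hWc.mono uIoc_subset_uIcc).aestronglyMeasurable measurableSet_uIoc
  have key := intervalIntegral.hasFDerivAt_integral_of_dominated_of_fderiv_le (𝕜 := ℝ)
    (μ := MeasureTheory.volume) (a := 0) (b := 1) (F := F)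
    (F' := fun z s => wirtingerMap (A z s) (B z s)) (x₀ := z) (bound := fun _ => C + C')
    (Metric.ball_mem_nhds z hδ) ?_ ?_ hmW ?_ ?_ ?_
  · refine HasFDerivAt.congr_fderiv key ?_
    have hAi := hAc.intervalIntegrable (μ := MeasureTheory.volume)
    have hBi := hBc.intervalIntegrable (μ := MeasureTheory.volume)
    refine ContinuousLinearMap.ext fun w => ?_
    have hint : IntervalIntegrable (fun s => wirtingerMap (A z s) (B z s)) MeasureTheory.volume 0 1 :=
      hWc.intervalIntegrable
    rw [ContinuousLinearMap.intervalIntegral_apply hint, wirtingerMap_apply]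
    simp only [wirtingerMap_apply]
    rw [intervalIntegral.integral_add (hAi.mul_const _) (hBi.mul_const _),
      intervalIntegral.integral_mul_const, intervalIntegral.integral_mul_const]
  · filter_upwards [hU.mem_nhds hz] with ζ hζ
    exact ((hsec hF ζ hζ).mono uIoc_subset_uIcc).aestronglyMeasurable measurableSet_uIoc
  · exact (hsec hF z hz).intervalIntegrable
  · refine Eventually.of_forall fun s hs ζ hζ => ?_
    have hm : (ζ, s) ∈ Metric.closedBall z δ ×ˢ Icc (0:ℝ) 1 :=
      ⟨Metric.ball_subset_closedBall hζ, hIoc s hs⟩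
    exact (norm_wirtingerMap_le _ _).trans (add_le_add (hC _ hm) (hC' _ hm))
  · exact intervalIntegrable_const
  · refine Eventually.of_forall fun s hs ζ hζ => ?_
    exact hW s (hIoc s hs) ζ (hball (Metric.ball_subset_closedBall hζ))

/-- The integral over `[0,1]` of `z H(sz) (1 - s|z|²)^γ`: the primitive in `z` of
`H(z) (1 - z z̄)^γ` vanishing at `0`, with `z̄` held fixed. -/
noncomputable def diskPrimitive (H : ℂ → ℂ) (γ : ℂ) (z : ℂ) : ℂ :=
  ∫ s in (0:ℝ)..1, z * H (s * z) * (1 - s * (z * conj z)) ^ γ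

variable {H : ℂ → ℂ} {γ z : ℂ}

lemma smul_mem_unitDisk {s : ℝ} (hs : s ∈ Icc (0:ℝ) 1) (hz : z ∈ unitDisk) :
    (s : ℂ) * z ∈ unitDisk := by
  rw [mem_unitDisk] at *
  rw [norm_mul, Complex.norm_real, Real.norm_of_nonneg hs.1]
  nlinarith [norm_nonneg z, hs.2]

lemma one_sub_mul_mem_slitPlane {s : ℝ} (hs : s ∈ Icc (0:ℝ) 1) (hz : z ∈ unitDisk) :
    1 - (s : ℂ) * (z * conj z) ∈ Complex.slitPlane := by
  rw [mem_unitDisk] at hz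
  rw [Complex.mul_conj, Complex.normSq_eq_norm_sq]
  left
  have e : (1 - (s : ℂ) * ((‖z‖ ^ 2 : ℝ) : ℂ)) = ((1 - s * ‖z‖ ^ 2 : ℝ) : ℂ) := by push_cast; ring
  rw [e, Complex.ofReal_re]
  nlinarith [norm_nonneg z, hs.2, hs.1, sq_nonneg ‖z‖]

/-- The `z`-derivative of the integrand is the `s`-derivative of `s H(sz) (1 - s|z|²)^γ`, so it
integrates in closed form; the `z̄`-derivative is an integral of the same type with exponent `γ -
1`. For `β = 0` the equation reads `(1 - |z|²) u_{z z̄} + α z u_z = 0`, which `u_z = H(z) (1 -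
|z|²)^α` satisfies. -/
lemma hasWirtingerAt_diskPrimitive (hH : DifferentiableOn ℂ H unitDisk) (hz : z ∈ unitDisk) :
    HasWirtingerAt (diskPrimitive H γ) (H z * (1 - z * conj z) ^ γ)
      (-γ * diskPrimitive (fun ζ => ζ * H ζ) (γ - 1) z) z := by
  have hHd : ∀ ζ ∈ unitDisk, HasDerivAt H (deriv H ζ) ζ := fun ζ hζ =>
    (hH.differentiableAt (isOpen_unitDisk.mem_nhds hζ)).hasDerivAt
  have hH' : ContinuousOn (deriv H) unitDisk :=
    (hH.deriv isOpen_unitDisk).continuousOn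
  set A : ℂ → ℝ → ℂ := fun z s =>
    (H (s * z) + z * (deriv H (s * z) * s)) * (1 - s * (z * conj z)) ^ γ +
      z * H (s * z) * (γ * (1 - s * (z * conj z)) ^ (γ - 1) * (-(s * conj z))) with hA
  set B : ℂ → ℝ → ℂ := fun z s =>
    z * H (s * z) * (γ * (1 - s * (z * conj z)) ^ (γ - 1) * (-(s * z))) with hB
  have hW : ∀ s ∈ Icc (0:ℝ) 1, ∀ z ∈ unitDisk,
      HasWirtingerAt (fun z => z * H (s * z) * (1 - s * (z * conj z)) ^ γ) (A z s) (B z s) z := by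
    intro s hs z hz
    have h1 : HasWirtingerAt (fun z : ℂ => H (s * z)) (deriv H (s * z) * s) 0 z := by
      have : HasDerivAt (fun z : ℂ => (s : ℂ) * z) (s : ℂ) z := by
        simpa using (hasDerivAt_id z).const_mul (s : ℂ)
      exact ((hHd _ (smul_mem_unitDisk hs hz)).comp z this).hasWirtingerAt
    have h2 : HasWirtingerAt (fun z : ℂ => z * conj z) (conj z) z z :=
      ((hasWirtingerAt_id z).mul (hasWirtingerAt_conj z)).congr (by ring) (by ring)
    have h3 : HasDerivAt (fun w : ℂ => (1 - s * w) ^ γ)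
        (γ * (1 - s * (z * conj z)) ^ (γ - 1) * (-s)) (z * conj z) := by
      have : HasDerivAt (fun w : ℂ => 1 - (s : ℂ) * w) (-(s : ℂ)) (z * conj z) := by
        simpa using ((hasDerivAt_id (z * conj z)).const_mul (s : ℂ)).const_sub 1
      exact this.cpow_const (one_sub_mul_mem_slitPlane hs hz)
    refine (((hasWirtingerAt_id z).mul h1).mul (HasWirtingerAt.comp h3 h2)).congr ?_ ?_
    · simp only [hA]; ring
    · simp only [hB]; ring
  -- continuity of the integrand and of its derivatives
  have hmaps : MapsTo (fun p : ℂ × ℝ => (p.2 : ℂ) * p.1) (unitDisk ×ˢ Icc (0:ℝ) 1) unitDisk :=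
    fun p hp => smul_mem_unitDisk hp.2 hp.1
  have hc0 : ContinuousOn (fun p : ℂ × ℝ => (p.2 : ℂ) * p.1) (unitDisk ×ˢ Icc (0:ℝ) 1) := by
    fun_prop
  have hc1 : ContinuousOn (fun p : ℂ × ℝ => H (p.2 * p.1)) (unitDisk ×ˢ Icc (0:ℝ) 1) :=
    hH.continuousOn.comp hc0 hmaps
  have hc2 : ContinuousOn (fun p : ℂ × ℝ => deriv H (p.2 * p.1)) (unitDisk ×ˢ Icc (0:ℝ) 1) :=
    hH'.comp hc0 hmaps
  have hc3 : ∀ δ : ℂ, ContinuousOn (fun p : ℂ × ℝ => (1 - p.2 * (p.1 * conj p.1)) ^ δ)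
      (unitDisk ×ˢ Icc (0:ℝ) 1) := fun δ => by
    refine ContinuousOn.cpow ?_ continuousOn_const
      fun p hp => one_sub_mul_mem_slitPlane hp.2 hp.1
    fun_prop
  have cf : ContinuousOn (fun p : ℂ × ℝ => p.1) (unitDisk ×ˢ Icc (0:ℝ) 1) := by fun_prop
  have cs : ContinuousOn (fun p : ℂ × ℝ => (p.2 : ℂ)) (unitDisk ×ˢ Icc (0:ℝ) 1) := by fun_prop
  have cc : ContinuousOn (fun p : ℂ × ℝ => conj p.1) (unitDisk ×ˢ Icc (0:ℝ) 1) := by fun_prop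
  have hcA : ContinuousOn (fun p : ℂ × ℝ => A p.1 p.2) (unitDisk ×ˢ Icc (0:ℝ) 1) := by
    exact ((hc1.add (cf.mul (hc2.mul cs))).mul (hc3 γ)).add
      ((cf.mul hc1).mul ((continuousOn_const.mul (hc3 (γ - 1))).mul (cs.mul cc).neg))
  have hcB : ContinuousOn (fun p : ℂ × ℝ => B p.1 p.2) (unitDisk ×ˢ Icc (0:ℝ) 1) := by
    exact (cf.mul hc1).mul ((continuousOn_const.mul (hc3 (γ - 1))).mul (cs.mul cf).neg)
  have hcF : ContinuousOn (fun p : ℂ × ℝ => p.1 * H (p.2 * p.1) * (1 - p.2 * (p.1 * conj p.1)) ^ γ)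
      (unitDisk ×ˢ Icc (0:ℝ) 1) := by
    exact (cf.mul hc1).mul (hc3 γ)
  have hAi : IntervalIntegrable (A z) MeasureTheory.volume 0 1 := by
    refine ContinuousOn.intervalIntegrable ?_
    rw [uIcc_of_le zero_le_one]
    exact hcA.comp (f := fun s : ℝ => (z, s)) (by fun_prop) fun s hs => ⟨hz, hs⟩
  have hAint : ∫ s in (0:ℝ)..1, A z s = H z * (1 - z * conj z) ^ γ := by
    have hder : ∀ s ∈ uIcc (0:ℝ) 1, HasDerivAt
        (fun s : ℝ => (s : ℂ) * H (s * z) * (1 - s * (z * conj z)) ^ γ) (A z s) s := by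
      intro s hs
      rw [uIcc_of_le zero_le_one] at hs
      have h0 : HasDerivAt (fun s : ℝ => (s : ℂ)) 1 s := Complex.ofRealCLM.hasDerivAt
      have h1 : HasDerivAt (fun s : ℝ => H (s * z)) (deriv H (s * z) * (1 * z)) s :=
        (hHd _ (smul_mem_unitDisk hs hz)).comp s (h0.mul_const z)
      have h2 : HasDerivAt (fun s : ℝ => (1 - (s : ℂ) * (z * conj z)) ^ γ)
          (γ * (1 - s * (z * conj z)) ^ (γ - 1) * (-(1 * (z * conj z)))) s := by
        have h3 : HasDerivAt (fun w : ℂ => w ^ γ) (γ * (1 - s * (z * conj z)) ^ (γ - 1) * 1)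
            (1 - s * (z * conj z)) :=
          (hasDerivAt_id _).cpow_const (one_sub_mul_mem_slitPlane hs hz)
        rw [mul_one] at h3
        exact h3.comp s ((h0.mul_const (z * conj z)).const_sub 1)
      refine ((h0.mul h1).mul h2).congr_deriv ?_
      simp only [hA, Pi.mul_apply]; ring
    rw [intervalIntegral.integral_eq_sub_of_hasDerivAt hder hAi]
    simp
  have hBint : ∫ s in (0:ℝ)..1, B z s = -γ * diskPrimitive (fun ζ => ζ * H ζ) (γ - 1) z := by
    rw [diskPrimitive, ← intervalIntegral.integral_const_mul]
    refine intervalIntegral.integral_congr fun s _ => ?_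
    simp only [hB]; ring
  rw [← hAint, ← hBint]
  exact hasWirtingerAt_intervalIntegral isOpen_unitDisk hcF hcA hcB hW hz

/-- Induction over all `H` and `γ` at once: one derivative is explicit and smooth, the other belongs
to the same family. -/
lemma contDiffOn_diskPrimitive (n : ℕ) : ∀ {H : ℂ → ℂ} {γ : ℂ}, DifferentiableOn ℂ H unitDisk →
    ContDiffOn ℝ n (diskPrimitive H γ) unitDisk := by
  induction n with
  | zero =>
    intro H γ hH
    rw [Nat.cast_zero, contDiffOn_zero]
    exact fun z hz => (HasFDerivAt.continuousAt
      (hasWirtingerAt_diskPrimitive hH hz)).continuousWithinAt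
  | succ n ih =>
    intro H γ hH
    have hW := fun z hz => hasWirtingerAt_diskPrimitive (γ := γ) hH (z := z) hz
    rw [Nat.cast_add, Nat.cast_one, contDiffOn_succ_iff_fderiv_of_isOpen isOpen_unitDisk]
    refine ⟨fun z hz => (HasFDerivAt.differentiableAt (hW z hz)).differentiableWithinAt,
      by simp, ?_⟩
    have h1 : ContDiffOn ℝ n (fun z => H z * (1 - z * conj z) ^ γ) unitDisk := by
      refine ContDiffOn.mul (ContDiffOn.restrict_scalars ℝ (hH.contDiffOn isOpen_unitDisk)) ?_
      intro z hz
      have hz' : (1 - z * conj z) ∈ Complex.slitPlane := by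
        simpa using one_sub_mul_mem_slitPlane (s := 1) (by simp) hz
      have h2 : ContDiffAt ℝ n (fun w : ℂ => w ^ γ) (1 - z * conj z) :=
        ((analyticAt_id.cpow analyticAt_const hz').contDiffAt).restrict_scalars ℝ
      have h3 : ContDiffAt ℝ n (fun z : ℂ => 1 - z * conj z) z :=
        contDiffAt_const.sub (contDiffAt_id.mul Complex.conjCLE.contDiff.contDiffAt)
      exact (h2.comp z h3).contDiffWithinAt
    have h2 : ContDiffOn ℝ n (fun z => -γ * diskPrimitive (fun ζ => ζ * H ζ) (γ - 1) z) unitDisk :=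
      contDiffOn_const.mul (ih (differentiableOn_id.mul hH))
    have h3 : ContDiffOn ℝ n (fun z => wirtingerMap (H z * (1 - z * conj z) ^ γ)
        (-γ * diskPrimitive (fun ζ => ζ * H ζ) (γ - 1) z)) unitDisk := by
      unfold wirtingerMap
      exact (h1.smul contDiffOn_const).add (h2.smul contDiffOn_const)
    exact h3.congr fun z hz => HasFDerivAt.fderiv (hW z hz)

end HolomorphicPrimitive

/-! ### Global injectivity from boundary behaviour. -/

section ProperLocalHomeo

/-- A proper local homeomorphism of a simply connected, locally path connected Hausdorff space to
itself with a point in the fibre over one point is a bijection. -/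
theorem IsLocalHomeomorph.bijective_of_isProperMap {X : Type*} [TopologicalSpace X] [T2Space X]
    [SimplyConnectedSpace X] [LocallyPathConnectedSpace X] {f : X → X} (hf : IsLocalHomeomorph f)
    (hp : IsProperMap f) {x₀ y₀ : X} (h0 : f x₀ = y₀) : Function.Bijective f := by
  have hfin : ∀ y, (f ⁻¹' {y}).Finite := fun y => by
    refine (hp.isCompact_preimage isCompact_singleton).finite ?_
    refine IsLocalHomeomorphOn.isDiscrete_of_image (f := f) (fun x _ => hf x) ?_
    exact (subsingleton_singleton.anti (image_preimage_subset f {y})).isDiscrete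
  have hcov : IsCoveringMap f := by
    rw [isCoveringMap_iff_isCoveringMapOn_univ]
    exact hp.isClosedMap.isCoveringMapOn_of_isLocalHomeomorphOn (fun y _ => hfin y)
      (fun x _ => hf x)
  -- With finite fibres and closedness `f` is a covering. Simple connectivity lifts the identity to
  -- a section, and uniqueness of lifts makes the section a two-sided inverse.
  obtain ⟨σ, ⟨hσ0, hσ⟩, -⟩ :=
    hcov.existsUnique_continuousMap_lifts (ContinuousMap.id X) y₀ x₀ h0
  have hσ' : ∀ y, f (σ y) = y := fun y => congrFun hσ y
  have hinv : σ ∘ f = id := hcov.eq_of_comp_eq (σ.continuous.comp hf.continuous) continuous_id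
    (by ext x; simp [hσ']) x₀ (by simp [h0, hσ0])
  exact ⟨Function.LeftInverse.injective (g := σ) fun x => congrFun hinv x,
    fun y => ⟨σ y, hσ' y⟩⟩

/-- A sense-preserving map of the disk, continuous up to the boundary and mapping the unit circle
to itself, maps the disk to itself bijectively. -/
theorem injOn_and_image_eq_of_sensePreserving {u : ℂ → ℂ} (hu : ContDiffOn ℝ 2 u unitDisk)
    (hs : IsSensePreserving u) (hc : ContinuousOn u (Metric.closedBall 0 1))
    (hb : ∀ z, ‖z‖ = 1 → ‖u z‖ = 1) (h0 : u 0 = 0) :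
    InjOn u unitDisk ∧ u '' unitDisk = unitDisk := by
  have hmap := fun z (hz : z ∈ unitDisk) => map_nhds_eq_of_sensePreserving hu hs hz
  obtain ⟨z₀, hz₀, hmax⟩ := (isCompact_closedBall (0 : ℂ) 1).exists_isMaxOn
    ⟨0, Metric.mem_closedBall_self zero_le_one⟩ hc.norm
  have hmax' : ∀ z, ‖z‖ ≤ 1 → ‖u z‖ ≤ ‖u z₀‖ := fun z hz => hmax (by simpa using hz)
  have h1 : 1 ≤ ‖u z₀‖ := by
    rw [← hb 1 norm_one]; exact hmax' 1 (by simp)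
  -- An open map cannot attain its maximum modulus inside, which replaces the maximum principle for
  -- a map that is not holomorphic.
  have hno : ∀ z ∈ unitDisk, ‖u z‖ < ‖u z₀‖ := by
    intro z hz
    refine lt_of_le_of_ne (hmax' z (mem_unitDisk.1 hz).le) fun heq => ?_
    have hev : ∀ᶠ w in 𝓝 (u z), ‖w‖ ≤ ‖u z‖ := by
      rw [← hmap z hz, eventually_map]
      filter_upwards [isOpen_unitDisk.mem_nhds hz] with ζ hζ
      rw [heq]; exact hmax' ζ (mem_unitDisk.1 hζ).le
    have ht : Tendsto (fun t : ℝ => ((1 + t : ℝ) : ℂ) * u z) (𝓝[>] 0) (𝓝 (u z)) := by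
      have : ContinuousAt (fun t : ℝ => ((1 + t : ℝ) : ℂ) * u z) 0 := by fun_prop
      have h2 := this.tendsto
      simp only [add_zero, Complex.ofReal_one, one_mul] at h2
      exact h2.mono_left nhdsWithin_le_nhds
    obtain ⟨t, ht1, ht0⟩ := ((ht.eventually hev).and self_mem_nhdsWithin).exists
    have ht0' : (0 : ℝ) < t := ht0
    rw [norm_mul, Complex.norm_real, Real.norm_of_nonneg (by linarith)] at ht1
    nlinarith
  have hz₀1 : ‖z₀‖ = 1 := by
    refine le_antisymm (by simpa using hz₀) (not_lt.1 fun h => ?_)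
    exact lt_irrefl _ (hno z₀ (mem_unitDisk.2 h))
  have hmaps : MapsTo u unitDisk unitDisk := fun z hz => by
    rw [mem_unitDisk, ← hb z₀ hz₀1]; exact hno z hz
  set f : unitDisk → unitDisk := hmaps.restrict u unitDisk unitDisk with hf
  have hemb : IsOpenEmbedding (Subtype.val : unitDisk → ℂ) := isOpen_unitDisk.isOpenEmbedding_subtypeVal
  have hfc : Continuous f := (hu.continuousOn.mono Subset.rfl).mapsToRestrict hmaps
  have hfo : IsOpenMap f := by
    rw [isOpenMap_iff_nhds_le]
    intro x
    rw [← Filter.map_le_map_iff hemb.injective, hemb.map_nhds_eq]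
    change 𝓝 (u x) ≤ _
    rw [Filter.map_map, ← hmap x x.2, ← hemb.map_nhds_eq x, Filter.map_map]
    rfl
  have hlh : IsLocalHomeomorph f := by
    rw [isLocalHomeomorph_iff_isOpenEmbedding_restrict]
    intro x
    obtain ⟨W, hW, hinj⟩ := exists_injOn_nhds_of_sensePreserving hu hs x.2
    obtain ⟨V, hVW, hV, hxV⟩ := mem_nhds_iff.1 hW
    have hV' : IsOpen (Subtype.val ⁻¹' V : Set unitDisk) := hV.preimage continuous_subtype_val
    refine ⟨Subtype.val ⁻¹' V, hV'.mem_nhds hxV, ?_⟩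
    refine .of_continuous_injective_isOpenMap (hfc.comp continuous_subtype_val) ?_
      (hfo.domRestrict hV')
    intro a b hab
    exact Subtype.ext (Subtype.ext (hinj (hVW a.2) (hVW b.2) (congrArg Subtype.val hab)))
  have hprop : IsProperMap f := by
    rw [isProperMap_iff_isCompact_preimage]
    refine ⟨hfc, fun K hK => ?_⟩
    rw [Subtype.isCompact_iff] at hK ⊢
    -- Properness: the circle is mapped to the circle, so taking the preimage of `K` in the closed
    -- disk adds no points.
    have e : Subtype.val '' (f ⁻¹' K) =
        Metric.closedBall (0 : ℂ) 1 ∩ u ⁻¹' (Subtype.val '' K) := by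
      ext z
      constructor
      · rintro ⟨x, hx, rfl⟩
        exact ⟨Metric.ball_subset_closedBall x.2, f x, hx, rfl⟩
      · rintro ⟨hz, w, hw, hwz⟩
        have hz1 : z ∈ unitDisk := by
          rw [mem_unitDisk]
          refine lt_of_le_of_ne (by simpa using hz) fun h => ?_
          have := mem_unitDisk.1 w.2
          rw [hwz, hb z h] at this
          exact lt_irrefl _ this
        refine ⟨⟨z, hz1⟩, ?_, rfl⟩
        have : f ⟨z, hz1⟩ = w := Subtype.ext hwz.symm
        rwa [mem_preimage, this]
    rw [e]
    exact (isCompact_closedBall _ _).of_isClosed_subset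
      (hc.preimage_isClosed_of_isClosed Metric.isClosed_closedBall hK.isClosed) inter_subset_left
  have hmem0 : (0 : ℂ) ∈ unitDisk := by simp
  have : ContractibleSpace unitDisk := (convex_ball (0 : ℂ) 1).contractibleSpace ⟨0, hmem0⟩
  have : LocallyPathConnectedSpace unitDisk := isOpen_unitDisk.locallyPathConnectedSpace
  have hbij := hlh.bijective_of_isProperMap hprop (x₀ := ⟨0, hmem0⟩) (y₀ := ⟨0, hmem0⟩)
    (Subtype.ext h0)
  refine ⟨fun z hz w hw h => ?_, Subset.antisymm hmaps.image_subset fun w hw => ?_⟩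
  · exact congrArg Subtype.val (hbij.1 (a₁ := ⟨z, hz⟩) (a₂ := ⟨w, hw⟩) (Subtype.ext h))
  · obtain ⟨x, hx⟩ := hbij.2 ⟨w, hw⟩
    exact ⟨x, x.2, congrArg Subtype.val hx⟩

end ProperLocalHomeo

/-! ### Power series on the closed disk. -/

section PowerSeries

lemma hasDerivAt_tsum_mul_pow_succ {b : ℕ → ℂ} {R : ℝ} (hR : 0 < R)
    (h : Summable fun k : ℕ => ((k : ℝ) + 1) * ‖b k‖ * R ^ k) {z : ℂ} (hz : ‖z‖ < R) :
    HasDerivAt (fun z => ∑' k : ℕ, b k * z ^ (k + 1)) (∑' k : ℕ, ((k : ℂ) + 1) * b k * z ^ k) z := by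
  refine hasDerivAt_tsum_of_isPreconnected (g := fun k z => b k * z ^ (k + 1))
    (g' := fun k z => ((k : ℂ) + 1) * b k * z ^ k) h Metric.isOpen_ball
    (convex_ball (0 : ℂ) R).isPreconnected ?_ ?_ (y₀ := 0) (by simpa using hR) ?_
    (by simpa using hz)
  · intro k y _
    have := (hasDerivAt_pow (k + 1) y).const_mul (b k)
    refine this.congr_deriv ?_
    push_cast [Nat.add_sub_cancel]; ring
  · intro k y hy
    rw [mem_ball_zero_iff] at hy
    rw [norm_mul, norm_mul, norm_pow]
    have e : ‖(k : ℂ) + 1‖ = (k : ℝ) + 1 := by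
      rw [← Nat.cast_add_one, Complex.norm_natCast]; push_cast; ring
    rw [e]
    gcongr
  · simp [summable_zero]

lemma differentiableOn_tsum_mul_pow {b : ℕ → ℂ} (h : Summable fun k : ℕ => ((k : ℝ) + 1) * ‖b k‖) :
    DifferentiableOn ℂ (fun z => ∑' k : ℕ, b k * z ^ k) unitDisk := by
  intro z hz
  have hz1 := mem_unitDisk.1 hz
  have hb : Summable fun k : ℕ => ‖b k‖ := h.of_nonneg_of_le (fun k => norm_nonneg _) fun k => by
    have : (0 : ℝ) ≤ k := Nat.cast_nonneg k
    nlinarith [norm_nonneg (b k)]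
  have h' : Summable fun k : ℕ => ((k : ℝ) + 1) * ‖b (k + 1)‖ * 1 ^ k := by
    refine (h.comp_injective (add_left_injective 1)).of_nonneg_of_le (fun k => by positivity)
      fun k => ?_
    simp only [Function.comp_apply, one_pow, mul_one]
    push_cast
    gcongr
    linarith
  have hd := (hasDerivAt_tsum_mul_pow_succ one_pos h' hz1).differentiableAt.const_add (b 0)
  refine (hd.congr_of_eventuallyEq ?_).differentiableWithinAt
  filter_upwards [isOpen_unitDisk.mem_nhds hz] with w hw
  have hs : Summable fun k : ℕ => b k * w ^ k := by
    refine .of_norm_bounded hb fun k => ?_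
    rw [norm_mul, norm_pow]
    exact mul_le_of_le_one_right (norm_nonneg _)
      (pow_le_one₀ (norm_nonneg _) (mem_unitDisk.1 hw).le)
  rw [hs.tsum_eq_zero_add]
  simp

lemma summable_mul_pow_of_norm_le_one {b : ℕ → ℂ} (h : Summable fun k : ℕ => ‖b k‖) {z : ℂ}
    (hz : ‖z‖ ≤ 1) : Summable fun k : ℕ => b k * z ^ k := by
  refine .of_norm_bounded h fun k => ?_
  rw [norm_mul, norm_pow]
  exact mul_le_of_le_one_right (norm_nonneg _) (pow_le_one₀ (norm_nonneg _) hz)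

lemma continuousOn_tsum_mul_pow {b : ℕ → ℂ} (h : Summable fun k : ℕ => ‖b k‖) :
    ContinuousOn (fun z => ∑' k : ℕ, b k * z ^ k) (Metric.closedBall 0 1) := by
  refine continuousOn_tsum (fun k => by fun_prop) h fun k z hz => ?_
  rw [norm_mul, norm_pow]
  exact mul_le_of_le_one_right (norm_nonneg _) (pow_le_one₀ (norm_nonneg _) (by simpa using hz))

lemma norm_tsum_mul_pow_le {b : ℕ → ℂ} (h : Summable fun k : ℕ => ‖b k‖) {z : ℂ}
    (hz : ‖z‖ ≤ 1) : ‖∑' k : ℕ, b k * z ^ k‖ ≤ ∑' k, ‖b k‖ := by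
  refine tsum_of_norm_bounded h.hasSum fun k => ?_
  rw [norm_mul, norm_pow]
  exact mul_le_of_le_one_right (norm_nonneg _) (pow_le_one₀ (norm_nonneg _) hz)

end PowerSeries

/-! ### Radial factors `∫₀¹ s^k (1 - s x)^α ds` for `-1 < α ≤ 0`. -/

section RimFactor

open MeasureTheory

variable {α : ℝ}

lemma intervalIntegrable_one_sub_rpow (hα : -1 < α) :
    IntervalIntegrable (fun s : ℝ => (1 - s) ^ α) volume 0 1 := by
  have := (intervalIntegral.intervalIntegrable_rpow' (a := 0) (b := 1) hα).comp_sub_left 1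
  simpa using this.symm

lemma integral_one_sub_rpow (hα : -1 < α) : ∫ s in (0:ℝ)..1, (1 - s) ^ α = 1 / (1 + α) := by
  rw [intervalIntegral.integral_comp_sub_left (fun s : ℝ => s ^ α) 1, sub_self, sub_zero,
    integral_rpow (Or.inl hα), Real.one_rpow, Real.zero_rpow (by linarith), sub_zero, add_comm]

lemma one_le_one_sub_mul_rpow (hα : α ≤ 0) {s x : ℝ} (hs : s ∈ Ico (0:ℝ) 1) (hx : x ∈ Icc (0:ℝ) 1) :
    1 ≤ (1 - s * x) ^ α :=
  Real.one_le_rpow_of_pos_of_le_one_of_nonpos (by nlinarith [hs.1, hs.2, hx.1, hx.2])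
    (by nlinarith [hs.1, hs.2, hx.1, hx.2]) hα

lemma one_sub_mul_rpow_le (hα : α ≤ 0) {s x : ℝ} (hs : s ∈ Ico (0:ℝ) 1) (hx : x ∈ Icc (0:ℝ) 1) :
    (1 - s * x) ^ α ≤ (1 - s) ^ α :=
  Real.rpow_le_rpow_of_nonpos (by linarith [hs.2]) (by nlinarith [hs.1, hs.2, hx.1, hx.2]) hα

/-- The radial factor `∫₀¹ s^k (1 - s x)^α ds`. -/
noncomputable def rimFactor (α : ℝ) (k : ℕ) (x : ℝ) : ℝ := ∫ s in (0:ℝ)..1, s ^ k * (1 - s * x) ^ α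

lemma intervalIntegrable_rimFactor (hα : -1 < α) (hα0 : α ≤ 0) (k : ℕ) {x : ℝ}
    (hx : x ∈ Icc (0:ℝ) 1) :
    IntervalIntegrable (fun s : ℝ => s ^ k * (1 - s * x) ^ α) volume 0 1 := by
  rw [intervalIntegrable_iff_integrableOn_Ioo_of_le zero_le_one]
  have h := intervalIntegrable_one_sub_rpow hα
  rw [intervalIntegrable_iff_integrableOn_Ioo_of_le zero_le_one] at h
  refine h.mono' (Measurable.aestronglyMeasurable (by fun_prop)) ?_
  refine (ae_restrict_iff' measurableSet_Ioo).2 (Eventually.of_forall fun s hs => ?_)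
  have hs' : s ∈ Ico (0:ℝ) 1 := Ioo_subset_Ico_self hs
  have h1 := one_le_one_sub_mul_rpow hα0 hs' hx
  have h2 := one_sub_mul_rpow_le hα0 hs' hx
  have h3 : s ^ k ≤ 1 := pow_le_one₀ hs.1.le hs.2.le
  have h4 : 0 ≤ s ^ k := pow_nonneg hs.1.le k
  rw [norm_mul, Real.norm_of_nonneg h4, Real.norm_of_nonneg (by linarith)]
  nlinarith

lemma one_div_le_rimFactor (hα : -1 < α) (hα0 : α ≤ 0) (k : ℕ) :
    1 / ((k : ℝ) + 1) ≤ rimFactor α k 1 := by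
  have e : ∫ s in (0:ℝ)..1, s ^ k = 1 / ((k : ℝ) + 1) := by simp [integral_pow]
  rw [← e]
  refine intervalIntegral.integral_mono_on_of_le_Ioo zero_le_one (by simp)
    (intervalIntegrable_rimFactor hα hα0 k (by simp)) fun s hs => ?_
  exact le_mul_of_one_le_right (pow_nonneg hs.1.le k)
    (one_le_one_sub_mul_rpow hα0 (Ioo_subset_Ico_self hs) (by simp))

/-- The excess over the value `1/(k+1)` at `α = 0` is at most `∫ ((1-s)^α - 1) = -α/(1+α)`, small
with `α` uniformly in `k`. -/
lemma rimFactor_le (hα : -1 < α) (hα0 : α ≤ 0) (k : ℕ) :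
    rimFactor α k 1 ≤ 1 / ((k : ℝ) + 1) + -α / (1 + α) := by
  have e : ∫ s in (0:ℝ)..1, s ^ k = 1 / ((k : ℝ) + 1) := by simp [integral_pow]
  have h1 : (∫ s in (0:ℝ)..1, s ^ k * (1 - s * 1) ^ α) - ∫ s in (0:ℝ)..1, s ^ k ≤
      (∫ s in (0:ℝ)..1, (1 - s) ^ α) - ∫ s in (0:ℝ)..1, (1:ℝ) := by
    have i1 := intervalIntegrable_rimFactor hα hα0 k (x := 1) (by simp)
    rw [← intervalIntegral.integral_sub i1 (by simp), ← intervalIntegral.integral_sub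
      (intervalIntegrable_one_sub_rpow hα) (by simp)]
    refine intervalIntegral.integral_mono_on_of_le_Ioo zero_le_one (i1.sub (by simp))
      ((intervalIntegrable_one_sub_rpow hα).sub (by simp)) fun s hs => ?_
    have h2 := one_le_one_sub_mul_rpow hα0 (Ioo_subset_Ico_self hs) (x := 1) (by simp)
    have h3 : s ^ k ≤ 1 := pow_le_one₀ hs.1.le hs.2.le
    rw [mul_one] at h2 ⊢
    nlinarith
  rw [integral_one_sub_rpow hα, e] at h1
  have e2 : 1 / (1 + α) - 1 = -α / (1 + α) := by
    have : 1 + α ≠ 0 := by linarith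
    field_simp; ring
  rw [intervalIntegral.integral_const, sub_zero, one_smul, e2] at h1
  rw [rimFactor]
  linarith

lemma hypCoeff_add_one_add_two (α : ℝ) (k n : ℕ) :
    hypCoeff (-α) ((k : ℝ) + 1) ((k : ℝ) + 2) n =
      ((k : ℝ) + 1) * (pochCoeff (-α) n * (1 / (((n + k : ℕ) : ℝ) + 1))) := by
  induction n with
  | zero =>
    rw [hypCoeff_zero, pochCoeff_zero]; push_cast
    have : (k : ℝ) + 1 ≠ 0 := by positivity
    field_simp; simp
  | succ n ih =>
    rw [hypCoeff_succ, pochCoeff_succ, ih]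
    push_cast
    field_simp
    ring

/-- Euler's integral for the radial function of index `k + 1` in the series form with `β = 0`,
obtained by expanding `(1 - s x)^α` and integrating termwise. -/
lemma rimFactor_eq_ordinaryHypergeometric (α : ℝ) (k : ℕ) {x : ℝ} (hx0 : 0 ≤ x) (hx : x < 1) :
    ((k : ℝ) + 1) * rimFactor α k x =
      ordinaryHypergeometric (-α) ((k : ℝ) + 1) ((k : ℝ) + 2) x := by
  have hx' : |x| < 1 := by rwa [abs_of_nonneg hx0]
  have hs := summable_pochCoeff_mul_pow (-α) hx'
  have key : HasSum (fun n : ℕ => ∫ s in (0:ℝ)..1, pochCoeff (-α) n * x ^ n * s ^ (n + k))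
      (∫ s in (0:ℝ)..1, s ^ k * (1 - s * x) ^ α) := by
    refine intervalIntegral.hasSum_integral_of_dominated_convergence
      (fun n _ => |pochCoeff (-α) n * x ^ n|) (fun n => (by fun_prop : Continuous _).aestronglyMeasurable)
      ?_ ?_ intervalIntegrable_const ?_
    · intro n
      refine Eventually.of_forall fun s hs => ?_
      rw [uIoc_of_le zero_le_one] at hs
      rw [norm_mul, norm_pow, Real.norm_eq_abs, Real.norm_of_nonneg hs.1.le]
      exact mul_le_of_le_one_right (abs_nonneg _) (pow_le_one₀ hs.1.le hs.2)
    · exact Eventually.of_forall fun s _ => hs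
    · refine Eventually.of_forall fun s hs => ?_
      rw [uIoc_of_le zero_le_one] at hs
      have hsx : |s * x| < 1 := by
        rw [abs_of_nonneg (mul_nonneg hs.1.le hx0)]; nlinarith [hs.1, hs.2]
      have := (hasSum_one_sub_rpow_neg (-α) hsx).mul_left (s ^ k)
      rw [neg_neg] at this
      refine this.congr_fun fun n => ?_
      rw [mul_pow, pow_add]; ring
  rw [ordinaryHypergeometric_eq_tsum_hypCoeff, rimFactor, ← key.tsum_eq, ← tsum_mul_left]
  refine tsum_congr fun n => ?_
  rw [intervalIntegral.integral_const_mul, integral_pow, hypCoeff_add_one_add_two]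
  simp
  ring

/-- The power series coefficients dual to the radial factors. -/
noncomputable def rimCoeff (α : ℝ) (a : ℕ → ℂ) (k : ℕ) : ℂ := a k / (rimFactor α k 1 : ℝ)

lemma rimFactor_one_pos (hα : -1 < α) (hα0 : α ≤ 0) (k : ℕ) : 0 < rimFactor α k 1 :=
  lt_of_lt_of_le (by positivity) (one_div_le_rimFactor hα hα0 k)

lemma norm_rimCoeff_le (hα : -1 < α) (hα0 : α ≤ 0) (a : ℕ → ℂ) (k : ℕ) :
    ‖rimCoeff α a k‖ ≤ ((k : ℝ) + 1) * ‖a k‖ := by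
  have h0 := rimFactor_one_pos hα hα0 k
  have h1 := one_div_le_rimFactor hα hα0 k
  rw [div_le_iff₀ (by positivity)] at h1
  rw [rimCoeff, norm_div, Complex.norm_real, Real.norm_of_nonneg h0.le, div_le_iff₀ h0]
  nlinarith [norm_nonneg (a k)]

/-- Compares the holomorphic factor of the deformed map with the derivative of the holomorphic part
at `α = 0`. The error is of order `|α|`, at the price of one more factor `k + 1`. -/
lemma norm_sub_rimCoeff_le (hα : -1 < α) (hα0 : α ≤ 0) (a : ℕ → ℂ) (k : ℕ) :
    ‖((k : ℂ) + 1) * a k - rimCoeff α a k‖ ≤ -α / (1 + α) * (((k : ℝ) + 1) ^ 2 * ‖a k‖) := by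
  have h0 := rimFactor_one_pos hα hα0 k
  have h1 := one_div_le_rimFactor hα hα0 k
  have h2 := rimFactor_le hα hα0 k
  have h0' : (rimFactor α k 1 : ℂ) ≠ 0 := by exact_mod_cast h0.ne'
  have hk : (0 : ℝ) < (k : ℝ) + 1 := by positivity
  have e : ((k : ℂ) + 1) * a k - rimCoeff α a k =
      (((((k : ℝ) + 1) * rimFactor α k 1 - 1 : ℝ) : ℂ)) * rimCoeff α a k := by
    rw [rimCoeff]; push_cast; field_simp
  rw [div_le_iff₀ hk] at h1
  have h3 : rimFactor α k 1 * ((k : ℝ) + 1) ≤ 1 + -α / (1 + α) * ((k : ℝ) + 1) := by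
    calc _ ≤ (1 / ((k : ℝ) + 1) + -α / (1 + α)) * ((k : ℝ) + 1) :=
          mul_le_mul_of_nonneg_right h2 hk.le
      _ = _ := by field_simp
  rw [e, norm_mul, Complex.norm_real, Real.norm_of_nonneg (by linarith)]
  calc _ ≤ (-α / (1 + α) * ((k : ℝ) + 1)) * (((k : ℝ) + 1) * ‖a k‖) :=
        mul_le_mul (by linarith) (norm_rimCoeff_le hα hα0 a k) (norm_nonneg _)
          (mul_nonneg (div_nonneg (by linarith) (by linarith)) hk.le)
    _ = _ := by ring

end RimFactor

/-! ### Boundary behaviour of the primitive and of its derivative. -/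

section BoundaryPrimitive

open MeasureTheory

variable {α : ℝ} {b : ℕ → ℂ} {z : ℂ}

lemma one_sub_mul_conj_cpow {s : ℝ} (hs : s ∈ Icc (0:ℝ) 1) (hz : ‖z‖ ≤ 1) (δ : ℝ) :
    (1 - (s : ℂ) * (z * conj z)) ^ (δ : ℂ) = (((1 - s * ‖z‖ ^ 2) ^ δ : ℝ) : ℂ) := by
  have h : 0 ≤ 1 - s * ‖z‖ ^ 2 := by nlinarith [hs.1, hs.2, norm_nonneg z, sq_nonneg ‖z‖]
  rw [Complex.ofReal_cpow h, Complex.mul_conj, Complex.normSq_eq_norm_sq]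
  push_cast; rfl

lemma norm_sq_mem_Icc (hz : ‖z‖ ≤ 1) : ‖z‖ ^ 2 ∈ Icc (0:ℝ) 1 :=
  ⟨sq_nonneg _, pow_le_one₀ (norm_nonneg _) hz⟩

lemma norm_smul_le_one {s : ℝ} (hs : s ∈ Icc (0:ℝ) 1) (hz : ‖z‖ ≤ 1) : ‖(s : ℂ) * z‖ ≤ 1 := by
  rw [norm_mul, Complex.norm_real, Real.norm_of_nonneg hs.1]
  nlinarith [norm_nonneg z, hs.2, hs.1]

/-- The primitive of a power series, up to the boundary, as a series. -/
lemma hasSum_diskPrimitive (hα : -1 < α) (hα0 : α ≤ 0) (hb : Summable fun k => ‖b k‖)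
    (hz : ‖z‖ ≤ 1) :
    HasSum (fun k : ℕ => b k * (rimFactor α k (‖z‖ ^ 2) : ℝ) * z ^ (k + 1))
      (diskPrimitive (fun w => ∑' k, b k * w ^ k) α z) := by
  have hx := norm_sq_mem_Icc hz
  have key : HasSum (fun k : ℕ => ∫ s in (0:ℝ)..1,
      b k * z ^ (k + 1) * ((s ^ k * (1 - s * ‖z‖ ^ 2) ^ α : ℝ) : ℂ))
      (diskPrimitive (fun w => ∑' k, b k * w ^ k) α z) := by
    have hne : ∀ᵐ s : ℝ, s ≠ 1 := by simp [ae_iff]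
    refine intervalIntegral.hasSum_integral_of_dominated_convergence
      (fun k s => ‖b k‖ * (1 - s) ^ α)
      (fun k => Measurable.aestronglyMeasurable (by fun_prop)) ?_ ?_ ?_ ?_
    · intro k
      filter_upwards [hne] with s hs1 hs
      rw [uIoc_of_le zero_le_one] at hs
      have hs' : s ∈ Ico (0:ℝ) 1 := ⟨hs.1.le, lt_of_le_of_ne hs.2 hs1⟩
      have h1 := one_le_one_sub_mul_rpow hα0 hs' hx
      have h2 := one_sub_mul_rpow_le hα0 hs' hx
      have h3 : s ^ k ≤ 1 := pow_le_one₀ hs.1.le hs.2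
      have h4 : 0 ≤ s ^ k := pow_nonneg hs.1.le k
      rw [norm_mul, norm_mul, norm_pow, Complex.norm_real,
        Real.norm_of_nonneg (mul_nonneg h4 (by linarith))]
      refine mul_le_mul (mul_le_of_le_one_right (norm_nonneg _)
        (pow_le_one₀ (norm_nonneg _) hz)) ?_ (mul_nonneg h4 (by linarith)) (norm_nonneg _)
      nlinarith
    · exact Eventually.of_forall fun s _ => hb.mul_right _
    · simp only [tsum_mul_right]
      exact (intervalIntegrable_one_sub_rpow hα).const_mul _
    · refine Eventually.of_forall fun s hs => ?_
      rw [uIoc_of_le zero_le_one] at hs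
      have hs' : s ∈ Icc (0:ℝ) 1 := Ioc_subset_Icc_self hs
      have h := ((summable_mul_pow_of_norm_le_one hb (norm_smul_le_one hs' hz)).hasSum.mul_left
        z).mul_right ((1 - (s : ℂ) * (z * conj z)) ^ (α : ℂ))
      refine h.congr_fun fun k => ?_
      rw [one_sub_mul_conj_cpow hs' hz]
      push_cast
      ring
  refine key.congr_fun fun k => ?_
  rw [intervalIntegral.integral_const_mul, intervalIntegral.integral_ofReal, rimFactor]
  ring

/-- For `-1 < α ≤ 0` the integrand is dominated by a multiple of `(1 - s)^α`, integrable uniformly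
up to the circle. -/
lemma continuousOn_diskPrimitive (hα : -1 < α) (hα0 : α ≤ 0) (hb : Summable fun k => ‖b k‖) :
    ContinuousOn (diskPrimitive (fun w => ∑' k, b k * w ^ k) α) (Metric.closedBall 0 1) := by
  have hcb := continuousOn_tsum_mul_pow hb
  have hIoo : volume.restrict (uIoc (0:ℝ) 1) = volume.restrict (Ioo 0 1) := by
    rw [uIoc_of_le zero_le_one]; exact Measure.restrict_congr_set Ioo_ae_eq_Ioc.symm
  have hne : ∀ᵐ s : ℝ, s ≠ 1 := by simp [ae_iff]
  have hslit : ∀ s ∈ Ioo (0:ℝ) 1, ∀ z : ℂ, ‖z‖ ≤ 1 →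
      1 - (s : ℂ) * (z * conj z) ∈ Complex.slitPlane := by
    intro s hs z hz
    left
    have h := norm_sq_mem_Icc hz
    rw [Complex.mul_conj, Complex.normSq_eq_norm_sq]
    have e : (1 - (s : ℂ) * ((‖z‖ ^ 2 : ℝ) : ℂ)) = ((1 - s * ‖z‖ ^ 2 : ℝ) : ℂ) := by
      push_cast; ring
    rw [e, Complex.ofReal_re]
    nlinarith [hs.1, hs.2, h.1, h.2]
  have hball : ∀ s ∈ Ioo (0:ℝ) 1, ∀ z : ℂ, ‖z‖ ≤ 1 → (s : ℂ) * z ∈ Metric.closedBall (0:ℂ) 1 :=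
    fun s hs z hz => by simpa using norm_smul_le_one (Ioo_subset_Icc_self hs) hz
  intro z₀ hz₀
  refine intervalIntegral.continuousWithinAt_of_dominated_interval
    (bound := fun s => (∑' k, ‖b k‖) * (1 - s) ^ α) ?_ ?_
    ((intervalIntegrable_one_sub_rpow hα).const_mul _) ?_
  · filter_upwards [self_mem_nhdsWithin] with z hz
    have hz' : ‖z‖ ≤ 1 := by simpa using hz
    rw [hIoo]
    refine ContinuousOn.aestronglyMeasurable ?_ measurableSet_Ioo
    refine (continuousOn_const.mul (hcb.comp (by fun_prop) fun s hs => hball s hs z hz')).mul ?_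
    exact ContinuousOn.cpow (by fun_prop) continuousOn_const fun s hs => hslit s hs z hz'
  · filter_upwards [self_mem_nhdsWithin] with z hz
    have hz' : ‖z‖ ≤ 1 := by simpa using hz
    filter_upwards [hne] with s hs1 hs
    rw [uIoc_of_le zero_le_one] at hs
    have hs' : s ∈ Ico (0:ℝ) 1 := ⟨hs.1.le, lt_of_le_of_ne hs.2 hs1⟩
    have h1 := one_le_one_sub_mul_rpow hα0 hs' (norm_sq_mem_Icc hz')
    have h2 := one_sub_mul_rpow_le hα0 hs' (norm_sq_mem_Icc hz')
    rw [one_sub_mul_conj_cpow (Ioc_subset_Icc_self hs) hz', norm_mul, norm_mul, Complex.norm_real,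
      Real.norm_of_nonneg (by linarith)]
    have h3 := norm_tsum_mul_pow_le hb (norm_smul_le_one (Ioc_subset_Icc_self hs) hz')
    have h4 := norm_nonneg (∑' k, b k * ((s : ℂ) * z) ^ k)
    refine mul_le_mul ?_ h2 (by linarith) (h4.trans h3)
    nlinarith
  · filter_upwards [hne] with s hs1 hs
    rw [uIoc_of_le zero_le_one] at hs
    have hs' : s ∈ Ioo (0:ℝ) 1 := ⟨hs.1, lt_of_le_of_ne hs.2 hs1⟩
    have hz₀' : ‖z₀‖ ≤ 1 := by simpa using hz₀
    refine (continuousWithinAt_id.mul ?_).mul ?_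
    · exact (hcb _ (hball s hs' z₀ hz₀')).comp (by fun_prop)
        fun z hz => hball s hs' z (by simpa using hz)
    · refine ContinuousWithinAt.cpow ?_ continuousWithinAt_const (hslit s hs' z₀ hz₀')
      exact Continuous.continuousWithinAt (by fun_prop)

/-- Termwise this is Bernoulli's inequality `1 - s^k ≤ k (1 - s)`. -/
lemma norm_tsum_sub_tsum_le (hb : Summable fun k : ℕ => ((k : ℝ) + 1) * ‖b k‖) {s : ℝ}
    (hs : s ∈ Icc (0:ℝ) 1) (hz : ‖z‖ ≤ 1) :
    ‖(∑' k : ℕ, b k * (s * z) ^ k) - ∑' k : ℕ, b k * z ^ k‖ ≤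
      (1 - s) * ∑' k : ℕ, ((k : ℝ) + 1) * ‖b k‖ := by
  have hb' : Summable fun k : ℕ => ‖b k‖ := hb.of_nonneg_of_le (fun k => norm_nonneg _) fun k => by
    have : (0 : ℝ) ≤ k := Nat.cast_nonneg k
    nlinarith [norm_nonneg (b k)]
  rw [← (summable_mul_pow_of_norm_le_one hb' (norm_smul_le_one hs hz)).tsum_sub
    (summable_mul_pow_of_norm_le_one hb' hz)]
  refine tsum_of_norm_bounded (hb.hasSum.mul_left (1 - s)) fun k => ?_
  have e : b k * (s * z) ^ k - b k * z ^ k = -(((1 - s ^ k : ℝ) : ℂ) * (b k * z ^ k)) := by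
    rw [mul_pow]; push_cast; ring
  have h1 : s ^ k ≤ 1 := pow_le_one₀ hs.1 hs.2
  have h2 : 1 - s ^ k ≤ k * (1 - s) := by
    have := one_add_mul_le_pow (a := s - 1) (by linarith [hs.1]) k
    rw [add_sub_cancel] at this
    linarith
  have h3 : ‖z‖ ^ k ≤ 1 := pow_le_one₀ (norm_nonneg _) hz
  rw [e, norm_neg, norm_mul, Complex.norm_real, Real.norm_of_nonneg (by linarith), norm_mul,
    norm_pow]
  calc (1 - s ^ k) * (‖b k‖ * ‖z‖ ^ k) ≤ ((k : ℝ) * (1 - s)) * (‖b k‖ * 1) := by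
        refine mul_le_mul h2 (by gcongr) (by positivity) ?_
        exact mul_nonneg (Nat.cast_nonneg k) (by linarith [hs.2])
    _ ≤ _ := by nlinarith [norm_nonneg (b k), hs.2, mul_nonneg (sub_nonneg.2 hs.2) (norm_nonneg (b k))]

/-- The bound on the `z̄`-derivative of the primitive. -/
lemma norm_dzbar_diskPrimitive_le (hα : -1 < α) (hα0 : α ≤ 0)
    (hb : Summable fun k : ℕ => ((k : ℝ) + 1) * ‖b k‖) (hz : ‖z‖ < 1) :
    ‖-(α : ℂ) * diskPrimitive (fun ζ => ζ * ∑' k, b k * ζ ^ k) ((α : ℂ) - 1) z‖ ≤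
      ((1 - ‖z‖ ^ 2) ^ α - 1) * ‖∑' k : ℕ, b k * z ^ k‖ +
        -α / (1 + α) * ∑' k : ℕ, ((k : ℝ) + 1) * ‖b k‖ := by
  set L := ∑' k : ℕ, ((k : ℝ) + 1) * ‖b k‖ with hL
  set x := ‖z‖ ^ 2 with hx
  have hL0 : 0 ≤ L := tsum_nonneg fun k => by positivity
  have hxI := norm_sq_mem_Icc hz.le
  have hx1 : x < 1 := by rw [hx]; nlinarith [norm_nonneg z]
  have hpos : ∀ s ∈ Icc (0:ℝ) 1, 0 < 1 - s * x := fun s hs => by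
    nlinarith [hs.1, hs.2, hxI.1]
  set h₀ := ‖∑' k : ℕ, b k * z ^ k‖ with hh₀
  have hder : ∀ s ∈ uIcc (0:ℝ) 1, HasDerivAt (fun s : ℝ => (1 - s * x) ^ α)
      (-α * (x * (1 - s * x) ^ (α - 1))) s := by
    intro s hs
    rw [uIcc_of_le zero_le_one] at hs
    have h1 : HasDerivAt (fun s : ℝ => 1 - s * x) (-x) s := by
      simpa using ((hasDerivAt_id s).mul_const x).const_sub 1
    refine (h1.rpow_const (Or.inl (hpos s hs).ne')).congr_deriv ?_
    ring
  have hcont : ContinuousOn (fun s : ℝ => -α * (x * (1 - s * x) ^ (α - 1))) (uIcc (0:ℝ) 1) := by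
    rw [uIcc_of_le zero_le_one]
    refine continuousOn_const.mul (continuousOn_const.mul (ContinuousOn.rpow_const (by fun_prop) ?_))
    exact fun s hs => Or.inl (hpos s hs).ne'
  have hint := intervalIntegral.integral_eq_sub_of_hasDerivAt hder hcont.intervalIntegrable
  rw [zero_mul, sub_zero, Real.one_rpow, one_mul] at hint
  rw [diskPrimitive, ← intervalIntegral.integral_const_mul]
  -- The series at `s z` is replaced by its value at `z`. The main term is then an exact derivative
  -- in `s`, and the error gains a factor `1 - s`, which lowers the singularity from exponent `α -
  -- 1` to the integrable `α`.
  have hbound := intervalIntegral.norm_integral_le_of_norm_le (μ := volume) (a := 0) (b := 1)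
    (f := fun s : ℝ => -(α : ℂ) * (z * (s * z * ∑' k, b k * (s * z) ^ k) *
      (1 - s * (z * conj z)) ^ ((α : ℂ) - 1)))
    (g := fun s : ℝ => -α * (x * (1 - s * x) ^ (α - 1)) * h₀ + -α * L * (1 - s) ^ α)
    zero_le_one ?_ ?_
  · refine hbound.trans (le_of_eq ?_)
    rw [intervalIntegral.integral_add (hcont.intervalIntegrable.mul_const _)
      ((intervalIntegrable_one_sub_rpow hα).const_mul _), intervalIntegral.integral_mul_const,
      hint, intervalIntegral.integral_const_mul, integral_one_sub_rpow hα]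
    ring
  · have hne : ∀ᵐ s : ℝ, s ≠ 1 := by simp [ae_iff]
    filter_upwards [hne] with s hs1 hs
    have hs' : s ∈ Icc (0:ℝ) 1 := Ioc_subset_Icc_self hs
    have hs'' : s ∈ Ico (0:ℝ) 1 := ⟨hs.1.le, lt_of_le_of_ne hs.2 hs1⟩
    have e : ((α : ℂ) - 1) = ((α - 1 : ℝ) : ℂ) := by push_cast; ring
    have hp := hpos s hs'
    have hr : 0 < (1 - s * x) ^ (α - 1) := Real.rpow_pos_of_pos hp _
    rw [e, one_sub_mul_conj_cpow hs' hz.le, norm_mul, norm_mul, norm_mul, norm_mul, norm_neg,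
      norm_mul, Complex.norm_real, Complex.norm_real, Complex.norm_real, Real.norm_of_nonneg hr.le,
      Real.norm_of_nonneg hs.1.le, Real.norm_eq_abs, abs_of_nonpos hα0]
    have h1 := norm_tsum_sub_tsum_le hb hs' hz.le
    have h2 := norm_le_norm_add_norm_sub' (∑' k : ℕ, b k * (s * z) ^ k) (∑' k : ℕ, b k * z ^ k)
    rw [← hh₀] at h2
    rw [← hL] at h1
    have h3 : ‖∑' k : ℕ, b k * (s * z) ^ k‖ ≤ h₀ + (1 - s) * L := by linarith
    have h4 : (1 - s) * (1 - s * x) ^ (α - 1) ≤ (1 - s) ^ α := by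
      refine le_trans ?_ (one_sub_mul_rpow_le hα0 hs'' hxI)
      rw [Real.rpow_sub_one hp.ne', mul_div_assoc', div_le_iff₀ hp, mul_comm]
      exact mul_le_mul_of_nonneg_left (by nlinarith [hs.1, hxI.2]) (Real.rpow_nonneg hp.le _)
    have h5 : ‖z‖ * (s * ‖z‖ * ‖∑' k : ℕ, b k * (s * z) ^ k‖) ≤ x * h₀ + (1 - s) * L := by
      have h6 : ‖z‖ * (s * ‖z‖ * ‖∑' k : ℕ, b k * (s * z) ^ k‖) =
          s * (x * ‖∑' k : ℕ, b k * (s * z) ^ k‖) := by rw [hx]; ring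
      rw [h6]
      have h7 : x * ‖∑' k : ℕ, b k * (s * z) ^ k‖ ≤ x * (h₀ + (1 - s) * L) :=
        mul_le_mul_of_nonneg_left h3 hxI.1
      have h8 : 0 ≤ (1 - s) * L := mul_nonneg (by linarith [hs.2]) hL0
      have h9 : 0 ≤ x * ‖∑' k : ℕ, b k * (s * z) ^ k‖ := mul_nonneg hxI.1 (norm_nonneg _)
      nlinarith [hs.2, hxI.2]
    calc -α * (‖z‖ * (s * ‖z‖ * ‖∑' k : ℕ, b k * (s * z) ^ k‖) * (1 - s * x) ^ (α - 1))
        ≤ -α * ((x * h₀ + (1 - s) * L) * (1 - s * x) ^ (α - 1)) := by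
          have := mul_le_mul_of_nonneg_right h5 hr.le
          exact mul_le_mul_of_nonneg_left this (by linarith)
      _ = -α * (x * (1 - s * x) ^ (α - 1)) * h₀ +
          -α * L * ((1 - s) * (1 - s * x) ^ (α - 1)) := by ring
      _ ≤ _ := by
          have := mul_le_mul_of_nonneg_left h4 (mul_nonneg (neg_nonneg.2 hα0) hL0)
          linarith
  · exact (hcont.intervalIntegrable.mul_const _).add
      ((intervalIntegrable_one_sub_rpow hα).const_mul _)

end BoundaryPrimitive

/-! ### Deforming a harmonic map to `(α, 0)`-harmonic maps with the same boundary values. -/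

section DiskMapConstruction

/-- The coefficients of the map constructed from `∑ aₖ z^(k+1)` and the conjugate of
`∑ dₖ z^(k+1)`. -/
noncomputable def diskMapCoeff (α : ℝ) (a d : ℕ → ℂ) : ℤ → ℂ
  | Int.ofNat 0 => 0
  | Int.ofNat (k + 1) => rimCoeff α a k / (k + 1)
  | Int.negSucc k => conj (d k)

/-- An `(α,0)`-harmonic map whose boundary values are those of `∑ aₖ z^(k+1)` plus the conjugate of
`∑ dₖ z^(k+1)`. -/
noncomputable def diskMap (α : ℝ) (a d : ℕ → ℂ) (z : ℂ) : ℂ :=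
  diskPrimitive (fun w => ∑' k, rimCoeff α a k * w ^ k) α z + conj (∑' k, d k * z ^ (k + 1))

variable {α : ℝ} {a d : ℕ → ℂ}

lemma summable_mul_norm_of_summable_sq_mul
    (ha : Summable fun k : ℕ => ((k : ℝ) + 1) ^ 2 * ‖a k‖) :
    Summable fun k : ℕ => ((k : ℝ) + 1) * ‖a k‖ :=
  ha.of_nonneg_of_le (fun k => by positivity) fun k => by
    have : (1 : ℝ) ≤ (k : ℝ) + 1 := by linarith [Nat.cast_nonneg (α := ℝ) k]
    nlinarith [mul_nonneg (by linarith : (0:ℝ) ≤ (k : ℝ) + 1) (norm_nonneg (a k))]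

lemma mul_norm_rimCoeff_le (hα : -1 < α) (hα0 : α ≤ 0) (a : ℕ → ℂ) (k : ℕ) :
    ((k : ℝ) + 1) * ‖rimCoeff α a k‖ ≤ ((k : ℝ) + 1) ^ 2 * ‖a k‖ := by
  have := mul_le_mul_of_nonneg_left (norm_rimCoeff_le hα hα0 a k) (show (0:ℝ) ≤ (k : ℝ) + 1 by positivity)
  linarith

lemma summable_mul_norm_rimCoeff (hα : -1 < α) (hα0 : α ≤ 0)
    (ha : Summable fun k : ℕ => ((k : ℝ) + 1) ^ 2 * ‖a k‖) :
    Summable fun k : ℕ => ((k : ℝ) + 1) * ‖rimCoeff α a k‖ :=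
  ha.of_nonneg_of_le (fun _ => by positivity) (mul_norm_rimCoeff_le hα hα0 a)

lemma summable_norm_rimCoeff (hα : -1 < α) (hα0 : α ≤ 0)
    (ha : Summable fun k : ℕ => ((k : ℝ) + 1) ^ 2 * ‖a k‖) :
    Summable fun k : ℕ => ‖rimCoeff α a k‖ :=
  (summable_mul_norm_of_summable_sq_mul ha).of_nonneg_of_le (fun _ => norm_nonneg _)
    (norm_rimCoeff_le hα hα0 a)

lemma hasDerivAt_tsum_mul_pow_succ_one (hd : Summable fun k : ℕ => ((k : ℝ) + 1) * ‖d k‖) {z : ℂ}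
    (hz : z ∈ unitDisk) :
    HasDerivAt (fun z => ∑' k : ℕ, d k * z ^ (k + 1)) (∑' k : ℕ, ((k : ℂ) + 1) * d k * z ^ k) z :=
  hasDerivAt_tsum_mul_pow_succ one_pos (by simpa using hd) (mem_unitDisk.1 hz)

lemma hasWirtingerAt_diskMap (hα : -1 < α) (hα0 : α ≤ 0)
    (ha : Summable fun k : ℕ => ((k : ℝ) + 1) ^ 2 * ‖a k‖)
    (hd : Summable fun k : ℕ => ((k : ℝ) + 1) * ‖d k‖) {z : ℂ} (hz : z ∈ unitDisk) :
    HasWirtingerAt (diskMap α a d)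
      ((∑' k, rimCoeff α a k * z ^ k) * (1 - z * conj z) ^ (α : ℂ))
      (-(α : ℂ) * diskPrimitive (fun ζ => ζ * ∑' k, rimCoeff α a k * ζ ^ k) ((α : ℂ) - 1) z +
        conj (∑' k : ℕ, ((k : ℂ) + 1) * d k * z ^ k)) z := by
  have h1 := hasWirtingerAt_diskPrimitive (γ := α)
    (differentiableOn_tsum_mul_pow (summable_mul_norm_rimCoeff hα hα0 ha)) hz
  have h2 := (hasDerivAt_tsum_mul_pow_succ_one hd hz).hasWirtingerAt.conj
  exact (h1.add h2).congr (by simp) (by simp)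

lemma isABHarmonic_diskMap (hα : -1 < α) (hα0 : α ≤ 0)
    (ha : Summable fun k : ℕ => ((k : ℝ) + 1) ^ 2 * ‖a k‖)
    (hd : Summable fun k : ℕ => ((k : ℝ) + 1) * ‖d k‖) : IsABHarmonic α 0 (diskMap α a d) := by
  have hH := differentiableOn_tsum_mul_pow (summable_mul_norm_rimCoeff hα hα0 ha)
  have hW := fun z (hz : z ∈ unitDisk) => hasWirtingerAt_diskMap hα hα0 ha hd hz
  have hg : DifferentiableOn ℂ (fun z => ∑' k : ℕ, d k * z ^ (k + 1)) unitDisk := fun z hz =>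
    (hasDerivAt_tsum_mul_pow_succ_one hd hz).differentiableAt.differentiableWithinAt
  refine ⟨?_, fun z hz => ?_⟩
  · refine (contDiffOn_diskPrimitive 2 hH).add ?_
    exact Complex.conjCLE.contDiff.comp_contDiffOn
      (ContDiffOn.restrict_scalars ℝ (hg.contDiffOn isOpen_unitDisk))
  · have hdz := (hW z hz).dz
    have hdd : wirtingerDz (wirtingerDzbar (diskMap α a d)) z =
        -(α : ℂ) * (z * (∑' k, rimCoeff α a k * z ^ k) * (1 - z * conj z) ^ ((α : ℂ) - 1)) := by
      have h1 := hasWirtingerAt_diskPrimitive (γ := (α : ℂ) - 1) (differentiableOn_id.mul hH) hz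
      have hg' : DifferentiableOn ℂ (deriv fun z => ∑' k : ℕ, d k * z ^ (k + 1)) unitDisk :=
        hg.deriv isOpen_unitDisk
      have h2 := (hg'.differentiableAt (isOpen_unitDisk.mem_nhds hz)).hasDerivAt.hasWirtingerAt.conj
      have h3 := (((hasDerivAt_id (diskPrimitive
        (fun ζ => ζ * ∑' k, rimCoeff α a k * ζ ^ k) ((α : ℂ) - 1) z)).const_mul
          (-(α : ℂ))))
      have h4 := (HasWirtingerAt.comp h3 h1).add h2
      have h5 := h4.congr_of_eventuallyEq (g := wirtingerDzbar (diskMap α a d)) (by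
        filter_upwards [isOpen_unitDisk.mem_nhds hz] with w hw
        rw [(hW w hw).dzbar, (hasDerivAt_tsum_mul_pow_succ_one hd hw).deriv]
        rfl)
      rw [h5.dz]
      simp
    have e1 : (1 - (‖z‖ : ℂ) ^ 2) = 1 - z * conj z := by
      rw [Complex.mul_conj, Complex.normSq_eq_norm_sq]; push_cast; rfl
    have hne : (1 - z * conj z) ≠ 0 := by
      have := Complex.slitPlane_ne_zero (one_sub_mul_mem_slitPlane (s := 1) (by simp) hz)
      simpa using this
    rw [opL, hdd, hdz, e1, Complex.cpow_sub _ _ hne, Complex.cpow_one]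
    field_simp
    push_cast
    ring

/-- The main estimate: the constructed map is sense-preserving for small `α`. -/
lemma isSensePreserving_diskMap (hα : -1 / 2 ≤ α) (hα0 : α ≤ 0)
    (ha : Summable fun k : ℕ => ((k : ℝ) + 1) ^ 2 * ‖a k‖)
    (hd : Summable fun k : ℕ => ((k : ℝ) + 1) * ‖d k‖) {δ : ℝ}
    (hδ : -4 * α * (∑' k : ℕ, ((k : ℝ) + 1) ^ 2 * ‖a k‖) < δ)
    (had : ∀ z : ℂ, ‖z‖ ≤ 1 → ‖∑' k : ℕ, ((k : ℂ) + 1) * d k * z ^ k‖ + δ ≤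
      ‖∑' k : ℕ, ((k : ℂ) + 1) * a k * z ^ k‖) : IsSensePreserving (diskMap α a d) := by
  intro z hz
  have hα1 : -1 < α := by linarith
  have hz1 := mem_unitDisk.1 hz
  have hW := hasWirtingerAt_diskMap hα1 hα0 ha hd hz
  rw [hW.dz, hW.dzbar]
  have hsum := summable_mul_norm_rimCoeff hα1 hα0 ha
  set L := ∑' k : ℕ, ((k : ℝ) + 1) ^ 2 * ‖a k‖ with hL
  have hL0 : 0 ≤ L := tsum_nonneg fun k => by positivity
  have hL' : ∑' k : ℕ, ((k : ℝ) + 1) * ‖rimCoeff α a k‖ ≤ L :=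
    hsum.tsum_le_tsum (mul_norm_rimCoeff_le hα1 hα0 a) ha
  have hq : -α / (1 + α) ≤ -2 * α := by
    rw [div_le_iff₀ (by linarith)]; nlinarith
  have hq0 : 0 ≤ -α / (1 + α) := div_nonneg (by linarith) (by linarith)
  have h1 := norm_dzbar_diskPrimitive_le hα1 hα0 hsum hz1
  set h := ∑' k : ℕ, rimCoeff α a k * z ^ k with hh
  have h2 : ‖(∑' k : ℕ, ((k : ℂ) + 1) * a k * z ^ k) - h‖ ≤ -2 * α * L := by
    have hs1 : Summable fun k : ℕ => ‖((k : ℂ) + 1) * a k‖ := by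
      refine (summable_mul_norm_of_summable_sq_mul ha).congr fun k => ?_
      rw [norm_mul, ← Nat.cast_add_one (R := ℂ), Complex.norm_natCast]; push_cast; ring
    rw [hh, ← (summable_mul_pow_of_norm_le_one hs1 hz1.le).tsum_sub
      (summable_mul_pow_of_norm_le_one (summable_norm_rimCoeff hα1 hα0 ha) hz1.le)]
    refine le_trans ?_ (mul_le_mul_of_nonneg_right hq hL0)
    refine tsum_of_norm_bounded (ha.hasSum.mul_left _) fun k => ?_
    rw [← sub_mul, norm_mul, norm_pow]
    exact (mul_le_of_le_one_right (norm_nonneg _) (pow_le_one₀ (norm_nonneg _) hz1.le)).trans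
      (norm_sub_rimCoeff_le hα1 hα0 a k)
  have h3 := norm_sub_norm_le (∑' k : ℕ, ((k : ℂ) + 1) * a k * z ^ k) h
  have h4 := had z hz1.le
  have e : (1 - z * conj z) ^ (α : ℂ) = (((1 - ‖z‖ ^ 2) ^ α : ℝ) : ℂ) := by
    have := one_sub_mul_conj_cpow (s := 1) (by simp) hz1.le α
    simpa using this
  have hp : 0 ≤ (1 - ‖z‖ ^ 2) ^ α := Real.rpow_nonneg (by nlinarith [norm_nonneg z]) _
  rw [e, norm_mul, Complex.norm_real, Real.norm_of_nonneg hp]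
  refine (norm_add_le _ _).trans_lt ?_
  rw [RCLike.norm_conj]
  -- The unbounded terms cancel: `|u_z|` is `(1-|z|²)^α |h|`, and the primitive contributes at most
  -- `((1-|z|²)^α - 1) |h|` to `|u_z̄|`, up to `-2αL`. Replacing `|h|` by its value at `α = 0` costs
  -- another `-2αL`, and the total is below `δ`.
  have h5 : -α / (1 + α) * ∑' k : ℕ, ((k : ℝ) + 1) * ‖rimCoeff α a k‖ ≤ -2 * α * L :=
    mul_le_mul hq hL' (tsum_nonneg fun k => by positivity) (by linarith)
  nlinarith

lemma continuousOn_diskMap (hα : -1 < α) (hα0 : α ≤ 0)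
    (ha : Summable fun k : ℕ => ((k : ℝ) + 1) ^ 2 * ‖a k‖) (hd : Summable fun k : ℕ => ‖d k‖) :
    ContinuousOn (diskMap α a d) (Metric.closedBall 0 1) := by
  refine (continuousOn_diskPrimitive hα hα0 (summable_norm_rimCoeff hα hα0 ha)).add ?_
  refine Complex.continuous_conj.comp_continuousOn ?_
  refine continuousOn_tsum (fun k => by fun_prop) hd fun k z hz => ?_
  rw [norm_mul, norm_pow]
  exact mul_le_of_le_one_right (norm_nonneg _) (pow_le_one₀ (norm_nonneg _) (by simpa using hz))

lemma diskMap_of_norm_eq_one (hα : -1 < α) (hα0 : α ≤ 0)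
    (ha : Summable fun k : ℕ => ((k : ℝ) + 1) ^ 2 * ‖a k‖) {z : ℂ} (hz : ‖z‖ = 1) :
    diskMap α a d z = (∑' k, a k * z ^ (k + 1)) + conj (∑' k, d k * z ^ (k + 1)) := by
  rw [diskMap, ← (hasSum_diskPrimitive hα hα0 (summable_norm_rimCoeff hα hα0 ha) hz.le).tsum_eq]
  congr 1
  refine tsum_congr fun k => ?_
  have : (rimFactor α k 1 : ℂ) ≠ 0 := by exact_mod_cast (rimFactor_one_pos hα hα0 k).ne'
  rw [hz, one_pow, rimCoeff, div_mul_cancel₀ _ this]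

lemma ordinaryHypergeometric_zero_left (b c x : ℝ) : ordinaryHypergeometric 0 b c x = 1 := by
  have h : ∀ n, n ≠ 0 → hypCoeff 0 b c n * x ^ n = 0 := by
    intro n hn
    obtain ⟨m, rfl⟩ := Nat.exists_eq_succ_of_ne_zero hn
    have : hypCoeff 0 b c (m + 1) = 0 := by
      clear hn
      induction m with
      | zero => rw [hypCoeff_succ]; simp
      | succ m ih => rw [hypCoeff_succ, ih, zero_mul]
    rw [Nat.succ_eq_add_one, this, zero_mul]
  rw [ordinaryHypergeometric_eq_tsum_hypCoeff, tsum_eq_single 0 h, hypCoeff_zero]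
  simp

lemma hasSeriesForm_diskMap (hα : -1 < α) (hα0 : α ≤ 0)
    (ha : Summable fun k : ℕ => ((k : ℝ) + 1) ^ 2 * ‖a k‖) (hd : Summable fun k : ℕ => ‖d k‖) :
    HasSeriesForm α 0 (diskMap α a d) (diskMapCoeff α a d) := by
  have hr := summable_norm_rimCoeff hα hα0 ha
  constructor
  · have hs : Summable fun k : ℤ => ‖diskMapCoeff α a d k‖ := by
      refine Summable.of_nat_of_neg_add_one ?_ ?_
      · rw [← summable_nat_add_iff 1]
        refine hr.of_nonneg_of_le (fun k => norm_nonneg _) fun k => ?_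
        change ‖rimCoeff α a k / ((k : ℂ) + 1)‖ ≤ _
        rw [norm_div, ← Nat.cast_add_one, Complex.norm_natCast]
        exact div_le_self (norm_nonneg _) (by push_cast; linarith [Nat.cast_nonneg (α := ℝ) k])
      · refine hd.congr fun k => ?_
        rw [← Int.negSucc_eq]
        exact (RCLike.norm_conj _).symm
    refine limsup_le_of_le (by isBoundedDefault) ?_
    filter_upwards [hs.tendsto_cofinite_zero.eventually (gt_mem_nhds one_pos)] with k hk
    refine ENNReal.rpow_le_one ?_ (by positivity)
    rw [← ofReal_norm]
    exact ENNReal.ofReal_le_one.2 hk.le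
  · intro z hz
    have hz1 := mem_unitDisk.1 hz
    have hx0 : 0 ≤ ‖z‖ ^ 2 := sq_nonneg _
    have hx1 : ‖z‖ ^ 2 < 1 := by nlinarith [norm_nonneg z]
    have hpos : ∀ k : ℕ, seriesTermPos α 0 (diskMapCoeff α a d) z (k + 1) =
        rimCoeff α a k * (rimFactor α k (‖z‖ ^ 2) : ℝ) * z ^ (k + 1) := by
      intro k
      have e := rimFactor_eq_ordinaryHypergeometric α k hx0 hx1
      have hc : diskMapCoeff α a d ((k + 1 : ℕ) : ℤ) = rimCoeff α a k / (k + 1) := rfl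
      rw [seriesTermPos, hc, sub_zero]
      rw [show (((k + 1 : ℕ) : ℝ)) = (k : ℝ) + 1 by push_cast; rfl,
        show (k : ℝ) + 1 + 1 = k + 2 by ring, ← e]
      have : (k : ℂ) + 1 ≠ 0 := Nat.cast_add_one_ne_zero k
      push_cast
      field_simp
    have hneg : ∀ k : ℕ, seriesTermNeg α 0 (diskMapCoeff α a d) z (k + 1) =
        conj (d k * z ^ (k + 1)) := by
      intro k
      have hc : diskMapCoeff α a d (-((k + 1 : ℕ) : ℤ)) = conj (d k) := by
        rw [show -((k + 1 : ℕ) : ℤ) = Int.negSucc k from rfl]; rfl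
      rw [seriesTermNeg, hc, neg_zero, ordinaryHypergeometric_zero_left]
      simp
    have hS := hasSum_diskPrimitive hα hα0 hr hz1.le
    have hD : HasSum (fun k : ℕ => conj (d k * z ^ (k + 1))) (conj (∑' k, d k * z ^ (k + 1))) := by
      refine Complex.hasSum_conj'.2 (Summable.hasSum (.of_norm_bounded hd fun k => ?_))
      rw [norm_mul, norm_pow]
      exact mul_le_of_le_one_right (norm_nonneg _) (pow_le_one₀ (norm_nonneg _) hz1.le)
    have hP : HasSum (fun k : ℕ => seriesTermPos α 0 (diskMapCoeff α a d) z k)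
        (diskPrimitive (fun w => ∑' k, rimCoeff α a k * w ^ k) α z) := by
      rw [← hasSum_nat_add_iff' 1]
      have h0 : seriesTermPos α 0 (diskMapCoeff α a d) z 0 = 0 := by
        have hc : diskMapCoeff α a d ((0 : ℕ) : ℤ) = 0 := rfl
        rw [seriesTermPos, hc]; simp
      simpa [h0, hpos] using hS
    have hN : HasSum (fun k : ℕ => seriesTermNeg α 0 (diskMapCoeff α a d) z (k + 1))
        (conj (∑' k, d k * z ^ (k + 1))) := by simpa only [hneg] using hD
    exact ⟨hP.summable, hN.summable, by rw [hP.tsum_eq, hN.tsum_eq]; rfl⟩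

/-- For `β = 0` the Gamma quotient is `1`, and `c_1 = (1 + α) a_0` because the first radial factor
at the rim is `1/(1+α)`. Hence the deformation leaves the quantity unchanged. -/
lemma heinzQuantity_diskMapCoeff (hα : -1 < α) (a d : ℕ → ℂ) :
    heinzQuantity α 0 (diskMapCoeff α a d) = ‖a 0‖ ^ 2 + ‖d 0‖ ^ 2 := by
  have h1 : diskMapCoeff α a d 1 = rimCoeff α a 0 / ((0 : ℕ) + 1) := rfl
  have h2 : diskMapCoeff α a d 0 = 0 := rfl
  have h3 : diskMapCoeff α a d (-1) = conj (d 0) := rfl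
  have h4 : rimFactor α 0 1 = 1 / (1 + α) := by
    rw [rimFactor, ← integral_one_sub_rpow hα]; simp
  have h5 : 1 + α ≠ 0 := by linarith
  have h6 : Real.Gamma (1 + α) ≠ 0 := (Real.Gamma_pos_of_pos (by linarith)).ne'
  have h7 : ‖rimCoeff α a 0‖ = ‖a 0‖ * (1 + α) := by
    rw [rimCoeff, h4, norm_div, Complex.norm_real, Real.norm_of_nonneg
      (one_div_nonneg.2 (by linarith))]
    field_simp
  rw [heinzQuantity, h1, h2, h3, RCLike.norm_conj]
  simp only [Nat.cast_zero, zero_add, div_one, h7, add_zero, Real.Gamma_one, mul_one, div_self h6,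
    norm_zero]
  field_simp
  ring

/-- A sense-preserving harmonic map with unimodular boundary values can be deformed to
`(α,0)`-harmonic maps of the disk onto itself for all small `α ≤ 0`. -/
theorem eventually_exists_isABHarmonicDiskMap
    (ha : Summable fun k : ℕ => ((k : ℝ) + 1) ^ 2 * ‖a k‖)
    (hd : Summable fun k : ℕ => ((k : ℝ) + 1) * ‖d k‖)
    (hb : ∀ z : ℂ, ‖z‖ = 1 → ‖(∑' k, a k * z ^ (k + 1)) + conj (∑' k, d k * z ^ (k + 1))‖ = 1)
    (hJ : ∀ z : ℂ, ‖z‖ ≤ 1 → ‖∑' k : ℕ, ((k : ℂ) + 1) * d k * z ^ k‖ <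
      ‖∑' k : ℕ, ((k : ℂ) + 1) * a k * z ^ k‖) :
    ∀ᶠ α in 𝓝[≤] (0 : ℝ), ∃ (u : ℂ → ℂ) (c : ℤ → ℂ), IsABHarmonicDiskMap α 0 u c ∧
      heinzQuantity α 0 c = ‖a 0‖ ^ 2 + ‖d 0‖ ^ 2 := by
  have hnorm : ∀ (e : ℕ → ℂ) (k : ℕ), ‖((k : ℂ) + 1) * e k‖ = ((k : ℝ) + 1) * ‖e k‖ := by
    intro e k
    rw [norm_mul, ← Nat.cast_add_one, Complex.norm_natCast]; push_cast; ring
  have hd0 : Summable fun k : ℕ => ‖d k‖ := hd.of_nonneg_of_le (fun k => norm_nonneg _) fun k => by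
    have : (0 : ℝ) ≤ k := Nat.cast_nonneg k
    nlinarith [norm_nonneg (d k)]
  -- Compactness of the closed disk turns strict positivity of the Jacobian into a uniform gap that
  -- absorbs the error of order `|α|`.
  obtain ⟨δ, hδ, had⟩ : ∃ δ > 0, ∀ z : ℂ, ‖z‖ ≤ 1 → ‖∑' k : ℕ, ((k : ℂ) + 1) * d k * z ^ k‖ + δ ≤
      ‖∑' k : ℕ, ((k : ℂ) + 1) * a k * z ^ k‖ := by
    have hc1 := continuousOn_tsum_mul_pow (b := fun k : ℕ => ((k : ℂ) + 1) * a k)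
      (by simpa only [hnorm] using summable_mul_norm_of_summable_sq_mul ha)
    have hc2 := continuousOn_tsum_mul_pow (b := fun k : ℕ => ((k : ℂ) + 1) * d k)
      (by simpa only [hnorm] using hd)
    obtain ⟨z₀, hz₀, hmin⟩ := (isCompact_closedBall (0 : ℂ) 1).exists_isMinOn
      ⟨0, Metric.mem_closedBall_self zero_le_one⟩ (hc1.norm.sub hc2.norm)
    refine ⟨_, sub_pos.2 (hJ z₀ (by simpa using hz₀)), fun z hz => ?_⟩
    have := hmin (show z ∈ Metric.closedBall (0 : ℂ) 1 by simpa using hz)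
    simp only [mem_ofPred_eq, Pi.sub_apply] at this
    linarith
  have hev : ∀ᶠ α in 𝓝[≤] (0 : ℝ), -4 * α * (∑' k : ℕ, ((k : ℝ) + 1) ^ 2 * ‖a k‖) < δ := by
    have hc : ContinuousAt (fun α : ℝ => -4 * α * (∑' k : ℕ, ((k : ℝ) + 1) ^ 2 * ‖a k‖)) 0 := by
      fun_prop
    refine nhdsWithin_le_nhds (hc.eventually_lt_const ?_)
    simpa using hδ
  filter_upwards [hev, self_mem_nhdsWithin, nhdsWithin_le_nhds
    (lt_mem_nhds (show (-1 / 2 : ℝ) < 0 by norm_num))] with α h1 h2 h3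
  have hα0 : α ≤ 0 := h2
  have hα : -1 < α := by linarith
  have hharm := isABHarmonic_diskMap hα hα0 ha hd
  have hsp := isSensePreserving_diskMap h3.le hα0 ha hd h1 had
  have hbij := injOn_and_image_eq_of_sensePreserving hharm.1 hsp
    (continuousOn_diskMap hα hα0 ha hd0)
    (fun z hz => by rw [diskMap_of_norm_eq_one hα hα0 ha hz, hb z hz])
    (by simp [diskMap, diskPrimitive])
  exact ⟨diskMap α a d, diskMapCoeff α a d,
    ⟨hharm, hasSeriesForm_diskMap hα hα0 ha hd0, hsp, hbij.1, hbij.2⟩,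
    heinzQuantity_diskMapCoeff hα a d⟩

end DiskMapConstruction

/-! ### A boundary point lemma for harmonic maps -/

lemma norm_le_of_forall_norm_eq_one {C : ℝ} {f : ℂ → ℂ} (hf : DifferentiableOn ℂ f (Metric.ball 0 1))
    (hc : ContinuousOn f (Metric.closedBall 0 1)) (hC : ∀ z : ℂ, ‖z‖ = 1 → ‖f z‖ ≤ C) {z : ℂ}
    (hz : ‖z‖ ≤ 1) : ‖f z‖ ≤ C := by
  refine Complex.norm_le_of_forall_mem_frontier_norm_le (U := Metric.ball 0 1) Metric.isBounded_ball
    ⟨hf, by rwa [closure_ball _ one_ne_zero]⟩ (fun w hw => hC w ?_) ?_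
  · rw [frontier_ball _ one_ne_zero] at hw
    simpa using hw
  · rw [closure_ball _ one_ne_zero]
    simpa using hz

lemma re_le_of_forall_norm_eq_one {C : ℝ} {f : ℂ → ℂ} (hf : DifferentiableOn ℂ f (Metric.ball 0 1))
    (hc : ContinuousOn f (Metric.closedBall 0 1)) (hC : ∀ z : ℂ, ‖z‖ = 1 → (f z).re ≤ C) {z : ℂ}
    (hz : ‖z‖ ≤ 1) : (f z).re ≤ C := by
  have := norm_le_of_forall_norm_eq_one (C := Real.exp C) (f := fun z => Complex.exp (f z))
    hf.cexp hc.cexp (fun w hw => by rw [Complex.norm_exp]; exact Real.exp_le_exp.2 (hC w hw)) hz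
  rwa [Complex.norm_exp, Real.exp_le_exp] at this

/-- A quantitative Hopf lemma for the real part of a holomorphic function. -/
lemma half_le_re_mul_deriv {Φ : ℂ → ℂ} {z₀ δ : ℂ} (hΦ : DifferentiableOn ℂ Φ (Metric.ball 0 1))
    (hc : ContinuousOn Φ (Metric.closedBall 0 1)) (h0 : Φ 0 = 0)
    (hle : ∀ z : ℂ, ‖z‖ = 1 → (Φ z).re ≤ 1) (hz₀ : ‖z₀‖ = 1) (h1 : (Φ z₀).re = 1)
    (hd : HasDerivAt Φ δ z₀) : 1 / 2 ≤ (z₀ * δ).re := by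
  have hre : ∀ z : ℂ, ‖z‖ ≤ 1 → (Φ z).re ≤ 1 := fun z hz => re_le_of_forall_norm_eq_one hΦ hc hle hz
  have hne : ∀ z : ℂ, ‖z‖ ≤ 1 → 2 - Φ z ≠ 0 := fun z hz h => by
    have := hre z hz
    rw [sub_eq_zero] at h
    rw [← h] at this
    norm_num at this
  -- `w ↦ w / (2 - w)` maps the half plane `Re w ≤ 1` into the closed unit disk and fixes `0`, so
  -- the Schwarz lemma applies.
  have hS : ∀ z : ℂ, ‖z‖ < 1 → ‖Φ z‖ ≤ ‖z‖ * ‖2 - Φ z‖ := fun z hz => by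
    have := Complex.norm_le_norm_of_mapsTo_ball (f := fun z => Φ z / (2 - Φ z)) (R := 1) (z := z)
      (hΦ.div (hΦ.const_sub 2) fun w hw => hne w (by simpa using (Metric.mem_ball.1 hw).le))
      (fun w hw => by
        have hw' : ‖w‖ ≤ 1 := by simpa using (Metric.mem_ball.1 hw).le
        rw [mem_closedBall_zero_iff, norm_div]
        refine div_le_one_of_le₀ ?_ (norm_nonneg _)
        have := hre w hw'
        rw [← abs_norm (Φ w), ← abs_norm (2 - Φ w), ← sq_le_sq, ← Complex.normSq_eq_norm_sq,
          ← Complex.normSq_eq_norm_sq, Complex.normSq_apply, Complex.normSq_apply]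
        simp
        nlinarith) (by simp [h0]) hz
    rwa [norm_div, div_le_iff₀ (norm_pos_iff.2 (hne z hz.le))] at this
  have hφ : HasDerivAt (fun r : ℝ => Φ (r * z₀)) (z₀ * δ) 1 := by
    have hl : HasDerivAt (fun r : ℝ => (r : ℂ) * z₀) z₀ 1 := by
      simpa using (Complex.ofRealCLM.hasDerivAt (x := (1:ℝ))).mul_const z₀
    have hd' : HasDerivAt Φ δ (((1:ℝ) : ℂ) * z₀) := by simpa using hd
    have := hd'.scomp (1:ℝ) hl
    rwa [smul_eq_mul] at this
  have hp : HasDerivAt (fun r : ℝ => (Φ (r * z₀)).re) (z₀ * δ).re 1 :=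
    Complex.reCLM.hasFDerivAt.comp_hasDerivAt (1:ℝ) hφ
  have hq : HasDerivAt (fun r : ℝ => (Φ (r * z₀)).im) (z₀ * δ).im 1 :=
    Complex.imCLM.hasFDerivAt.comp_hasDerivAt (1:ℝ) hφ
  set p : ℝ → ℝ := fun r => (Φ (r * z₀)).re with hpdef
  set q : ℝ → ℝ := fun r => (Φ (r * z₀)).im with hqdef
  -- This function of `r` is nonnegative for `r < 1` and vanishes at `1`, where `|2 - Φ| = |Φ|`. Its
  -- derivative there, `2(1 + q²) - 4p'`, is therefore at most `0`.
  have hψ : HasDerivAt (fun r : ℝ => r ^ 2 * ((2 - p r) ^ 2 + q r ^ 2) - (p r ^ 2 + q r ^ 2)) _ 1 :=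
    ((hasDerivAt_pow 2 (1:ℝ)).mul ((((hp.const_sub 2).pow 2)).add (hq.pow 2))).sub
      ((hp.pow 2).add (hq.pow 2))
  have hp1 : p 1 = 1 := by simp [hpdef, h1]
  have hnn : ∀ r ∈ Ioo (0:ℝ) 1, 0 ≤ r ^ 2 * ((2 - p r) ^ 2 + q r ^ 2) - (p r ^ 2 + q r ^ 2) := by
    intro r hr
    have hnr : ‖(r : ℂ) * z₀‖ = r := by simp [hz₀, abs_of_pos hr.1]
    have := hS (r * z₀) (by rw [hnr]; exact hr.2)
    rw [hnr] at this
    have h2 : ‖Φ (r * z₀)‖ ^ 2 ≤ (r * ‖2 - Φ (r * z₀)‖) ^ 2 := by gcongr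
    rw [mul_pow, ← Complex.normSq_eq_norm_sq, ← Complex.normSq_eq_norm_sq, Complex.normSq_apply,
      Complex.normSq_apply] at h2
    simp only [Complex.sub_re, Complex.sub_im, Complex.re_ofNat, Complex.im_ofNat] at h2
    simp only [hpdef, hqdef]
    linarith
  have hlim := (hasDerivWithinAt_iff_tendsto_slope' (s := Iio (1:ℝ)) (by simp)).1
    (hψ.hasDerivWithinAt (s := Iio (1:ℝ)))
  have hle0 := le_of_tendsto hlim (b := 0) (by
    filter_upwards [Ioo_mem_nhdsLT (zero_lt_one (α := ℝ))] with r hr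
    rw [slope_def_field]
    refine div_nonpos_of_nonneg_of_nonpos ?_ (by linarith [hr.2])
    have := hnn r hr
    rw [hp1]
    linarith)
  generalize z₀ * δ = w at hle0 ⊢
  simp only [Nat.cast_ofNat, Pi.add_apply, Pi.pow_apply, hp1] at hle0
  norm_num at hle0
  nlinarith [sq_nonneg (q 1), hle0]

/-- The boundary point lemma for a harmonic map `h + conj g` which is unimodular on the circle and
whose tangential derivative there is a positive multiple of its rotation by a right angle. -/
lemma norm_deriv_lt_and_re_pos_of_norm_eq_one {h g : ℂ → ℂ} {z₀ h₁ g₁ : ℂ} {θ : ℝ}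
    (hh : DifferentiableOn ℂ h (Metric.ball 0 1)) (hg : DifferentiableOn ℂ g (Metric.ball 0 1))
    (hhc : ContinuousOn h (Metric.closedBall 0 1)) (hgc : ContinuousOn g (Metric.closedBall 0 1))
    (h0 : h 0 = 0) (g0 : g 0 = 0) (hF : ∀ z : ℂ, ‖z‖ = 1 → ‖h z + conj (g z)‖ = 1)
    (hz₀ : ‖z₀‖ = 1) (hdh : HasDerivAt h h₁ z₀) (hdg : HasDerivAt g g₁ z₀) (hθ : 0 < θ)
    (heq : z₀ * h₁ - conj (z₀ * g₁) = θ * (h z₀ + conj (g z₀))) :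
    ‖g₁‖ < ‖h₁‖ ∧ 0 < (conj (h z₀ + conj (g z₀)) * z₀ * h₁).re := by
  set ω : ℂ := h z₀ + conj (g z₀) with hω
  have hω1 : ‖ω‖ = 1 := hF z₀ hz₀
  have hωre : ω.re ^ 2 + ω.im ^ 2 = 1 := by
    have : ‖ω‖ ^ 2 = 1 := by rw [hω1]; norm_num
    rw [← Complex.normSq_eq_norm_sq, Complex.normSq_apply] at this
    linarith
  have hre : ∀ z, (conj ω * h z + ω * g z).re = (conj ω * (h z + conj (g z))).re := fun z => by
    simp [mul_add]
  -- On the circle the real part of this holomorphic function is `Re(ω̄ (h + ḡ)) ≤ 1`, with equality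
  -- at `z₀`.
  have key := half_le_re_mul_deriv (Φ := fun z => conj ω * h z + ω * g z) (z₀ := z₀)
    (δ := conj ω * h₁ + ω * g₁) ((hh.const_mul _).add (hg.const_mul _))
    (by fun_prop) (by simp [h0, g0]) (fun z hz => by
      rw [hre]
      refine (Complex.re_le_norm _).trans ?_
      rw [norm_mul, hF z hz, Complex.norm_conj, hω1, one_mul]) hz₀ (by
      rw [hre, ← hω]
      simp only [Complex.mul_re, Complex.conj_re, Complex.conj_im]
      linarith) ((hdh.const_mul _).add (hdg.const_mul _))
  have hX : ‖h₁‖ = ‖z₀ * h₁‖ := by rw [norm_mul, hz₀, one_mul]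
  have hY : ‖g₁‖ = ‖z₀ * g₁‖ := by rw [norm_mul, hz₀, one_mul]
  rw [hX, hY, mul_assoc]
  have key2 : 1 / 2 ≤ (conj ω * (z₀ * h₁) + ω * (z₀ * g₁)).re := by
    convert key using 2; ring
  set X := z₀ * h₁
  set Y := z₀ * g₁
  have e1 := congrArg Complex.re heq
  have e2 := congrArg Complex.im heq
  simp only [Complex.sub_re, Complex.sub_im, Complex.conj_re, Complex.conj_im, Complex.mul_re,
    Complex.mul_im, Complex.ofReal_re, Complex.ofReal_im, zero_mul, sub_zero, add_zero] at e1 e2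
  simp only [Complex.add_re, Complex.mul_re, Complex.conj_re, Complex.conj_im] at key2
  -- From `X = Ȳ + θω` one gets `|X|² - |Y|² = θ Re(ω̄X + ωY)` and `2 Re(ω̄X) = Re(ω̄X + ωY) + θ`,
  -- so the Hopf bound proves both claims.
  have hXr : X.re = Y.re + θ * ω.re := by linarith
  have hXi : X.im = -Y.im + θ * ω.im := by linarith
  rw [hXr, hXi] at key2
  constructor
  · rw [← abs_norm Y, ← abs_norm X, ← sq_lt_sq, ← Complex.normSq_eq_norm_sq,
      ← Complex.normSq_eq_norm_sq, Complex.normSq_apply, Complex.normSq_apply, hXr, hXi]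
    nlinarith [mul_le_mul_of_nonneg_left key2 hθ.le]
  · simp only [Complex.mul_re, Complex.conj_re, Complex.conj_im]
    rw [hXr, hXi]
    nlinarith [mul_le_mul_of_nonneg_left key2 hθ.le]

/-- If `|g₁| < |h₁|` on the unit circle and `V h₁` has positive real part there for some
holomorphic `V`, then `|g₁| < |h₁|` on the closed unit disk. -/
lemma norm_lt_norm_of_boundary {h₁ g₁ V : ℂ → ℂ}
    (hh : DifferentiableOn ℂ h₁ (Metric.ball 0 1)) (hg : DifferentiableOn ℂ g₁ (Metric.ball 0 1))
    (hV : DifferentiableOn ℂ V (Metric.ball 0 1))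
    (hhc : ContinuousOn h₁ (Metric.closedBall 0 1)) (hgc : ContinuousOn g₁ (Metric.closedBall 0 1))
    (hVc : ContinuousOn V (Metric.closedBall 0 1))
    (hlt : ∀ z : ℂ, ‖z‖ = 1 → ‖g₁ z‖ < ‖h₁ z‖) (hpos : ∀ z : ℂ, ‖z‖ = 1 → 0 < (V z * h₁ z).re)
    {z : ℂ} (hz : ‖z‖ ≤ 1) : ‖g₁ z‖ < ‖h₁ z‖ := by
  have hK : IsCompact (Metric.sphere (0:ℂ) 1) := isCompact_sphere _ _
  have hsub : Metric.sphere (0:ℂ) 1 ⊆ Metric.closedBall 0 1 := Metric.sphere_subset_closedBall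
  have hne : (Metric.sphere (0:ℂ) 1).Nonempty := ⟨1, by simp⟩
  have hΨc : ContinuousOn (fun z => V z * h₁ z) (Metric.closedBall 0 1) := hVc.mul hhc
  obtain ⟨z₁, hz₁, hmin⟩ := hK.exists_isMinOn hne
    (Complex.continuous_re.comp_continuousOn (hΨc.mono hsub))
  -- The minimum principle for `Re(V h₁)` excludes zeros of `h₁`, so the maximum principle is
  -- available for `g₁ / h₁`.
  have hm : ∀ z : ℂ, ‖z‖ ≤ 1 → h₁ z ≠ 0 := fun w hw h0 => by
    have := re_le_of_forall_norm_eq_one (f := fun z => -(V z * h₁ z)) (hV.mul hh).neg hΨc.neg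
      (C := -(V z₁ * h₁ z₁).re) (fun y hy => by
        have : (V z₁ * h₁ z₁).re ≤ (V y * h₁ y).re := hmin (a := y) (by simpa using hy)
        rw [Complex.neg_re]; exact neg_le_neg this) hw
    simp only [h0, mul_zero, neg_zero, Complex.zero_re] at this
    linarith [hpos z₁ (by simpa using hz₁)]
  have hQc : ContinuousOn (fun z => g₁ z / h₁ z) (Metric.closedBall 0 1) :=
    hgc.div hhc fun w hw => hm w (by simpa using hw)
  obtain ⟨z₂, hz₂, hmax⟩ := hK.exists_isMaxOn hne (hQc.mono hsub).norm
  have h2 : ‖z₂‖ = 1 := by simpa using hz₂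
  have := norm_le_of_forall_norm_eq_one (f := fun z => g₁ z / h₁ z) (C := ‖g₁ z₂ / h₁ z₂‖)
    (hg.div hh fun w hw => hm w (by simpa using (Metric.mem_ball.1 hw).le)) hQc
    (fun y hy => hmax (a := y) (by simpa using hy)) hz
  have h3 : ‖g₁ z₂ / h₁ z₂‖ < 1 := by
    rw [norm_div, div_lt_one (norm_pos_iff.2 (hm z₂ h2.le))]
    exact hlt z₂ h2
  have h4 := this.trans_lt h3
  rwa [norm_div, div_lt_one (norm_pos_iff.2 (hm z hz))] at h4

/-! ### Diagonal sums for opposite exponents. -/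

lemma abs_pochCoeff_le_one {s : ℝ} (hs : |s| ≤ 1) (n : ℕ) : |pochCoeff s n| ≤ 1 := by
  induction n with
  | zero => simp [pochCoeff_zero]
  | succ n ih =>
    rw [pochCoeff_succ, abs_div, abs_mul, abs_of_pos (show (0:ℝ) < n + 1 by positivity)]
    have h1 : |s + n| ≤ n + 1 := (abs_add_le _ _).trans (by rw [Nat.abs_cast]; linarith)
    rw [div_le_one (by positivity)]
    calc _ ≤ 1 * ((n:ℝ) + 1) := by gcongr
      _ = _ := one_mul _

lemma abs_pochDiag_le {s t x : ℝ} (hs : |s| ≤ 1) (ht : |t| ≤ 1) (hx0 : 0 ≤ x) (hx : x < 1) (k : ℕ) :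
    |pochDiag s t k x| ≤ (1 - x)⁻¹ := by
  rw [← Real.norm_eq_abs]
  refine tsum_of_norm_bounded (hasSum_geometric_of_lt_one hx0 hx) fun n => ?_
  rw [Real.norm_eq_abs, abs_mul, abs_mul, abs_of_nonneg (pow_nonneg hx0 n)]
  calc _ ≤ 1 * 1 * x ^ n := by
        gcongr
        · exact abs_pochCoeff_le_one hs _
        · exact abs_pochCoeff_le_one ht _
    _ = _ := by ring

lemma mul_pochCoeff_one_add (s : ℝ) (k : ℕ) : s * pochCoeff (1 + s) k = (s + k) * pochCoeff s k := by
  induction k with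
  | zero => simp [pochCoeff_zero]
  | succ k ih =>
    rw [pochCoeff_succ, pochCoeff_succ, ← mul_div_assoc, ← mul_assoc, ih]
    push_cast
    ring

lemma hypCoeff_symm (a b c : ℝ) (n : ℕ) : hypCoeff a b c n = hypCoeff b a c n := by
  induction n with
  | zero => simp [hypCoeff_zero]
  | succ n ih => rw [hypCoeff_succ, hypCoeff_succ, ih]; ring

lemma ordinaryHypergeometric_symm (a b c x : ℝ) :
    ordinaryHypergeometric a b c x = ordinaryHypergeometric b a c x := by
  simp only [ordinaryHypergeometric_eq_tsum_hypCoeff, hypCoeff_symm a b]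

/-- Euler's transformation again. With `s = ±1/3`, three times the factor `s + k` is plus or minus
the exponent of `z`, so tangential differentiation of the boundary expansion yields another closed
product. -/
lemma add_mul_pochDiag_neg {s x : ℝ} (hx : |x| < 1) (k : ℕ) :
    (s + k) * pochDiag s (-s) k x = s * (1 - x) * pochDiag (1 + s) (1 - s) k x := by
  have hx1 : 0 < 1 - x := by linarith [(abs_lt.1 hx).2]
  have h := ordinaryHypergeometric_euler (s + k) (-s) (c := (k:ℝ) + 1) (by positivity) hx
  rw [show s + k + -s - ((k:ℝ) + 1) = -1 by ring, Real.rpow_neg_one,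
    show (k:ℝ) + 1 - (s + k) = 1 - s by ring, show (k:ℝ) + 1 - -s = 1 + s + k by ring,
    ordinaryHypergeometric_symm, eq_inv_mul_iff_mul_eq₀ hx1.ne'] at h
  rw [← pochCoeff_mul_ordinaryHypergeometric, ← pochCoeff_mul_ordinaryHypergeometric, ← h]
  linear_combination (-(1 - x) * ordinaryHypergeometric (1 + s + k) (1 - s) ((k:ℝ) + 1) x) *
    mul_pochCoeff_one_add s k

/-! ### The extremal family with threefold symmetry. -/

/-- The sequence `A` placed at the indices `3 k + l`. -/
noncomputable def spread (l : ℕ) (A : ℕ → ℂ) : ℕ → ℂ := Function.extend (fun k => 3 * k + l) A 0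

lemma spread_injective (l : ℕ) : Function.Injective fun k : ℕ => 3 * k + l := fun a b h => by
  simp only at h; omega

lemma spread_apply (l : ℕ) (A : ℕ → ℂ) (k : ℕ) : spread l A (3 * k + l) = A k :=
  (spread_injective l).extend_apply A 0 k

lemma spread_eq_zero {l : ℕ} (A : ℕ → ℂ) {m : ℕ} (hm : m ∉ range fun k => 3 * k + l) :
    spread l A m = 0 := Function.extend_apply' _ _ _ hm

lemma HasSum.spread {l : ℕ} {A : ℕ → ℂ} {w : ℕ → ℂ} {S : ℂ}
    (h : HasSum (fun k => A k * w (3 * k + l)) S) : HasSum (fun m => spread l A m * w m) S := by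
  rw [← (spread_injective l).hasSum_iff (fun m hm => by rw [spread_eq_zero A hm, zero_mul])]
  simpa only [Function.comp_def, spread_apply] using h

lemma summable_sq_mul_norm_spread {l : ℕ} {A : ℕ → ℂ} {C b r : ℝ} (hb : 0 ≤ b) (hr : 0 ≤ r)
    (hbr : b * r ^ 3 < 1) (hA : ∀ k, ‖A k‖ ≤ C * b ^ k) :
    Summable fun m : ℕ => ((m : ℝ) + 1) ^ 2 * (‖spread l A m‖ * r ^ m) := by
  rw [← (spread_injective l).summable_iff (fun m hm => by rw [spread_eq_zero A hm]; simp)]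
  simp only [Function.comp_def, spread_apply]
  have hq : ‖b * r ^ 3‖ < 1 := by rwa [Real.norm_of_nonneg (by positivity)]
  have h0 := summable_pow_mul_geometric_of_norm_lt_one 0 hq
  have h1 := summable_pow_mul_geometric_of_norm_lt_one 1 hq
  have h2 := summable_pow_mul_geometric_of_norm_lt_one 2 hq
  refine Summable.of_nonneg_of_le (fun k => by positivity) (fun k => ?_)
    ((((h2.mul_left 9).add (h1.mul_left (6 * ((l:ℝ) + 1)))).add (h0.mul_left (((l:ℝ) + 1) ^ 2))).mul_left
      (C * r ^ l))
  calc _ ≤ (((3 * k + l : ℕ) : ℝ) + 1) ^ 2 * ((C * b ^ k) * r ^ (3 * k + l)) := by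
        gcongr; exact hA k
    _ = _ := by push_cast; ring

lemma summable_sq_mul_spread {l : ℕ} {A : ℕ → ℂ} {C b r : ℝ} (hb : 0 ≤ b) (hr : 0 ≤ r)
    (hbr : b * r ^ 3 < 1) (hA : ∀ k, ‖A k‖ ≤ C * b ^ k) :
    Summable fun m : ℕ => ((m : ℝ) + 1) * ‖spread l A m‖ * r ^ m :=
  (summable_sq_mul_norm_spread hb hr hbr hA).of_nonneg_of_le (fun m => by positivity) fun m => by
    rw [mul_assoc]
    gcongr
    nlinarith [(Nat.cast_nonneg m : (0:ℝ) ≤ m)]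

/-- The expansions on the unit circle used for the extremal harmonic maps. -/
lemma hasSum_cube_root {b : ℝ} (hb0 : 0 < b) (hb1 : b < 1) {z : ℂ} (hz : ‖z‖ = 1) (s : ℝ) (t : ℝ) :
    (1 - -b * z ^ 3) ^ (-(s : ℂ)) * (1 - conj (-b * z ^ 3)) ^ (-(t : ℂ)) =
      (∑' k : ℕ, (pochDiag s t k (b ^ 2) : ℂ) * (-b * z ^ 3) ^ k) +
        ∑' k : ℕ, (pochDiag t s (k + 1) (b ^ 2) : ℂ) * conj (-b * z ^ 3) ^ (k + 1) ∧
    (Summable fun k : ℕ => (pochDiag s t k (b ^ 2) : ℂ) * (-b * z ^ 3) ^ k) ∧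
    (Summable fun k : ℕ => (pochDiag t s (k + 1) (b ^ 2) : ℂ) * conj (-b * z ^ 3) ^ (k + 1)) := by
  have hZ : ‖-b * z ^ 3‖ = b := by simp [hz, abs_of_pos hb0]
  obtain ⟨h1, h2, h3⟩ := hasSum_one_sub_cpow_mul s t (z := -b * z ^ 3) (w := conj (-b * z ^ 3))
    (by rwa [hZ]) (by rwa [Complex.norm_conj, hZ]) (x := b ^ 2) (by
      rw [Complex.mul_conj, Complex.normSq_eq_norm_sq, hZ])
  exact ⟨h3, h1, h2⟩


/-- The Taylor coefficients of the holomorphic part of the extremal harmonic maps. -/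
noncomputable def holCoeff (b : ℝ) : ℕ → ℂ :=
  spread 0 fun k => (-b : ℂ) ^ k * pochDiag (1 / 3) (-(1 / 3)) k (b ^ 2)

/-- The Taylor coefficients of the antiholomorphic part of the extremal harmonic maps. -/
noncomputable def antiCoeff (b : ℝ) : ℕ → ℂ :=
  spread 1 fun k => (-b : ℂ) ^ (k + 1) * pochDiag (-(1 / 3)) (1 / 3) (k + 1) (b ^ 2)

lemma sq_lt_one_of_pos {b : ℝ} (hb0 : 0 < b) (hb1 : b < 1) : b ^ 2 < 1 := by nlinarith

lemma abs_sq_lt_one_of_pos {b : ℝ} (hb0 : 0 < b) (hb1 : b < 1) : |b ^ 2| < 1 := by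
  rw [abs_of_pos (by positivity)]; exact sq_lt_one_of_pos hb0 hb1

lemma summable_holCoeff {b r : ℝ} (hb0 : 0 < b) (hb1 : b < 1) (hr : 0 ≤ r) (hbr : b * r ^ 3 < 1) :
    (Summable fun m : ℕ => ((m : ℝ) + 1) ^ 2 * (‖holCoeff b m‖ * r ^ m)) ∧
    Summable fun m : ℕ => ((m : ℝ) + 1) * ‖holCoeff b m‖ * r ^ m := by
  have h : ∀ k, ‖(-b : ℂ) ^ k * pochDiag (1 / 3) (-(1 / 3)) k (b ^ 2)‖ ≤ (1 - b ^ 2)⁻¹ * b ^ k := by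
    intro k
    rw [norm_mul, norm_pow, norm_neg, Complex.norm_real, Complex.norm_real, Real.norm_eq_abs,
      Real.norm_eq_abs, abs_of_pos hb0, mul_comm]
    gcongr
    exact abs_pochDiag_le (by norm_num [abs_le]) (by norm_num [abs_le]) (by positivity)
      (sq_lt_one_of_pos hb0 hb1) k
  exact ⟨summable_sq_mul_norm_spread hb0.le hr hbr h, summable_sq_mul_spread hb0.le hr hbr h⟩

lemma summable_antiCoeff {b r : ℝ} (hb0 : 0 < b) (hb1 : b < 1) (hr : 0 ≤ r) (hbr : b * r ^ 3 < 1) :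
    Summable fun m : ℕ => ((m : ℝ) + 1) * ‖antiCoeff b m‖ * r ^ m := by
  refine summable_sq_mul_spread (C := (1 - b ^ 2)⁻¹) hb0.le hr hbr fun k => ?_
  have hx := sq_lt_one_of_pos hb0 hb1
  rw [norm_mul, norm_pow, norm_neg, Complex.norm_real, Complex.norm_real, Real.norm_eq_abs,
    Real.norm_eq_abs, abs_of_pos hb0, mul_comm]
  have h1 : 0 < 1 - b ^ 2 := by linarith
  exact mul_le_mul (abs_pochDiag_le (by norm_num [abs_le]) (by norm_num [abs_le]) (by positivity) hx _)
    (pow_le_pow_of_le_one hb0.le hb1.le (Nat.le_succ k)) (by positivity) (by positivity)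

/-- The cube root whose argument is the deviation of the extremal harmonic map on the circle from
the identity. -/
noncomputable def rotRoot (b : ℝ) (z : ℂ) : ℂ := (1 - -b * z ^ 3) ^ (((1 / 3 : ℝ)) : ℂ)

lemma re_one_sub_pos {b : ℝ} (hb0 : 0 < b) (hb1 : b < 1) {z : ℂ} (hz : ‖z‖ ≤ 1) :
    0 < (1 - -b * z ^ 3).re := by
  have h1 : ‖-b * z ^ 3‖ ≤ b := by
    rw [norm_mul, norm_neg, Complex.norm_real, norm_pow, Real.norm_of_nonneg hb0.le]
    exact mul_le_of_le_one_right hb0.le (pow_le_one₀ (norm_nonneg _) hz)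
  have := Complex.re_le_norm (-b * z ^ 3)
  rw [Complex.sub_re, Complex.one_re]
  linarith

lemma rotRoot_ne_zero {b : ℝ} (hb0 : 0 < b) (hb1 : b < 1) {z : ℂ} (hz : ‖z‖ ≤ 1) :
    rotRoot b z ≠ 0 := by
  have h := re_one_sub_pos hb0 hb1 hz
  rw [rotRoot, Ne, Complex.cpow_eq_zero_iff]
  rintro ⟨h0, -⟩
  rw [h0, Complex.zero_re] at h
  exact h.false

lemma differentiableAt_rotRoot {b : ℝ} (hb0 : 0 < b) (hb1 : b < 1) {z : ℂ} (hz : ‖z‖ ≤ 1) :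
    DifferentiableAt ℂ (rotRoot b) z := by
  refine DifferentiableAt.cpow_const (by fun_prop) (Or.inl (re_one_sub_pos hb0 hb1 hz))

lemma cpow_eq_rotRoot_zpow (b : ℝ) {z : ℂ} (n : ℤ) :
    (1 - -b * z ^ 3) ^ (((n / 3 : ℝ)) : ℂ) = rotRoot b z ^ n := by
  rw [rotRoot, ← Complex.cpow_int_mul]
  congr 1
  push_cast
  ring

lemma conj_cpow_eq_conj_rotRoot_zpow {b : ℝ} (hb0 : 0 < b) (hb1 : b < 1) {z : ℂ} (hz : ‖z‖ ≤ 1)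
    (n : ℤ) :
    (1 - conj (-b * z ^ 3)) ^ (((n / 3 : ℝ)) : ℂ) = conj (rotRoot b z) ^ n := by
  have h := Complex.conj_cpow (1 - -b * z ^ 3) ((n / 3 : ℝ) : ℂ) (by
    intro h
    have := re_one_sub_pos hb0 hb1 hz
    rw [Complex.arg_eq_pi_iff] at h
    linarith [h.1])
  rw [Complex.conj_ofReal, cpow_eq_rotRoot_zpow, map_zpow₀] at h
  rw [← h, map_sub, map_one]

/-- The boundary values of the extremal harmonic maps. -/
lemma holCoeff_add_antiCoeff {b : ℝ} (hb0 : 0 < b) (hb1 : b < 1) {z : ℂ} (hz : ‖z‖ = 1) :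
    (∑' m, holCoeff b m * z ^ (m + 1)) + conj (∑' m, antiCoeff b m * z ^ (m + 1)) =
      z * (rotRoot b z)⁻¹ * conj (rotRoot b z) := by
  obtain ⟨h0, h1, h2⟩ := hasSum_cube_root hb0 hb1 hz (1 / 3) (-(1 / 3))
  have hzz : conj z * z = 1 := by rw [mul_comm, Complex.mul_conj, Complex.normSq_eq_norm_sq, hz]; simp
  have e1 : HasSum (fun m => holCoeff b m * z ^ (m + 1)) _ :=
    HasSum.spread (w := fun m => z ^ (m + 1)) ((h1.hasSum.mul_left z).congr_fun fun k => by ring)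
  -- On the circle `z · conj(z³)^(k+1)` equals the conjugate of `z^(3k+2)`, which explains the shift
  -- by one in `antiCoeff`.
  have e2 : HasSum (fun m => antiCoeff b m * z ^ (m + 1)) _ :=
    HasSum.spread (w := fun m => z ^ (m + 1))
      (((Complex.hasSum_conj'.2 (h2.hasSum.mul_left z))).congr_fun fun k => by
        simp only [map_mul, map_pow, Complex.conj_conj, Complex.conj_ofReal, map_neg]
        linear_combination (-(-b:ℂ) ^ (k + 1) * pochDiag (-(1 / 3)) (1 / 3) (k + 1) (b ^ 2) * z ^ (3 * k + 2)) * hzz)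
  rw [e1.tsum_eq, e2.tsum_eq, Complex.conj_conj, ← mul_add, ← h0]
  have r1 := cpow_eq_rotRoot_zpow b (z := z) (-1)
  have r2 := conj_cpow_eq_conj_rotRoot_zpow hb0 hb1 hz.le 1
  rw [zpow_neg_one] at r1
  rw [zpow_one] at r2
  rw [← r1, ← r2, mul_assoc]
  norm_num

/-- The tangential derivative of the boundary values of the extremal harmonic maps. -/
lemma mul_holCoeff_sub_mul_antiCoeff {b : ℝ} (hb0 : 0 < b) (hb1 : b < 1) {z : ℂ} (hz : ‖z‖ = 1) :
    (∑' m : ℕ, ((m : ℂ) + 1) * holCoeff b m * z ^ (m + 1)) -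
        conj (∑' m : ℕ, ((m : ℂ) + 1) * antiCoeff b m * z ^ (m + 1)) =
      (1 - b ^ 2) * z * (rotRoot b z ^ 4 * conj (rotRoot b z) ^ 2)⁻¹ := by
  obtain ⟨h0, h1, h2⟩ := hasSum_cube_root hb0 hb1 hz (1 + 1 / 3) (1 - 1 / 3)
  have hzz : conj z * z = 1 := by rw [mul_comm, Complex.mul_conj, Complex.normSq_eq_norm_sq, hz]; simp
  have q1 := fun k => congrArg (fun x : ℝ => (x : ℂ)) (add_mul_pochDiag_neg (s := 1 / 3) (abs_sq_lt_one_of_pos hb0 hb1) k)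
  have q2 := fun k => congrArg (fun x : ℝ => (x : ℂ)) (add_mul_pochDiag_neg (s := -(1 / 3)) (abs_sq_lt_one_of_pos hb0 hb1) k)
  simp only [neg_neg, sub_neg_eq_add, ← sub_eq_add_neg] at q1 q2
  push_cast at q1 q2
  have e1 : HasSum (fun m => holCoeff b m * (((m : ℂ) + 1) * z ^ (m + 1))) _ :=
    HasSum.spread (w := fun m => ((m : ℂ) + 1) * z ^ (m + 1))
      ((h1.hasSum.mul_left ((1 - b ^ 2) * z)).congr_fun fun k => by
        push_cast
        linear_combination (3 * (-b : ℂ) ^ k * z ^ (3 * k + 1)) * q1 k)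
  have e2 : HasSum (fun m => antiCoeff b m * (((m : ℂ) + 1) * z ^ (m + 1))) _ :=
    HasSum.spread (w := fun m => ((m : ℂ) + 1) * z ^ (m + 1))
      (((Complex.hasSum_conj'.2 (h2.hasSum.mul_left (-(1 - b ^ 2) * z)))).congr_fun fun k => by
        simp only [map_mul, map_pow, Complex.conj_conj, Complex.conj_ofReal, map_neg, map_sub, map_one]
        have := q2 (k + 1)
        push_cast at this ⊢
        linear_combination ((1 - b ^ 2) * (-b:ℂ) ^ (k + 1) * pochDiag (1 - 1 / 3) (1 + 1 / 3) (k + 1) (b ^ 2) * z ^ (3 * k + 2)) * hzz + (3 * (-b : ℂ) ^ (k + 1) * z ^ (3 * k + 2)) * this)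
  rw [tsum_congr fun m : ℕ => show ((m : ℂ) + 1) * holCoeff b m * z ^ (m + 1) = holCoeff b m * (((m : ℂ) + 1) * z ^ (m + 1)) by ring,
    tsum_congr fun m : ℕ => show ((m : ℂ) + 1) * antiCoeff b m * z ^ (m + 1) = antiCoeff b m * (((m : ℂ) + 1) * z ^ (m + 1)) by ring,
    e1.tsum_eq, e2.tsum_eq, Complex.conj_conj]
  have r1 := cpow_eq_rotRoot_zpow b (z := z) (-4)
  have r2 := conj_cpow_eq_conj_rotRoot_zpow hb0 hb1 hz.le (-2)
  rw [mul_inv, show (rotRoot b z ^ 4)⁻¹ = rotRoot b z ^ (-4:ℤ) by rw [zpow_neg]; rfl,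
    show (conj (rotRoot b z) ^ 2)⁻¹ = conj (rotRoot b z) ^ (-2:ℤ) by rw [zpow_neg]; rfl, ← r1, ← r2]
  rw [show (((-4 : ℤ) / 3 : ℝ) : ℂ) = -((1 + 1 / 3 : ℝ) : ℂ) by push_cast; norm_num,
    show (((-2 : ℤ) / 3 : ℝ) : ℂ) = -((1 - 1 / 3 : ℝ) : ℂ) by push_cast; norm_num, h0]
  ring

lemma holCoeff_zero (b : ℝ) : holCoeff b 0 = pochDiag (1 / 3) (-(1 / 3)) 0 (b ^ 2) := by
  have := spread_apply 0 (fun k => (-b : ℂ) ^ k * pochDiag (1 / 3) (-(1 / 3)) k (b ^ 2)) 0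
  simpa [holCoeff] using this

lemma antiCoeff_zero (b : ℝ) : antiCoeff b 0 = 0 :=
  spread_eq_zero _ fun ⟨k, hk⟩ => by simp only at hk; omega

lemma norm_holCoeff_add_antiCoeff {b : ℝ} (hb0 : 0 < b) (hb1 : b < 1) {z : ℂ} (hz : ‖z‖ = 1) :
    ‖(∑' m, holCoeff b m * z ^ (m + 1)) + conj (∑' m, antiCoeff b m * z ^ (m + 1))‖ = 1 := by
  rw [holCoeff_add_antiCoeff hb0 hb1 hz, norm_mul, norm_mul, norm_inv, Complex.norm_conj, hz,
    one_mul, inv_mul_cancel₀ (norm_ne_zero_iff.2 (rotRoot_ne_zero hb0 hb1 hz.le))]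

/-- The extremal harmonic maps have positive Jacobian on the closed disk. -/
theorem norm_deriv_antiCoeff_lt {b : ℝ} (hb0 : 0 < b) (hb1 : b < 1) {z : ℂ} (hz : ‖z‖ ≤ 1) :
    ‖∑' m : ℕ, ((m : ℂ) + 1) * antiCoeff b m * z ^ m‖ <
      ‖∑' m : ℕ, ((m : ℂ) + 1) * holCoeff b m * z ^ m‖ := by
  -- The coefficients decay like `b^(m/3)`, so both series converge on a larger disk and are
  -- differentiable on the circle.
  obtain ⟨R, hR1, hbR⟩ : ∃ R : ℝ, 1 < R ∧ b * R ^ 3 < 1 := by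
    have h : ∀ᶠ R : ℝ in 𝓝[>] 1, b * R ^ 3 < 1 := by
      refine nhdsWithin_le_nhds (ContinuousAt.eventually_lt (by fun_prop) (by fun_prop) ?_)
      simpa using hb1
    obtain ⟨R, h1, h2⟩ := (h.and self_mem_nhdsWithin).exists
    exact ⟨R, h2, h1⟩
  have hR0 : 0 < R := by linarith
  have dh : ∀ w ∈ Metric.ball (0:ℂ) R, HasDerivAt _ _ w := fun w hw =>
    hasDerivAt_tsum_mul_pow_succ hR0 (summable_holCoeff hb0 hb1 hR0.le hbR).2
      (mem_ball_zero_iff.1 hw)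
  have dg : ∀ w ∈ Metric.ball (0:ℂ) R, HasDerivAt _ _ w := fun w hw =>
    hasDerivAt_tsum_mul_pow_succ hR0 (summable_antiCoeff hb0 hb1 hR0.le hbR) (mem_ball_zero_iff.1 hw)
  set h : ℂ → ℂ := fun z => ∑' m : ℕ, holCoeff b m * z ^ (m + 1) with hh
  set g : ℂ → ℂ := fun z => ∑' m : ℕ, antiCoeff b m * z ^ (m + 1) with hg
  set h₁ : ℂ → ℂ := fun z => ∑' m : ℕ, ((m : ℂ) + 1) * holCoeff b m * z ^ m with hh₁
  set g₁ : ℂ → ℂ := fun z => ∑' m : ℕ, ((m : ℂ) + 1) * antiCoeff b m * z ^ m with hg₁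
  have hd : DifferentiableOn ℂ h (Metric.ball 0 R) := fun w hw =>
    (dh w hw).differentiableAt.differentiableWithinAt
  have gd : DifferentiableOn ℂ g (Metric.ball 0 R) := fun w hw =>
    (dg w hw).differentiableAt.differentiableWithinAt
  have h1d : DifferentiableOn ℂ h₁ (Metric.ball 0 R) :=
    (hd.deriv Metric.isOpen_ball).congr fun w hw => (dh w hw).deriv.symm
  have g1d : DifferentiableOn ℂ g₁ (Metric.ball 0 R) :=
    (gd.deriv Metric.isOpen_ball).congr fun w hw => (dg w hw).deriv.symm
  have hVd : DifferentiableOn ℂ (fun z => rotRoot b z ^ 2) (Metric.closedBall 0 1) := fun w hw =>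
    ((differentiableAt_rotRoot hb0 hb1 (by simpa using hw)).pow 2).differentiableWithinAt
  have s1 : Metric.ball (0:ℂ) 1 ⊆ Metric.ball 0 R := Metric.ball_subset_ball hR1.le
  have s2 : Metric.closedBall (0:ℂ) 1 ⊆ Metric.ball 0 R := Metric.closedBall_subset_ball hR1
  have key : ∀ z₀ : ℂ, ‖z₀‖ = 1 → ‖g₁ z₀‖ < ‖h₁ z₀‖ ∧ 0 < (rotRoot b z₀ ^ 2 * h₁ z₀).re := by
    intro z₀ hz₀
    have hm : z₀ ∈ Metric.ball (0:ℂ) R := s2 (by simp [hz₀])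
    have hv := rotRoot_ne_zero hb0 hb1 hz₀.le
    have hvc : conj (rotRoot b z₀) ≠ 0 := (map_ne_zero _).2 hv
    have hN : 0 < Complex.normSq (rotRoot b z₀) := Complex.normSq_pos.2 hv
    have hNe : (Complex.normSq (rotRoot b z₀) : ℂ) = rotRoot b z₀ * conj (rotRoot b z₀) :=
      (Complex.mul_conj _).symm
    have hF : h z₀ + conj (g z₀) = z₀ * (rotRoot b z₀)⁻¹ * conj (rotRoot b z₀) :=
      holCoeff_add_antiCoeff hb0 hb1 hz₀
    have hx : 0 < 1 - b ^ 2 := by linarith [sq_lt_one_of_pos hb0 hb1]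
    have e1 : z₀ * h₁ z₀ = ∑' m : ℕ, ((m : ℂ) + 1) * holCoeff b m * z₀ ^ (m + 1) := by
      rw [hh₁, ← tsum_mul_left]; exact tsum_congr fun m => by ring
    have e2 : z₀ * g₁ z₀ = ∑' m : ℕ, ((m : ℂ) + 1) * antiCoeff b m * z₀ ^ (m + 1) := by
      rw [hg₁, ← tsum_mul_left]; exact tsum_congr fun m => by ring
    obtain ⟨k1, k2⟩ := norm_deriv_lt_and_re_pos_of_norm_eq_one (hd.mono s1) (gd.mono s1)
      (hd.mono s2).continuousOn (gd.mono s2).continuousOn (by simp [hh]) (by simp [hg])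
      (fun w hw => norm_holCoeff_add_antiCoeff hb0 hb1 hw) hz₀ (dh z₀ hm) (dg z₀ hm)
      (θ := (1 - b ^ 2) / Complex.normSq (rotRoot b z₀) ^ 3) (by positivity) (by
        rw [e1, e2, mul_holCoeff_sub_mul_antiCoeff hb0 hb1 hz₀, hF]
        push_cast
        rw [hNe]
        field_simp)
    refine ⟨k1, ?_⟩
    rw [hF] at k2
    have hzz : conj z₀ * z₀ = 1 := by
      rw [mul_comm, Complex.mul_conj, Complex.normSq_eq_norm_sq, hz₀]; simp
    -- For the boundary value `F = z v̄ / v` one has `F̄ z = v² / |v|²`, so up to a positive factor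
    -- the boundary quantity is `V h₁` with the holomorphic `V = v²`.
    have e3 : rotRoot b z₀ ^ 2 * h₁ z₀ = (Complex.normSq (rotRoot b z₀) : ℂ) *
        (conj (z₀ * (rotRoot b z₀)⁻¹ * conj (rotRoot b z₀)) * z₀ * h₁ z₀) := by
      rw [hNe]
      simp only [map_mul, map_inv₀, Complex.conj_conj]
      field_simp
      linear_combination (-h₁ z₀) * hzz
    rw [e3, Complex.re_ofReal_mul]
    exact mul_pos hN k2
  exact norm_lt_norm_of_boundary (h₁ := h₁) (g₁ := g₁) (V := fun z => rotRoot b z ^ 2)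
    (h1d.mono s1) (g1d.mono s1) (hVd.mono Metric.ball_subset_closedBall)
    (h1d.mono s2).continuousOn (g1d.mono s2).continuousOn hVd.continuousOn
    (fun w hw => (key w hw).1) (fun w hw => (key w hw).2) hz

/-! ### The sharp constant and the conclusion. -/

lemma Gamma_two_thirds_mul_Gamma_four_thirds :
    Real.Gamma (2 / 3) * Real.Gamma (4 / 3) = 2 * Real.pi / (3 * √3) := by
  have h1 := Real.Gamma_mul_Gamma_one_sub (1 / 3)
  have h2 := Real.Gamma_add_one (s := 1 / 3) (by norm_num)
  rw [show Real.pi * (1 / 3) = Real.pi / 3 by ring, Real.sin_pi_div_three] at h1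
  norm_num at h1 h2
  rw [h2]
  have h3 : (0:ℝ) < √3 := by positivity
  have : Real.Gamma (2 / 3) * (1 / 3 * Real.Gamma (1 / 3)) = 1 / 3 * (Real.pi / (√3 / 2)) := by
    rw [← h1]; ring
  rw [this]
  field_simp

/-- The first holomorphic coefficient is `F(1/3, -1/3; 1; b²)`, with limit `1 / (Γ(2/3) Γ(4/3)) =
3√3/(2π)` by Gauss and the reflection formula. -/
lemma tendsto_norm_sq_holCoeff_zero :
    Tendsto (fun b : ℝ => ‖holCoeff b 0‖ ^ 2 + ‖antiCoeff b 0‖ ^ 2) (𝓝[<] 1)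
      (𝓝 (27 / (4 * Real.pi ^ 2))) := by
  have h := tendsto_ordinaryHypergeometric_one (a := 1 / 3) (b := -(1 / 3)) (c := 1)
    (by norm_num) (by norm_num)
  rw [tsum_hypCoeff_eq (by norm_num) (by norm_num)
    (fun n hn => by have := (Nat.cast_nonneg n : (0:ℝ) ≤ n); linarith)
    (fun n hn => by have := (Nat.cast_nonneg n : (0:ℝ) ≤ n); linarith)] at h
  have hsq : Tendsto (fun b : ℝ => b ^ 2) (𝓝[<] 1) (𝓝[<] 1) := by
    refine tendsto_nhdsWithin_iff.2 ⟨?_, ?_⟩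
    · have : Tendsto (fun b : ℝ => b ^ 2) (𝓝 1) (𝓝 (1 ^ 2)) := (continuous_pow 2).tendsto 1
      rw [one_pow] at this
      exact this.mono_left nhdsWithin_le_nhds
    · filter_upwards [Ioo_mem_nhdsLT (zero_lt_one (α := ℝ))] with b hb
      exact sq_lt_one_of_pos hb.1 hb.2
  have hval : (Real.Gamma 1 * Real.Gamma (1 - 1 / 3 - -(1 / 3)) /
      (Real.Gamma (1 - 1 / 3) * Real.Gamma (1 - -(1 / 3)))) ^ 2 = 27 / (4 * Real.pi ^ 2) := by
    norm_num
    rw [← mul_inv, mul_comm, Gamma_two_thirds_mul_Gamma_four_thirds, inv_pow, div_pow, mul_pow, mul_pow,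
      Real.sq_sqrt (by norm_num)]
    field_simp
    norm_num
  rw [← hval]
  refine ((h.comp hsq).pow 2).congr fun b => ?_
  rw [holCoeff_zero, antiCoeff_zero, ← pochCoeff_mul_ordinaryHypergeometric, pochCoeff_zero]
  simp

/-- Harmonic maps of the disk onto itself, smooth up to the boundary, for which the Heinz
quantity is arbitrarily close to the sharp bound. -/
theorem eventually_exists_heinzQuantity_lt {ε : ℝ} (hε : 0 < ε) :
    ∀ᶠ α in 𝓝[≤] (0:ℝ), ∃ u c, IsABHarmonicDiskMap α 0 u c ∧
      heinzQuantity α 0 c < 27 / (4 * Real.pi ^ 2) + ε := by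
  obtain ⟨b, hb, hb0, hb1⟩ := ((tendsto_norm_sq_holCoeff_zero.eventually_lt_const
    (lt_add_of_pos_right _ hε)).and (Ioo_mem_nhdsLT (zero_lt_one (α := ℝ)))).exists
  have h1 : b * 1 ^ 3 < 1 := by linarith
  have hs := (summable_holCoeff hb0 hb1 zero_le_one h1).1
  have hs' := summable_antiCoeff hb0 hb1 zero_le_one h1
  simp only [one_pow, mul_one] at hs hs'
  filter_upwards [eventually_exists_isABHarmonicDiskMap hs hs'
    (fun z hz => norm_holCoeff_add_antiCoeff hb0 hb1 hz)
    (fun z hz => norm_deriv_antiCoeff_lt hb0 hb1 hz)] with α ⟨u, c, hu, hc⟩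
  exact ⟨u, c, hu, hc ▸ hb⟩

/-- Heinz's inequality for `(α,β)`-harmonic maps of the disk onto itself. The lower bound is
asymptotically sharp as `α, β → 0`: it is the greatest lower bound for `α = β = 0`, and no larger
constant is a lower bound for all maps with `(α,β)` in a punctured neighbourhood of `(0,0)`. -/
theorem mainTheorem1 :
    (∀ α β : ℝ, (∀ n : ℕ, α ≠ -((n : ℝ) + 1)) → (∀ n : ℕ, β ≠ -((n : ℝ) + 1)) → -1 < α + β →
      ∀ (u : ℂ → ℂ) (c : ℤ → ℂ), IsABHarmonicDiskMap α β u c →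
        27 / (4 * Real.pi ^ 2) ≤ heinzQuantity α β c) ∧
    (∀ ε : ℝ, 0 < ε → ∃ (u : ℂ → ℂ) (c : ℤ → ℂ), IsABHarmonicDiskMap 0 0 u c ∧
      heinzQuantity 0 0 c < 27 / (4 * Real.pi ^ 2) + ε) ∧
    (∀ ε : ℝ, 0 < ε → ∃ᶠ p : ℝ × ℝ in 𝓝[≠] (0, 0),
      ∃ (u : ℂ → ℂ) (c : ℤ → ℂ), IsABHarmonicDiskMap p.1 p.2 u c ∧
        heinzQuantity p.1 p.2 c < 27 / (4 * Real.pi ^ 2) + ε) := by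
  refine ⟨fun α β hα hβ hαβ u c h => h.heinz_inequality hα hβ hαβ,
    -- The one-sided neighbourhood filter contains the point `0`, so the undeformed harmonic case
    -- comes from the same statement.
    fun ε hε => (eventually_exists_heinzQuantity_lt hε).self_of_nhdsWithin self_mem_Iic,
    fun ε hε => ?_⟩
  -- The origin is approached along the negative `α`-axis, which avoids the origin itself.
  have ht : Tendsto (fun α : ℝ => (α, (0:ℝ))) (𝓝[<] 0) (𝓝[≠] (0, 0)) := by
    refine tendsto_nhdsWithin_iff.2 ⟨?_, ?_⟩
    · exact ((continuous_id.prodMk continuous_const).tendsto (0:ℝ)).mono_left nhdsWithin_le_nhds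
    · filter_upwards [self_mem_nhdsWithin] with α hα h
      exact (ne_of_lt hα) (congrArg Prod.fst h)
  exact ht.frequently ((eventually_exists_heinzQuantity_lt hε).filter_mono
    (nhdsWithin_mono _ Iio_subset_Iic_self)).frequently
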